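/- **Lemma 5.6.** Let $K$ be a field. All graphs $E=(E^0,E^1,r,s)$ are finite and directed, and $L_K(E)$ is the Leavitt path algebra: the $K$-algebra generated by $v\in E^0$ and $e,e^*$ ($e\in E^1$), where the $v$ are orthogonal idempotents with $\sum_v v=1$, $s(e)e=e=e\,r(e)$, $r(e)e^*=e^*=e^*s(e)$, $e^*f=\delta_{e,f}\,r(e)$, and $v=\sum_{s(e)=v}ee^*$ for every vertex $v$ that is not a sink. A *cycle* of $E$ is either a sink $w$ (a cycle of length $0$, with $s(w)=w$), or a proper cycle, i.e. a closed path $c=e_1\cdots e_n$, $n\ge 1$, whose vertices $s(e_1),\dots,s(e_n)$ are distinct; then $s(c)=s(e_1)$ and $c^0=\{s(e_1),\dots,s(e_n)\}$. A *source cycle* is a proper cycle $c$ such that every edge $e$ with $r(e)\in c^0$ is an edge of $c$. For a cycle $c$ of $E$ let $\mathcal P^E_c$ be the set of all paths $\gamma$ of $E$ with range $s(c)$ that, if $c$ is a proper cycle, are not of the form $\gamma=\gamma'c$. Let $K[[\mathcal P^E_c]]$ be the space of all maps $\mathcal P^E_c\to K$, written as formal series $\sum_\mu \mathfrak p(\mu)\mu$,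 let $\mathbb I_c=\{1,2,3,\dots\}$ if $c$ is a proper cycle and $\mathbb I_c=\{1\}$ if $c$ is a sink, and put $$\widehat U_{E,c-1}=\bigoplus_{j\in\mathbb I_c}K[[\mathcal P^E_c]]\,\alpha_{c,j}.$$ This is a left $L_K(E)$-module as follows; the action is described on the terms $\mu\alpha_{c,j}$ with $\mu\in\mathcal P^E_c$ and applied to formal series termwise, and $\alpha_{c,0}=0$. A vertex $v$ fixes $\mu\alpha_{c,j}$ if $s(\mu)=v$ and kills it otherwise. An edge $e$ sends $\mu\alpha_{c,j}$ to $(e\mu)\alpha_{c,j}$ if $r(e)=s(\mu)$ and $e\mu\in\mathcal P^E_c$, to $\alpha_{c,j}+\alpha_{c,j-1}$ if $e\mu=c$, and to $0$ if $r(e)\ne s(\mu)$. A ghost edge $e^*$ sends $\mu\alpha_{c,j}$ to $\mu'\alpha_{c,j}$ if $\mu=e\mu'$, to $e_2\cdots e_n\sum_{l=0}^{j-1}(-1)^l\alpha_{c,j-l}$ if $c=e_1\cdots e_n$ is a proper cycle, $\mu=s(c)$ and $e=e_1$, and to $0$ otherwise. (Here $\alpha_{c,j}$ stands for $s(c)\alpha_{c,j}$,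 and $e_2\cdots e_n$ for $s(c)$ if $n=1$.) Let $d=d_1\cdots d_r$ be a source cycle of length $r\ge 2$ in $E$. Let $F=F_{E,d}$ be the graph with vertex set $(E^0\setminus d^0)\sqcup\{\overline v\}$ whose edges are: the edges $e$ of $E$ with $s(e)\notin d^0$, with the same source and range as in $E$; for each edge $f$ of $E$ with $s(f)\in d^0$ and $r(f)\notin d^0$ an edge $\varphi(f)$ from $\overline v$ to $r(f)$; and a loop $d'$ at $\overline v$. A cycle $c$ of $E$ which does not meet $d^0$ is also a cycle of $F$; if $c$ meets $d^0$ (so that $c$ is $d$ or a rotation of $d$), then $\widehat U_{F,c-1}$ denotes $\widehat U_{F,d'-1}$. Then there are mutually inverse ($K$-linear) equivalences of categories of left modules $$G_1: L_K(E)\text{-Mod}\to L_K(F)\text{-Mod},\qquad G_2: L_K(F)\text{-Mod}\to L_K(E)\text{-Mod}$$ such that $\widehat U_{E,c-1}\cong G_2\big(\widehat U_{F,c-1}\big)$ as left $L_K(E)$-modules for every cycle $c$ of $E$. -/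

import Mathlib

universe u v w

/-! ### Finite directed graphs, paths and cycles -/

/-- A finite directed graph `E = (E⁰, E¹, r, s)`; loops and parallel edges are allowed. -/
structure FinGraph where
  /-- the set `E⁰` of vertices -/
  Vertex : Type u
  /-- the set `E¹` of edges -/
  Edge : Type v
  /-- the source map -/
  s : Edge → Vertex
  /-- the range map -/
  r : Edge → Vertex
  finite_vertex : Finite Vertex
  finite_edge : Finite Edge

namespace FinGraph

attribute [instance] FinGraph.finite_vertex FinGraph.finite_edge

/-- A sink is a vertex which emits no edges. -/
def IsSink (E : FinGraph.{u, v}) (x : E.Vertex) : Prop := ∀ e : E.Edge, E.s e ≠ x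

/-- `E.IsWalk x l y`: the list of edges `l = [e₁, …, eₙ]` is a path from `x` to `y`, that is
`x = s(e₁)`, `r(eᵢ) = s(eᵢ₊₁)`, `r(eₙ) = y` (and `x = y` if `l` is empty). -/
def IsWalk (E : FinGraph.{u, v}) : E.Vertex → List E.Edge → E.Vertex → Prop
  | x, [], y => x = y
  | x, e :: l, y => E.s e = x ∧ E.IsWalk (E.r e) l y

/-- A finite path in `E`; the vertices are the paths with an empty list of edges. -/
@[ext]
structure Path (E : FinGraph.{u, v}) where
  /-- the source `s(ρ)` of the path -/
  src : E.Vertex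
  /-- the range `r(ρ)` of the path -/
  tgt : E.Vertex
  /-- the edges `e₁, …, eₙ` of the path, in this order -/
  edges : List E.Edge
  isWalk : E.IsWalk src edges tgt

namespace Path

variable {E : FinGraph.{u, v}}

/-- The trivial path at the vertex `x`. -/
def trivial (x : E.Vertex) : E.Path := ⟨x, x, [], rfl⟩

/-- The concatenation `e γ` of an edge and a path with `r(e) = s(γ)`. -/
def cons (e : E.Edge) (γ : E.Path) (h : E.r e = γ.src) : E.Path :=
  ⟨E.s e, γ.tgt, e :: γ.edges, rfl, h ▸ γ.isWalk⟩

/-- The path `e₂ ⋯ eₙ` obtained from `e₁ e₂ ⋯ eₙ` by removing its first edge (a trivial path is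
left unchanged). -/
def tail : E.Path → E.Path
  | ⟨x, y, [], h⟩ => ⟨x, y, [], h⟩
  | ⟨_, y, e :: l, h⟩ => ⟨E.r e, y, l, h.2⟩

/-- The length of a path. -/
def length (γ : E.Path) : ℕ := γ.edges.length

/-- The set `c⁰ = {s(e₁), …, s(eₙ)}` of the vertices from which the edges of `c` start. -/
def vertices (c : E.Path) : Set E.Vertex := {x | ∃ e ∈ c.edges, E.s e = x}

/-- A proper cycle: a closed path `e₁ ⋯ eₙ` with `n ≥ 1` and `s(eᵢ) ≠ s(eⱼ)` for all `i ≠ j`. -/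
def IsProperCycle (c : E.Path) : Prop :=
  c.edges ≠ [] ∧ c.tgt = c.src ∧ (c.edges.map E.s).Nodup

/-- A source cycle: a proper cycle without entrances, that is each edge whose range is a vertex
of the cycle is an edge of the cycle. -/
def IsSourceCycle (c : E.Path) : Prop :=
  c.IsProperCycle ∧ ∀ e : E.Edge, E.r e ∈ c.vertices → e ∈ c.edges

/-- A cycle: either a sink (regarded as a cycle of length `0`) or a proper cycle. -/
def IsCycle (c : E.Path) : Prop :=
  (c.edges = [] ∧ E.IsSink c.src) ∨ c.IsProperCycle

theorem IsCycle.tgt_eq {c : E.Path} (hc : c.IsCycle) : c.tgt = c.src := by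
  rcases hc with ⟨h, -⟩ | h
  · have := c.isWalk
    rw [h] at this
    exact this.symm
  · exact h.2.1

@[simp] theorem cons_edges (e : E.Edge) (γ : E.Path) (h : E.r e = γ.src) :
    (cons e γ h).edges = e :: γ.edges := rfl

@[simp] theorem cons_src (e : E.Edge) (γ : E.Path) (h : E.r e = γ.src) :
    (cons e γ h).src = E.s e := rfl

@[simp] theorem cons_tgt (e : E.Edge) (γ : E.Path) (h : E.r e = γ.src) :
    (cons e γ h).tgt = γ.tgt := rfl

@[simp] theorem tail_cons (e : E.Edge) (γ : E.Path) (h : E.r e = γ.src) :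
    (cons e γ h).tail = γ := by
  obtain ⟨x, y, l, hl⟩ := γ
  have h' : E.r e = x := h
  subst h'
  rfl

/-- Every path is trivial or of the form `e γ`. -/
theorem eq_trivial_or_cons (μ : E.Path) :
    μ = trivial μ.src ∨ ∃ (e : E.Edge) (γ : E.Path) (h : E.r e = γ.src), μ = cons e γ h := by
  obtain ⟨x, y, l, hl⟩ := μ
  cases l with
  | nil =>
    left
    have : x = y := hl
    subst this
    rfl
  | cons e l =>
    right
    obtain ⟨rfl, hl⟩ := hl
    exact ⟨e, ⟨E.r e, y, l, hl⟩, rfl, rfl⟩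

theorem cons_inj {e f : E.Edge} {γ δ : E.Path} {h : E.r e = γ.src} {h' : E.r f = δ.src}
    (H : cons e γ h = cons f δ h') : e = f ∧ γ = δ := by
  have h1 := congrArg (fun p : E.Path => p.edges.head?) H
  have h2 := congrArg tail H
  simp only [tail_cons] at h2
  simp only [cons_edges, List.head?_cons, Option.some.injEq] at h1
  exact ⟨h1, h2⟩

end Path

/-- The type of all cycles of `E` (sinks and proper cycles). -/
def Cycle (E : FinGraph.{u, v}) : Type (max u v) := {c : E.Path // c.IsCycle}

/-! ### The graph in which a cycle is replaced by a loop -/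

open Classical in
/-- The graph `F_{E,d}` in which the cycle `d` and all its vertices are replaced by a loop `d'` at
a new vertex `v̄`.
* The vertices are those of `E` outside `d⁰`, and the new vertex `v̄ = none`.
* The edges are the edges `f` of `E` with `r(f) ∉ d⁰`, and the new loop `d' = none` at `v̄`. An edge
  `f` with `s(f) ∉ d⁰` keeps its source and range; an edge `f` with `s(f) ∈ d⁰` (this is the edge
  called `φ(f)`) has source `v̄` and the range it has in `E`.

(If `d` is a source cycle, then the edges with range in `d⁰` are the edges of `d`; in particular
every edge with source outside `d⁰` has its range outside `d⁰`.) -/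
noncomputable def contract (E : FinGraph.{u, v}) (d : E.Path) : FinGraph.{u, v} where
  Vertex := Option {x : E.Vertex // x ∉ d.vertices}
  Edge := Option {e : E.Edge // E.r e ∉ d.vertices}
  s
    | none => none
    | some e => if h : E.s e.1 ∈ d.vertices then none else some ⟨E.s e.1, h⟩
  r
    | none => none
    | some e => some ⟨E.r e.1, e.2⟩
  finite_vertex := inferInstance
  finite_edge := inferInstance

section Contract

variable {E : FinGraph.{u, v}} {d : E.Path}

theorem Path.IsSourceCycle.range_notMem (hd : d.IsSourceCycle) {e : E.Edge}
    (he : E.s e ∉ d.vertices) : E.r e ∉ d.vertices :=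
  fun h => he ⟨e, hd.2 e h, rfl⟩

theorem IsWalk.source_notMem (hd : d.IsSourceCycle) :
    ∀ {l : List E.Edge} {x y : E.Vertex}, E.IsWalk x l y → x ∉ d.vertices →
      ∀ e ∈ l, E.s e ∉ d.vertices
  | [], _, _, _, _ => by simp
  | e :: l, x, y, h, hx => by
    intro f hf
    have he : E.s e ∉ d.vertices := by rw [h.1]; exact hx
    rcases List.mem_cons.1 hf with rfl | hf
    · exact he
    · exact IsWalk.source_notMem hd h.2 (hd.range_notMem he) f hf

theorem IsWalk.tgt_notMem (hd : d.IsSourceCycle) :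
    ∀ {l : List E.Edge} {x y : E.Vertex}, E.IsWalk x l y → x ∉ d.vertices → y ∉ d.vertices
  | [], _, _, h, hx => by
    have : _ = _ := h
    rwa [← this]
  | e :: l, x, y, h, hx =>
    IsWalk.tgt_notMem hd h.2 (hd.range_notMem (by rw [h.1]; exact hx))

/-- A list of edges with sources outside `d⁰`, regarded as a list of edges of `F_{E,d}`. -/
noncomputable def edgesToContract (hd : d.IsSourceCycle) (l : List E.Edge)
    (hl : ∀ e ∈ l, E.s e ∉ d.vertices) : List (E.contract d).Edge :=
  l.pmap (fun e he => some ⟨e, hd.range_notMem he⟩) hl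

theorem contract_s_some (e : E.Edge) (he : E.r e ∉ d.vertices) (h : E.s e ∉ d.vertices) :
    (E.contract d).s (some ⟨e, he⟩) = some ⟨E.s e, h⟩ := by
  simp [contract, h]

theorem isWalk_edgesToContract (hd : d.IsSourceCycle) :
    ∀ {l : List E.Edge} {x y : E.Vertex} (hl : ∀ e ∈ l, E.s e ∉ d.vertices)
      (_ : E.IsWalk x l y) (hx : x ∉ d.vertices) (hy : y ∉ d.vertices),
      (E.contract d).IsWalk (some ⟨x, hx⟩) (edgesToContract hd l hl) (some ⟨y, hy⟩)
  | [], x, y, _, h, hx, hy => by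
    have : x = y := h
    subst this
    rfl
  | e :: l, x, y, hl, h, hx, hy => by
    obtain ⟨rfl, h⟩ := h
    exact ⟨contract_s_some e _ hx,
      isWalk_edgesToContract hd (fun f hf => hl f (List.mem_cons_of_mem _ hf)) h
        (hd.range_notMem hx) hy⟩

theorem nodup_edgesToContract (hd : d.IsSourceCycle) :
    ∀ {l : List E.Edge} (hl : ∀ e ∈ l, E.s e ∉ d.vertices) (_ : (l.map E.s).Nodup),
      ((edgesToContract hd l hl).map (E.contract d).s).Nodup
  | [], _, _ => List.nodup_nil
  | e :: l, hl, h => by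
    rw [List.map_cons, List.nodup_cons] at h
    refine List.nodup_cons.2 ⟨?_, nodup_edgesToContract hd _ h.2⟩
    intro hmem
    obtain ⟨a, ha, hae⟩ := List.mem_map.1 hmem
    obtain ⟨f, hf, rfl⟩ := List.mem_pmap.1 ha
    have hf' := hl f (List.mem_cons_of_mem _ hf)
    have he' := hl e List.mem_cons_self
    rw [contract_s_some f _ hf', contract_s_some e _ he'] at hae
    have : E.s f = E.s e := congrArg Subtype.val (Option.some.inj hae)
    exact h.1 (List.mem_map.2 ⟨f, hf, this⟩)

/-- The loop `d'` of `F_{E,d}` at the new vertex. -/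
noncomputable def contractLoop (E : FinGraph.{u, v}) (d : E.Path) : (E.contract d).Cycle :=
  ⟨⟨none, none, [none], rfl, rfl⟩, Or.inr ⟨by simp, rfl, List.nodup_singleton _⟩⟩

/-- A path of `E` whose source is outside `d⁰`, regarded as a path of `F_{E,d}`. -/
noncomputable def Path.toContract (hd : d.IsSourceCycle) (γ : E.Path) (h : γ.src ∉ d.vertices) :
    (E.contract d).Path where
  src := some ⟨γ.src, h⟩
  tgt := some ⟨γ.tgt, γ.isWalk.tgt_notMem hd h⟩
  edges := edgesToContract hd γ.edges (γ.isWalk.source_notMem hd h)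
  isWalk := isWalk_edgesToContract hd _ γ.isWalk h _

theorem Path.IsCycle.toContract (hd : d.IsSourceCycle) {c : E.Path} (hc : c.IsCycle)
    (h : c.src ∉ d.vertices) : (Path.toContract hd c h).IsCycle := by
  rcases hc with ⟨hc, hs⟩ | hc
  · left
    refine ⟨List.pmap_eq_nil_iff.2 hc, ?_⟩
    rintro (_ | ⟨e, he⟩) H
    · exact Option.some_ne_none _ H.symm
    · by_cases h' : E.s e ∈ d.vertices
      · have h2 : (E.contract d).s (some ⟨e, he⟩) = none := by simp [contract, h']
        rw [h2] at H
        exact Option.some_ne_none _ H.symm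
      · rw [contract_s_some e he h'] at H
        exact hs e (congrArg Subtype.val (Option.some.inj H))
  · right
    refine ⟨?_, ?_, nodup_edgesToContract hd _ hc.2.2⟩
    · intro h0
      exact hc.1 (List.pmap_eq_nil_iff.1 h0)
    · exact congrArg some (Subtype.ext hc.2.1)

open Classical in
/-- The cycle of `F_{E,d}` which corresponds to a cycle `c` of `E`: it is the loop `d'` if `c` meets
`d⁰` (in this case `c` is `d` or a rotation of `d`), and it is `c` itself otherwise. -/
noncomputable def Cycle.toContract (hd : d.IsSourceCycle) (c : E.Cycle) : (E.contract d).Cycle :=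
  if h : c.1.src ∈ d.vertices then E.contractLoop d
  else ⟨Path.toContract hd c.1 h, Path.IsCycle.toContract hd c.2 h⟩

end Contract

end FinGraph

/-! ### Leavitt path algebras -/

/-- The generators `v`, `e` and `e*` of the Leavitt path algebra. -/
inductive LeavittGen (E : FinGraph.{u, v}) : Type (max u v)
  | vertex (x : E.Vertex)
  | edge (e : E.Edge)
  | ghost (e : E.Edge)

namespace LeavittPathAlgebra

section Rel

variable (K : Type w) [Field K] (E : FinGraph.{u, v})

/-- The vertex `x` in the free algebra. -/
def fv (x : E.Vertex) : FreeAlgebra K (LeavittGen E) := FreeAlgebra.ι K (.vertex x)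

/-- The edge `e` in the free algebra. -/
def fe (e : E.Edge) : FreeAlgebra K (LeavittGen E) := FreeAlgebra.ι K (.edge e)

/-- The ghost edge `e*` in the free algebra. -/
def fg (e : E.Edge) : FreeAlgebra K (LeavittGen E) := FreeAlgebra.ι K (.ghost e)

/-- The defining relations of the Leavitt path algebra of a finite graph. As the free algebra
has a unit element, the identity `1 = ∑ v` (over all vertices) has to be listed among them. -/
inductive Rel : FreeAlgebra K (LeavittGen E) → FreeAlgebra K (LeavittGen E) → Prop
  | vertex_mul_self (x : E.Vertex) : Rel (fv K E x * fv K E x) (fv K E x)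
  | vertex_mul_of_ne (x y : E.Vertex) : x ≠ y → Rel (fv K E x * fv K E y) 0
  | sum_vertex : Rel (∑ᶠ x : E.Vertex, fv K E x) 1
  | source_mul_edge (e : E.Edge) : Rel (fv K E (E.s e) * fe K E e) (fe K E e)
  | edge_mul_range (e : E.Edge) : Rel (fe K E e * fv K E (E.r e)) (fe K E e)
  | range_mul_ghost (e : E.Edge) : Rel (fv K E (E.r e) * fg K E e) (fg K E e)
  | ghost_mul_source (e : E.Edge) : Rel (fg K E e * fv K E (E.s e)) (fg K E e)
  | ghost_mul_edge_self (e : E.Edge) : Rel (fg K E e * fe K E e) (fv K E (E.r e))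
  | ghost_mul_edge_of_ne (e f : E.Edge) : e ≠ f → Rel (fg K E e * fe K E f) 0
  | sum_edge_mul_ghost (x : E.Vertex) : ¬ E.IsSink x →
      Rel (fv K E x) (∑ᶠ (e : E.Edge) (_ : E.s e = x), fe K E e * fg K E e)

end Rel

end LeavittPathAlgebra

/-- The Leavitt path algebra `L_K(E)` of a finite graph `E`. -/
def LeavittPathAlgebra (K : Type w) [Field K] (E : FinGraph.{u, v}) : Type (max u v w) :=
  RingQuot (LeavittPathAlgebra.Rel K E)

namespace LeavittPathAlgebra

variable {K : Type w} [Field K] {E : FinGraph.{u, v}}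

noncomputable instance : Ring (LeavittPathAlgebra K E) :=
  inferInstanceAs (Ring (RingQuot (Rel K E)))

noncomputable instance : Algebra K (LeavittPathAlgebra K E) :=
  inferInstanceAs (Algebra K (RingQuot (Rel K E)))

/-- The canonical map from the free algebra. -/
noncomputable def mk : FreeAlgebra K (LeavittGen E) →ₐ[K] LeavittPathAlgebra K E :=
  RingQuot.mkAlgHom K (Rel K E)

/-- The generator `v` of `L_K(E)`. -/
noncomputable def vertex (x : E.Vertex) : LeavittPathAlgebra K E := mk (fv K E x)

/-- The generator `e` of `L_K(E)`. -/
noncomputable def edge (e : E.Edge) : LeavittPathAlgebra K E := mk (fe K E e)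

/-- The generator `e*` of `L_K(E)`. -/
noncomputable def ghost (e : E.Edge) : LeavittPathAlgebra K E := mk (fg K E e)

/-- The universal property of `L_K(E)`. -/
noncomputable def lift {A : Type*} [Ring A] [Algebra K A] (φ : LeavittGen E → A)
    (h : ∀ ⦃a b⦄, Rel K E a b → FreeAlgebra.lift K φ a = FreeAlgebra.lift K φ b) :
    LeavittPathAlgebra K E →ₐ[K] A :=
  RingQuot.liftAlgHom K ⟨FreeAlgebra.lift K φ, h⟩

theorem lift_mk {A : Type*} [Ring A] [Algebra K A] (φ : LeavittGen E → A)
    (h : ∀ ⦃a b⦄, Rel K E a b → FreeAlgebra.lift K φ a = FreeAlgebra.lift K φ b)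
    (a : FreeAlgebra K (LeavittGen E)) : lift φ h (mk a) = FreeAlgebra.lift K φ a :=
  RingQuot.liftAlgHom_mkAlgHom_apply K _ h a

end LeavittPathAlgebra

/-! ### The modules of formal series -/

namespace FinGraph.Cycle

variable {E : FinGraph.{u, v}}

/-- The set `P_c`. If `c` is a sink, it consists of all paths with range `c`. If `c` is a proper
cycle, it consists of all paths `γ` with range `s(c)` which are not of the form `γ' c`. -/
def pathSet (c : E.Cycle) : Set E.Path :=
  {γ | γ.tgt = c.1.src ∧ (c.1.edges ≠ [] → ¬ c.1.edges <:+ γ.edges)}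

/-- The index set `𝕀_c`: all integers `j ≥ 1` if `c` is a proper cycle, `{1}` if `c` is a sink. -/
def indexSet (c : E.Cycle) : Set ℕ := {j | 1 ≤ j ∧ (c.1.edges = [] → j = 1)}

theorem tail_mem {c : E.Cycle} (h : c.1.edges ≠ []) : c.1.tail ∈ c.pathSet := by
  obtain ⟨⟨x, y, l, hl⟩, hc⟩ := c
  have := hc.tgt_eq
  cases l with
  | nil => exact absurd rfl h
  | cons e l =>
    refine ⟨this, fun _ hs => ?_⟩
    have := hs.length_le
    simp [Path.tail] at this

theorem trivial_mem (c : E.Cycle) : Path.trivial c.1.src ∈ c.pathSet :=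
  ⟨rfl, fun h hs => h (List.suffix_nil.1 hs)⟩

theorem mem_of_cons_mem {c : E.Cycle} {e : E.Edge} {γ : E.Path} {h : E.r e = γ.src}
    (hm : Path.cons e γ h ∈ c.pathSet) : γ ∈ c.pathSet :=
  ⟨hm.1, fun h0 hs => hm.2 h0 (hs.trans (List.suffix_cons _ _))⟩

theorem cons_mem_or {c : E.Cycle} {e : E.Edge} {γ : E.Path} (h : E.r e = γ.src)
    (hm : γ ∈ c.pathSet) : Path.cons e γ h ∈ c.pathSet ∨ c.1 = Path.cons e γ h := by
  by_cases H : c.1.edges ≠ [] → ¬ c.1.edges <:+ (Path.cons e γ h).edges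
  · exact Or.inl ⟨hm.1, H⟩
  · right
    push Not at H
    obtain ⟨h0, hs⟩ := H
    rcases List.suffix_cons_iff.1 hs with hs | hs
    · have ht := c.2.tgt_eq
      have hw := c.1.isWalk
      rw [hs] at hw
      exact Path.ext hw.1.symm (ht.trans hm.1.symm) hs
    · exact absurd hs (hm.2 h0)

end FinGraph.Cycle

open FinGraph

/-- The `K`-vector space `K[[P_c]]` of all maps from `P_c` to `K` (formal series). -/
abbrev FormalSeries (K : Type w) {E : FinGraph.{u, v}} (c : E.Cycle) : Type (max u v w) :=
  c.pathSet → K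

namespace FormalSeries

variable (K : Type w) [Field K] {E : FinGraph.{u, v}} (c : E.Cycle)

open Classical in
/-- The coefficient `𝔭(γ)` of a formal series at a path `γ`; it is `0` if `γ ∉ P_c`. -/
noncomputable def coeff (γ : E.Path) : FormalSeries K c →ₗ[K] K :=
  if h : γ ∈ c.pathSet then LinearMap.proj ⟨γ, h⟩ else 0

open Classical in
/-- `∑ 𝔭(μ) μ ↦ ∑ 𝔭(μ) μ` over all `μ` with `s(μ) = x`. -/
noncomputable def proj (x : E.Vertex) : FormalSeries K c →ₗ[K] FormalSeries K c :=
  LinearMap.pi fun μ => if μ.1.src = x then coeff K c μ.1 else 0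

open Classical in
/-- `∑ 𝔭(μ) μ ↦ ∑ 𝔭(μ) e μ` over all `μ ∈ P_c` with `r(e) = s(μ)` and `e μ ∈ P_c`. -/
noncomputable def concat (e : E.Edge) : FormalSeries K c →ₗ[K] FormalSeries K c :=
  LinearMap.pi fun μ => if μ.1.edges.head? = some e then coeff K c μ.1.tail else 0

open Classical in
/-- `∑ 𝔭(μ) μ ↦ ∑ 𝔭(μ) μ'` over all `μ ∈ P_c` of the form `μ = e μ'`. -/
noncomputable def strip (e : E.Edge) : FormalSeries K c →ₗ[K] FormalSeries K c :=
  LinearMap.pi fun μ => if h : E.r e = μ.1.src then coeff K c (Path.cons e μ.1 h) else 0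

open Classical in
/-- If `c = e₁ e₂ ⋯ eₙ` is a proper cycle and `e = e₁`, the map `∑ 𝔭(μ) μ ↦ 𝔭(e₂ ⋯ eₙ) s(c)`;
otherwise `0`. It accounts for the only path `μ` in `P_c` such that `e μ` is a path but not in
`P_c`, namely `μ = e₂ ⋯ eₙ`, where `e₁ μ = c`. -/
noncomputable def close (e : E.Edge) : FormalSeries K c →ₗ[K] FormalSeries K c :=
  LinearMap.pi fun μ =>
    if c.1.edges.head? = some e ∧ μ.1 = Path.trivial c.1.src then coeff K c c.1.tail else 0

open Classical in
/-- If `c = e₁ e₂ ⋯ eₙ` is a proper cycle and `e = e₁`, the map `∑ 𝔭(μ) μ ↦ 𝔭(s(c)) e₂ ⋯ eₙ`;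
otherwise `0`. -/
noncomputable def unroll (e : E.Edge) : FormalSeries K c →ₗ[K] FormalSeries K c :=
  LinearMap.pi fun μ =>
    if c.1.edges.head? = some e ∧ μ.1 = c.1.tail then coeff K c (Path.trivial c.1.src) else 0

end FormalSeries

/-- The `K`-vector space `Û_{E,c-1} = ⨁_{j ∈ 𝕀_c} K[[P_c]] α_{c,j}`. -/
def UHat (K : Type w) [Field K] {E : FinGraph.{u, v}} (c : E.Cycle) : Type (max u v w) :=
  c.indexSet →₀ FormalSeries K c

namespace UHat

variable (K : Type w) [Field K] {E : FinGraph.{u, v}} (c : E.Cycle)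

noncomputable instance : AddCommGroup (UHat K c) :=
  inferInstanceAs (AddCommGroup (c.indexSet →₀ FormalSeries K c))

noncomputable instance instModuleBase : Module K (UHat K c) :=
  inferInstanceAs (Module K (c.indexSet →₀ FormalSeries K c))

/-- `Û` as a type of finitely supported families, indexed by `𝕀_c`, of formal series. -/
noncomputable def ofFinsupp : (c.indexSet →₀ FormalSeries K c) ≃ₗ[K] UHat K c :=
  LinearEquiv.refl K (c.indexSet →₀ FormalSeries K c)

open Classical in
/-- The map `𝔭 ↦ 𝔭 α_{c,j}`, where `α_{c,j} = 0` for `j ∉ 𝕀_c`, in particular `α_{c,0} = 0`. -/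
noncomputable def α (j : ℕ) : FormalSeries K c →ₗ[K] UHat K c :=
  if h : j ∈ c.indexSet then (ofFinsupp K c).toLinearMap ∘ₗ Finsupp.lsingle ⟨j, h⟩ else 0

/-- The linear map on `Û` which is `𝔭 α_{c,j} ↦ g j 𝔭` on the summand of index `j`. -/
noncomputable def ofSummands (g : ℕ → FormalSeries K c →ₗ[K] UHat K c) :
    UHat K c →ₗ[K] UHat K c :=
  (Finsupp.lsum K fun j : c.indexSet => g j.1) ∘ₗ (ofFinsupp K c).symm.toLinearMap

/-- The action of a vertex `x`: the part of each series on the paths starting in `x`. -/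
noncomputable def actVertex (x : E.Vertex) : UHat K c →ₗ[K] UHat K c :=
  ofSummands K c fun j => α K c j ∘ₗ FormalSeries.proj K c x

/-- The action of an edge `e`. It sends `μ α_{c,j}` to `(e μ) α_{c,j}` if `e μ` is a path in
`P_c`, and to `0` if `e μ` is not a path. In the remaining case, `e = e₁` and `μ = e₂ ⋯ eₙ`, it is
`e μ α_{c,j} = c α_{c,j} = α_{c,j} + α_{c,j-1}`, according to the identity
`(c - 1) α_{c,j} = α_{c,j-1}` of the Prüfer module. -/
noncomputable def actEdge (e : E.Edge) : UHat K c →ₗ[K] UHat K c :=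
  ofSummands K c fun j =>
    α K c j ∘ₗ FormalSeries.concat K c e +
      (α K c j + α K c (j - 1)) ∘ₗ FormalSeries.close K c e

/-- The action of a ghost edge `e*`. It sends `(e μ') α_{c,j}` to `μ' α_{c,j}`, and all other
`μ α_{c,j}` to `0`, with the exception of `μ = s(c)` for `e = e₁`, where
`e₁* α_{c,j} = e₂ ⋯ eₙ ∑_{0 ≤ l < j} (-1)^l α_{c,j-l}`, as in the Prüfer module. -/
noncomputable def actGhost (e : E.Edge) : UHat K c →ₗ[K] UHat K c :=
  ofSummands K c fun j =>
    α K c j ∘ₗ FormalSeries.strip K c e +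
      (∑ l ∈ Finset.range j, (-1 : K) ^ l • α K c (j - l)) ∘ₗ FormalSeries.unroll K c e

end UHat

/-! ### The Cuntz–Krieger relations for the operators on `Û` -/

namespace FormalSeries

variable {K : Type w} [Field K] {E : FinGraph.{u, v}} {c : E.Cycle}

theorem coeff_of_mem {γ : E.Path} (h : γ ∈ c.pathSet) (p : FormalSeries K c) :
    coeff K c γ p = p ⟨γ, h⟩ := by
  simp [coeff, h]

theorem coeff_of_notMem {γ : E.Path} (h : γ ∉ c.pathSet) (p : FormalSeries K c) :
    coeff K c γ p = 0 := by
  simp [coeff, h]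

theorem ext_coeff {p q : FormalSeries K c}
    (h : ∀ γ ∈ c.pathSet, coeff K c γ p = coeff K c γ q) : p = q := by
  funext μ
  have := h μ.1 μ.2
  rwa [coeff_of_mem μ.2, coeff_of_mem μ.2] at this

open Classical in
theorem coeff_proj (x : E.Vertex) (γ : E.Path) (p : FormalSeries K c) :
    coeff K c γ (proj K c x p) = if γ.src = x then coeff K c γ p else 0 := by
  by_cases h : γ ∈ c.pathSet
  · rw [coeff_of_mem h]
    simp only [proj, LinearMap.pi_apply]
    split_ifs <;> rfl
  · simp [coeff_of_notMem h]

theorem coeff_concat_trivial (e : E.Edge) (x : E.Vertex) (p : FormalSeries K c) :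
    coeff K c (Path.trivial x) (concat K c e p) = 0 := by
  by_cases h : Path.trivial x ∈ c.pathSet
  · rw [coeff_of_mem h]
    simp [concat, Path.trivial]
  · exact coeff_of_notMem h _

open Classical in
theorem coeff_concat_cons (e f : E.Edge) (γ : E.Path) (h : E.r f = γ.src)
    (p : FormalSeries K c) :
    coeff K c (Path.cons f γ h) (concat K c e p) =
      if f = e ∧ Path.cons f γ h ∈ c.pathSet then coeff K c γ p else 0 := by
  by_cases hm : Path.cons f γ h ∈ c.pathSet
  · rw [coeff_of_mem hm]
    simp only [concat, LinearMap.pi_apply, Path.cons_edges, List.head?_cons, Option.some.injEq,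
      Path.tail_cons, hm, and_true]
    split_ifs <;> rfl
  · simp [coeff_of_notMem hm, hm]

open Classical in
theorem coeff_strip {e : E.Edge} {γ : E.Path} (hm : γ ∈ c.pathSet) (p : FormalSeries K c) :
    coeff K c γ (strip K c e p) =
      if h : E.r e = γ.src then coeff K c (Path.cons e γ h) p else 0 := by
  rw [coeff_of_mem hm]
  simp only [strip, LinearMap.pi_apply]
  split_ifs <;> rfl

open Classical in
theorem coeff_close (e : E.Edge) (γ : E.Path) (p : FormalSeries K c) :
    coeff K c γ (close K c e p) =
      if c.1.edges.head? = some e ∧ γ = Path.trivial c.1.src then coeff K c c.1.tail p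
      else 0 := by
  by_cases h : γ ∈ c.pathSet
  · rw [coeff_of_mem h]
    simp only [close, LinearMap.pi_apply]
    split_ifs <;> rfl
  · rw [coeff_of_notMem h, if_neg]
    rintro ⟨-, rfl⟩
    exact h c.trivial_mem

open Classical in
theorem coeff_unroll (e : E.Edge) (γ : E.Path) (p : FormalSeries K c) :
    coeff K c γ (unroll K c e p) =
      if c.1.edges.head? = some e ∧ γ = c.1.tail then coeff K c (Path.trivial c.1.src) p
      else 0 := by
  by_cases h : γ ∈ c.pathSet
  · rw [coeff_of_mem h]
    simp only [unroll, LinearMap.pi_apply]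
    split_ifs <;> rfl
  · rw [coeff_of_notMem h, if_neg]
    rintro ⟨h0, rfl⟩
    refine h (Cycle.tail_mem ?_)
    intro h1
    simp [h1] at h0

/-- The first edge of a proper cycle. -/
theorem cycle_eq_cons {e : E.Edge} (h : c.1.edges.head? = some e) :
    ∃ hr : E.r e = c.1.tail.src, c.1 = Path.cons e c.1.tail hr := by
  rcases Path.eq_trivial_or_cons c.1 with h0 | ⟨f, γ, hf, h0⟩
  · rw [h0] at h
    simp [Path.trivial] at h
  · have hfe : f = e := by
      rw [h0] at h
      simpa using h
    subst hfe
    have ht : c.1.tail = γ := by rw [h0, Path.tail_cons]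
    rw [ht]
    exact ⟨hf, h0⟩

theorem self_notMem {e : E.Edge} (h : c.1.edges.head? = some e) : c.1 ∉ c.pathSet := by
  intro hm
  refine hm.2 ?_ List.suffix_rfl
  intro h0
  simp [h0] at h

theorem proj_proj_self (x : E.Vertex) (p : FormalSeries K c) :
    proj K c x (proj K c x p) = proj K c x p := by
  refine ext_coeff fun γ _ => ?_
  simp only [coeff_proj]
  split_ifs <;> rfl

theorem proj_proj_of_ne {x y : E.Vertex} (h : x ≠ y) (p : FormalSeries K c) :
    proj K c x (proj K c y p) = 0 := by
  refine ext_coeff fun γ _ => ?_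
  simp only [coeff_proj, map_zero]
  split_ifs with h1 h2
  · exact absurd (h1.symm.trans h2) h
  · rfl
  · rfl

theorem sum_proj [Fintype E.Vertex] (p : FormalSeries K c) :
    ∑ x : E.Vertex, proj K c x p = p := by
  refine ext_coeff fun γ _ => ?_
  simp only [map_sum, coeff_proj]
  rw [Finset.sum_eq_single γ.src (fun x _ hx => if_neg hx.symm)
    (fun h => absurd (Finset.mem_univ _) h), if_pos rfl]

theorem proj_concat (e : E.Edge) (p : FormalSeries K c) :
    proj K c (E.s e) (concat K c e p) = concat K c e p := by
  refine ext_coeff fun γ _ => ?_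
  rw [coeff_proj]
  rcases Path.eq_trivial_or_cons γ with h0 | ⟨f, δ, hf, rfl⟩
  · rw [h0, coeff_concat_trivial]
    simp
  · rw [coeff_concat_cons, Path.cons_src]
    split_ifs with h1 h2 h3
    · rfl
    · rfl
    · exact absurd (congrArg E.s h3.1) h1
    · rfl

theorem concat_proj (e : E.Edge) (p : FormalSeries K c) :
    concat K c e (proj K c (E.r e) p) = concat K c e p := by
  refine ext_coeff fun γ _ => ?_
  rcases Path.eq_trivial_or_cons γ with h0 | ⟨f, δ, hf, rfl⟩
  · rw [h0, coeff_concat_trivial, coeff_concat_trivial]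
  · rw [coeff_concat_cons, coeff_concat_cons, coeff_proj]
    split_ifs with h1 h2
    · rfl
    · obtain ⟨rfl, -⟩ := h1
      exact absurd hf.symm h2
    · rfl

theorem proj_close (e : E.Edge) (p : FormalSeries K c) :
    proj K c (E.s e) (close K c e p) = close K c e p := by
  refine ext_coeff fun γ _ => ?_
  rw [coeff_proj, coeff_close]
  split_ifs with h1 h2 h3
  · rfl
  · rfl
  · obtain ⟨h4, rfl⟩ := h3
    obtain ⟨hr, h5⟩ := cycle_eq_cons h4
    exact absurd (congrArg Path.src h5) h1
  · rfl

theorem close_proj (e : E.Edge) (p : FormalSeries K c) :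
    close K c e (proj K c (E.r e) p) = close K c e p := by
  refine ext_coeff fun γ _ => ?_
  rw [coeff_close, coeff_close, coeff_proj]
  split_ifs with h1 h2
  · rfl
  · obtain ⟨hr, h5⟩ := cycle_eq_cons h1.1
    exact absurd hr.symm h2
  · rfl

theorem proj_strip (e : E.Edge) (p : FormalSeries K c) :
    proj K c (E.r e) (strip K c e p) = strip K c e p := by
  refine ext_coeff fun γ hm => ?_
  rw [coeff_proj, coeff_strip hm]
  split_ifs with h1 h2 h3
  · rfl
  · rfl
  · exact absurd h3.symm h1
  · rfl

theorem strip_proj (e : E.Edge) (p : FormalSeries K c) :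
    strip K c e (proj K c (E.s e) p) = strip K c e p := by
  refine ext_coeff fun γ hm => ?_
  rw [coeff_strip hm, coeff_strip hm]
  split_ifs with h1
  · rw [coeff_proj, if_pos (Path.cons_src _ _ _)]
  · rfl

theorem proj_unroll (e : E.Edge) (p : FormalSeries K c) :
    proj K c (E.r e) (unroll K c e p) = unroll K c e p := by
  refine ext_coeff fun γ _ => ?_
  rw [coeff_proj, coeff_unroll]
  split_ifs with h1 h2 h3
  · rfl
  · rfl
  · obtain ⟨h4, rfl⟩ := h3
    obtain ⟨hr, h5⟩ := cycle_eq_cons h4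
    exact absurd hr.symm h1
  · rfl

theorem unroll_proj (e : E.Edge) (p : FormalSeries K c) :
    unroll K c e (proj K c (E.s e) p) = unroll K c e p := by
  refine ext_coeff fun γ _ => ?_
  rw [coeff_unroll, coeff_unroll, coeff_proj]
  split_ifs with h1 h2
  · rfl
  · obtain ⟨hr, h5⟩ := cycle_eq_cons h1.1
    exact absurd (congrArg Path.src h5) h2
  · rfl

theorem strip_close (e f : E.Edge) (p : FormalSeries K c) :
    strip K c f (close K c e p) = 0 := by
  refine ext_coeff fun γ hm => ?_
  rw [coeff_strip hm, map_zero]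
  split_ifs with h1
  · rw [coeff_close, if_neg]
    rintro ⟨-, h⟩
    have := congrArg Path.edges h
    simp [Path.trivial] at this
  · rfl

theorem unroll_concat (e f : E.Edge) (p : FormalSeries K c) :
    unroll K c f (concat K c e p) = 0 := by
  refine ext_coeff fun γ _ => ?_
  rw [coeff_unroll, map_zero, coeff_concat_trivial, ite_self]

theorem concat_unroll (e : E.Edge) (p : FormalSeries K c) :
    concat K c e (unroll K c e p) = 0 := by
  refine ext_coeff fun γ _ => ?_
  rw [map_zero]
  rcases Path.eq_trivial_or_cons γ with h0 | ⟨f, δ, hf, rfl⟩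
  · rw [h0, coeff_concat_trivial]
  · rw [coeff_concat_cons, coeff_unroll]
    split_ifs with h1 h2
    · obtain ⟨rfl, hm⟩ := h1
      obtain ⟨h3, rfl⟩ := h2
      obtain ⟨hr, h5⟩ := cycle_eq_cons h3
      rw [← h5] at hm
      exact absurd hm (self_notMem h3)
    · rfl
    · rfl

theorem close_strip (e : E.Edge) (p : FormalSeries K c) :
    close K c e (strip K c e p) = 0 := by
  refine ext_coeff fun γ _ => ?_
  rw [map_zero, coeff_close]
  split_ifs with h1
  · obtain ⟨hr, h5⟩ := cycle_eq_cons h1.1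
    have h0 : c.1.edges ≠ [] := by
      intro h0
      simp [h0] at h1
    rw [coeff_strip (Cycle.tail_mem h0), dif_pos hr, ← h5, coeff_of_notMem (self_notMem h1.1)]
  · rfl

theorem strip_concat_of_ne {e f : E.Edge} (h : e ≠ f) (p : FormalSeries K c) :
    strip K c e (concat K c f p) = 0 := by
  refine ext_coeff fun γ hm => ?_
  rw [coeff_strip hm, map_zero]
  split_ifs with h1
  · rw [coeff_concat_cons, if_neg]
    exact fun H => h H.1
  · rfl

theorem unroll_close_of_ne {e f : E.Edge} (h : e ≠ f) (p : FormalSeries K c) :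
    unroll K c e (close K c f p) = 0 := by
  refine ext_coeff fun γ hm => ?_
  rw [coeff_unroll, coeff_close, map_zero]
  split_ifs with h1 h2
  · exact absurd (Option.some.inj (h1.1.symm.trans h2.1)) h
  · rfl
  · rfl

theorem strip_concat_self (e : E.Edge) (p : FormalSeries K c) :
    strip K c e (concat K c e p) + unroll K c e (close K c e p) = proj K c (E.r e) p := by
  refine ext_coeff fun γ hm => ?_
  rw [map_add, coeff_strip hm, coeff_unroll, coeff_close, coeff_proj]
  by_cases h1 : E.r e = γ.src
  · rw [dif_pos h1, if_pos h1.symm, coeff_concat_cons]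
    by_cases h2 : Path.cons e γ h1 ∈ c.pathSet
    · rw [if_pos ⟨rfl, h2⟩, if_neg, add_zero]
      rintro ⟨h3, rfl⟩
      obtain ⟨hr, h5⟩ := cycle_eq_cons h3
      rw [← h5] at h2
      exact self_notMem h3 h2
    · have h3 := (Cycle.cons_mem_or h1 hm).resolve_left h2
      have h4 : c.1.edges.head? = some e := by rw [h3]; rfl
      have h5 : γ = c.1.tail := by rw [h3, Path.tail_cons]
      rw [if_neg (fun H => h2 H.2), zero_add, if_pos ⟨h4, h5⟩, if_pos ⟨h4, rfl⟩, ← h5]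
  · rw [dif_neg h1, if_neg (c := γ.src = E.r e) (fun H => h1 H.symm), if_neg, add_zero]
    rintro ⟨h3, rfl⟩
    obtain ⟨hr, h5⟩ := cycle_eq_cons h3
    exact h1 hr

open Classical in
theorem coeff_sum_concat_strip [Fintype E.Edge] {x : E.Vertex} (hx : ¬ E.IsSink x)
    (p : FormalSeries K c) :
    ∑ e : E.Edge, (if E.s e = x then
      concat K c e (strip K c e p) + close K c e (unroll K c e p) else 0) = proj K c x p := by
  refine ext_coeff fun γ hm => ?_
  rw [map_sum, coeff_proj]
  have key : ∀ e : E.Edge, coeff K c γ (if E.s e = x then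
      concat K c e (strip K c e p) + close K c e (unroll K c e p) else 0) =
      if γ.src = x ∧ (γ.edges.head? = some e ∨
        (γ = Path.trivial c.1.src ∧ c.1.edges.head? = some e)) then coeff K c γ p else 0 := by
    intro e
    rcases Path.eq_trivial_or_cons γ with h0 | ⟨f, δ, hf, rfl⟩
    · have h0' : γ.edges.head? = none := by rw [h0]; rfl
      have h1 : coeff K c γ (concat K c e (strip K c e p)) = 0 := by
        rw [h0, coeff_concat_trivial]
      by_cases h2 : c.1.edges.head? = some e ∧ γ = Path.trivial c.1.src
      · obtain ⟨hr, h5⟩ := cycle_eq_cons h2.1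
        have h6 : E.s e = γ.src := by
          rw [h2.2]
          exact (congrArg Path.src h5).symm
        rw [h6]
        by_cases h7 : γ.src = x
        · rw [if_pos h7, if_pos ⟨h7, Or.inr ⟨h2.2, h2.1⟩⟩, map_add, h1, zero_add, coeff_close,
            if_pos h2, coeff_unroll, if_pos ⟨h2.1, rfl⟩, h2.2]
        · rw [if_neg h7, if_neg (fun H => h7 H.1), map_zero]
      · rw [if_neg (c := γ.src = x ∧ _)]
        · split_ifs
          · rw [map_add, h1, zero_add, coeff_close, if_neg h2]
          · exact map_zero _
        · rintro ⟨-, H | H⟩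
          · simp [h0'] at H
          · exact h2 ⟨H.2, H.1⟩
    · have h1 : Path.cons f δ hf ≠ Path.trivial c.1.src := by
        intro H
        have := congrArg Path.edges H
        simp [Path.trivial] at this
      have h2 : coeff K c (Path.cons f δ hf) (close K c e (unroll K c e p)) = 0 := by
        rw [coeff_close, if_neg (fun H => h1 H.2)]
      by_cases h3 : f = e
      · subst h3
        by_cases h4 : E.s f = x
        · rw [if_pos h4, if_pos ⟨h4, Or.inl rfl⟩, map_add, h2, add_zero, coeff_concat_cons,
            if_pos ⟨rfl, hm⟩, coeff_strip (Cycle.mem_of_cons_mem hm), dif_pos hf]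
        · rw [if_neg h4, if_neg (fun H => h4 H.1), map_zero]
      · rw [if_neg (c := (Path.cons f δ hf).src = x ∧ _)]
        · split_ifs
          · rw [map_add, h2, add_zero, coeff_concat_cons, if_neg (fun H => h3 H.1)]
          · exact map_zero _
        · rintro ⟨-, H | H⟩
          · exact h3 (by simpa using H)
          · exact h1 H.1
  rw [Finset.sum_congr rfl fun e _ => key e]
  by_cases h1 : γ.src = x
  · rw [if_pos h1]
    obtain ⟨e, he⟩ : ∃ e : E.Edge, ∀ f : E.Edge, (γ.edges.head? = some f ∨
        (γ = Path.trivial c.1.src ∧ c.1.edges.head? = some f)) ↔ f = e := by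
      rcases Path.eq_trivial_or_cons γ with h0 | ⟨f, δ, hf, rfl⟩
      · have h2 : γ.src = c.1.src := by
          have h3 := hm.1
          rw [h0] at h3
          exact h3
        rcases Path.eq_trivial_or_cons c.1 with h3 | ⟨f, δ, hf, h3⟩
        · exfalso
          rcases c.2 with h4 | h4
          · exact hx (h1 ▸ h2 ▸ h4.2)
          · exact h4.1 (by rw [h3]; rfl)
        · refine ⟨f, fun g => ?_⟩
          have h4 : γ.edges.head? = none := by rw [h0]; rfl
          have h5 : c.1.edges.head? = some f := by rw [h3]; rfl
          have h6 : γ = Path.trivial c.1.src := by rw [← h2]; exact h0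
          rw [h4, h5]
          constructor
          · rintro (H | H)
            · simp at H
            · exact (Option.some.inj H.2).symm
          · rintro rfl
            exact Or.inr ⟨h6, rfl⟩
      · refine ⟨f, fun g => ?_⟩
        constructor
        · rintro (H | H)
          · exact (Option.some.inj H).symm
          · have := congrArg Path.edges H.1
            simp [Path.trivial] at this
        · rintro rfl
          exact Or.inl rfl
    simp [h1, he]
  · simp [h1]

end FormalSeries

namespace UHat

variable {K : Type w} [Field K] {E : FinGraph.{u, v}} {c : E.Cycle}

theorem α_zero : α K c 0 = 0 := by
  simp [α, Cycle.indexSet]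

theorem α_of_mem {j : ℕ} (hj : j ∈ c.indexSet) (p : FormalSeries K c) :
    α K c j p = ofFinsupp K c (Finsupp.single ⟨j, hj⟩ p) := by
  rw [α, dif_pos hj]
  rfl

theorem hom_ext {f g : UHat K c →ₗ[K] UHat K c}
    (h : ∀ (j : ℕ), 1 ≤ j → ∀ p, f (α K c j p) = g (α K c j p)) : f = g := by
  suffices H : f ∘ₗ (ofFinsupp K c).toLinearMap = g ∘ₗ (ofFinsupp K c).toLinearMap by
    refine LinearMap.ext fun y => ?_
    simpa using LinearMap.congr_fun H ((ofFinsupp K c).symm y)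
  refine Finsupp.lhom_ext fun j p => ?_
  have := h j.1 j.2.1 p
  rw [α_of_mem j.2] at this
  exact this

theorem ofSummands_α_of_mem (g : ℕ → FormalSeries K c →ₗ[K] UHat K c) {j : ℕ}
    (hj : j ∈ c.indexSet) (p : FormalSeries K c) : ofSummands K c g (α K c j p) = g j p := by
  rw [α_of_mem hj]
  simp [ofSummands]

theorem ofSummands_α (g : ℕ → FormalSeries K c →ₗ[K] UHat K c)
    (hg : ∀ j ∉ c.indexSet, g j = 0) (j : ℕ) (p : FormalSeries K c) :
    ofSummands K c g (α K c j p) = g j p := by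
  by_cases hj : j ∈ c.indexSet
  · exact ofSummands_α_of_mem g hj p
  · rw [hg j hj]
    simp [α, hj]

theorem α_of_notMem {j : ℕ} (hj : j ∉ c.indexSet) : α K c j = 0 := by
  simp [α, hj]

theorem close_of_edges_eq_nil (h : c.1.edges = []) (e : E.Edge) :
    FormalSeries.close K c e = 0 := by
  ext p μ
  simp [FormalSeries.close, h]

theorem unroll_of_edges_eq_nil (h : c.1.edges = []) (e : E.Edge) :
    FormalSeries.unroll K c e = 0 := by
  ext p μ
  simp [FormalSeries.unroll, h]

theorem eq_zero_or_edges_eq_nil {j : ℕ} (hj : j ∉ c.indexSet) : j = 0 ∨ c.1.edges = [] := by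
  by_contra! H
  exact hj ⟨Nat.one_le_iff_ne_zero.2 H.1, fun h => absurd h H.2⟩

theorem actVertex_α (x : E.Vertex) (j : ℕ) (p : FormalSeries K c) :
    actVertex K c x (α K c j p) = α K c j (FormalSeries.proj K c x p) := by
  refine ofSummands_α _ (fun i hi => ?_) j p
  rw [α_of_notMem hi, LinearMap.zero_comp]

theorem actEdge_α (e : E.Edge) (j : ℕ) (p : FormalSeries K c) :
    actEdge K c e (α K c j p) = α K c j (FormalSeries.concat K c e p) +
      (α K c j (FormalSeries.close K c e p) + α K c (j - 1) (FormalSeries.close K c e p)) := by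
  refine ofSummands_α _ (fun i hi => ?_) j p
  rcases eq_zero_or_edges_eq_nil hi with rfl | h
  · simp [α_zero]
  · simp [α_of_notMem hi, close_of_edges_eq_nil h]

theorem actGhost_α (e : E.Edge) (j : ℕ) (p : FormalSeries K c) :
    actGhost K c e (α K c j p) = α K c j (FormalSeries.strip K c e p) +
      ∑ l ∈ Finset.range j, (-1 : K) ^ l • α K c (j - l) (FormalSeries.unroll K c e p) := by
  refine (ofSummands_α _ (fun i hi => ?_) j p).trans (by simp)
  rcases eq_zero_or_edges_eq_nil hi with rfl | h
  · simp [α_zero]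
  · simp [α_of_notMem hi, unroll_of_edges_eq_nil h]

theorem telescope (j : ℕ) (q : FormalSeries K c) :
    ∑ l ∈ Finset.range (j + 1), (-1 : K) ^ l • α K c (j + 1 - l) q +
      ∑ l ∈ Finset.range j, (-1 : K) ^ l • α K c (j - l) q = α K c (j + 1) q := by
  rw [Finset.sum_range_succ']
  have : ∀ l ∈ Finset.range j, (-1 : K) ^ (l + 1) • α K c (j + 1 - (l + 1)) q =
      - ((-1 : K) ^ l • α K c (j - l) q) := by
    intro l _
    rw [Nat.add_sub_add_right, pow_succ]
    simp
  rw [Finset.sum_congr rfl this, Finset.sum_neg_distrib]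
  simp

theorem telescope' (j : ℕ) (q : FormalSeries K c) :
    ∑ l ∈ Finset.range j, (-1 : K) ^ l • (α K c (j - l) q + α K c (j - l - 1) q) =
      α K c j q := by
  rcases j with _ | j
  · simp [α_zero]
  · rw [← telescope j q]
    simp only [smul_add, Finset.sum_add_distrib]
    congr 1
    rw [Finset.sum_range_succ]
    have h0 : j + 1 - j - 1 = 0 := by omega
    rw [h0, α_zero]
    simp only [LinearMap.zero_apply, smul_zero, add_zero]
    refine Finset.sum_congr rfl fun l _ => ?_
    have h1 : j + 1 - l - 1 = j - l := by omega
    rw [h1]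

open FormalSeries

theorem actVertex_mul_self (x : E.Vertex) :
    actVertex K c x ∘ₗ actVertex K c x = actVertex K c x := by
  refine hom_ext fun j _ p => ?_
  simp [actVertex_α, proj_proj_self]

theorem actVertex_mul_of_ne {x y : E.Vertex} (h : x ≠ y) :
    actVertex K c x ∘ₗ actVertex K c y = 0 := by
  refine hom_ext fun j _ p => ?_
  simp [actVertex_α, proj_proj_of_ne h]

theorem sum_actVertex [Fintype E.Vertex] : ∑ x : E.Vertex, actVertex K c x = LinearMap.id := by
  refine hom_ext fun j _ p => ?_
  simp only [LinearMap.sum_apply, actVertex_α, LinearMap.id_apply]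
  rw [← map_sum, sum_proj]

theorem actVertex_actEdge (e : E.Edge) :
    actVertex K c (E.s e) ∘ₗ actEdge K c e = actEdge K c e := by
  refine hom_ext fun j _ p => ?_
  simp [actVertex_α, actEdge_α, proj_concat, proj_close]

theorem actEdge_actVertex (e : E.Edge) :
    actEdge K c e ∘ₗ actVertex K c (E.r e) = actEdge K c e := by
  refine hom_ext fun j _ p => ?_
  simp [actVertex_α, actEdge_α, concat_proj, close_proj]

theorem actVertex_actGhost (e : E.Edge) :
    actVertex K c (E.r e) ∘ₗ actGhost K c e = actGhost K c e := by
  refine hom_ext fun j _ p => ?_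
  simp [actVertex_α, actGhost_α, proj_strip, proj_unroll]

theorem actGhost_actVertex (e : E.Edge) :
    actGhost K c e ∘ₗ actVertex K c (E.s e) = actGhost K c e := by
  refine hom_ext fun j _ p => ?_
  simp [actVertex_α, actGhost_α, strip_proj, unroll_proj]

theorem actGhost_actEdge_self (e : E.Edge) :
    actGhost K c e ∘ₗ actEdge K c e = actVertex K c (E.r e) := by
  refine hom_ext fun j hj p => ?_
  obtain ⟨j, rfl⟩ := Nat.exists_eq_add_of_le' hj
  simp only [LinearMap.comp_apply, actEdge_α, map_add, actGhost_α, strip_close, unroll_concat,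
    map_zero, smul_zero, Finset.sum_const_zero, add_zero, zero_add, Nat.add_sub_cancel]
  rw [telescope, actVertex_α, ← map_add, strip_concat_self]

theorem actGhost_actEdge_of_ne {e f : E.Edge} (h : e ≠ f) :
    actGhost K c e ∘ₗ actEdge K c f = 0 := by
  refine hom_ext fun j hj p => ?_
  simp [actEdge_α, actGhost_α, strip_close, unroll_concat, strip_concat_of_ne h,
    unroll_close_of_ne h]

theorem actEdge_actGhost_α (e : E.Edge) (j : ℕ) (p : FormalSeries K c) :
    actEdge K c e (actGhost K c e (α K c j p)) =
      α K c j (concat K c e (strip K c e p) + close K c e (unroll K c e p)) := by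
  simp only [actGhost_α, map_add, map_sum, map_smul, actEdge_α, close_strip, concat_unroll,
    map_zero, add_zero, zero_add]
  rw [telescope']

open Classical in
theorem sum_actEdge_actGhost [Fintype E.Edge] {x : E.Vertex} (hx : ¬ E.IsSink x) :
    ∑ e : E.Edge, (if E.s e = x then actEdge K c e ∘ₗ actGhost K c e else 0) =
      actVertex K c x := by
  refine hom_ext fun j hj p => ?_
  rw [actVertex_α, ← coeff_sum_concat_strip hx, map_sum, LinearMap.sum_apply]
  refine Finset.sum_congr rfl fun e _ => ?_
  split_ifs
  · exact actEdge_actGhost_α e j p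
  · simp

variable (K c)

/-- The Cuntz–Krieger family of operators on `Û`. -/
noncomputable def actGen : LeavittGen E → Module.End K (UHat K c)
  | .vertex x => actVertex K c x
  | .edge e => actEdge K c e
  | .ghost e => actGhost K c e

theorem actGen_rel ⦃a b : FreeAlgebra K (LeavittGen E)⦄ (h : LeavittPathAlgebra.Rel K E a b) :
    FreeAlgebra.lift K (actGen K c) a = FreeAlgebra.lift K (actGen K c) b := by
  have hv (x : E.Vertex) : FreeAlgebra.lift K (actGen K c) (LeavittPathAlgebra.fv K E x) =
      actVertex K c x := FreeAlgebra.lift_ι_apply _ _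
  have he (e : E.Edge) : FreeAlgebra.lift K (actGen K c) (LeavittPathAlgebra.fe K E e) =
      actEdge K c e := FreeAlgebra.lift_ι_apply _ _
  have hg (e : E.Edge) : FreeAlgebra.lift K (actGen K c) (LeavittPathAlgebra.fg K E e) =
      actGhost K c e := FreeAlgebra.lift_ι_apply _ _
  let _ := Fintype.ofFinite E.Vertex
  let _ := Fintype.ofFinite E.Edge
  cases h with
  | vertex_mul_self x => rw [map_mul, hv]; exact actVertex_mul_self x
  | vertex_mul_of_ne x y hxy => rw [map_mul, hv, hv, map_zero]; exact actVertex_mul_of_ne hxy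
  | sum_vertex =>
    rw [finsum_eq_sum_of_fintype, map_sum, map_one, Finset.sum_congr rfl fun x _ => hv x]
    exact sum_actVertex
  | source_mul_edge e => rw [map_mul, hv, he]; exact actVertex_actEdge e
  | edge_mul_range e => rw [map_mul, hv, he]; exact actEdge_actVertex e
  | range_mul_ghost e => rw [map_mul, hv, hg]; exact actVertex_actGhost e
  | ghost_mul_source e => rw [map_mul, hv, hg]; exact actGhost_actVertex e
  | ghost_mul_edge_self e => rw [map_mul, hv, he, hg]; exact actGhost_actEdge_self e
  | ghost_mul_edge_of_ne e f hef =>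
    rw [map_mul, he, hg, map_zero]; exact actGhost_actEdge_of_ne hef
  | sum_edge_mul_ghost x hx =>
    classical
    rw [finsum_eq_sum_of_fintype, map_sum, hv, ← sum_actEdge_actGhost hx]
    refine Finset.sum_congr rfl fun e _ => ?_
    rw [finsum_eq_if]
    split_ifs
    · rw [map_mul, he, hg]; rfl
    · exact (map_zero (FreeAlgebra.lift K (actGen K c))).symm

/-- The homomorphism `Φ : L_K(E) → End_K(Û)` with `v ↦ P_v`, `e ↦ S_e`, `e* ↦ S_{e*}`. -/
noncomputable def rep : LeavittPathAlgebra K E →ₐ[K] Module.End K (UHat K c) :=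
  LeavittPathAlgebra.lift (actGen K c) (actGen_rel K c)

/-- The left `L_K(E)`-module `Û_{E,c-1}`, with `a • u = Φ(a)(u)`. -/
noncomputable instance instModule : Module (LeavittPathAlgebra K E) (UHat K c) :=
  Module.compHom (UHat K c) (rep K c).toRingHom

variable {K c}

theorem smul_def (a : LeavittPathAlgebra K E) (y : UHat K c) : a • y = rep K c a y := rfl

theorem vertex_smul (x : E.Vertex) (y : UHat K c) :
    (LeavittPathAlgebra.vertex x : LeavittPathAlgebra K E) • y = actVertex K c x y := by
  rw [smul_def, rep, LeavittPathAlgebra.vertex, LeavittPathAlgebra.lift_mk,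
    LeavittPathAlgebra.fv, FreeAlgebra.lift_ι_apply]
  rfl

theorem edge_smul (e : E.Edge) (y : UHat K c) :
    (LeavittPathAlgebra.edge e : LeavittPathAlgebra K E) • y = actEdge K c e y := by
  rw [smul_def, rep, LeavittPathAlgebra.edge, LeavittPathAlgebra.lift_mk,
    LeavittPathAlgebra.fe, FreeAlgebra.lift_ι_apply]
  rfl

theorem ghost_smul (e : E.Edge) (y : UHat K c) :
    (LeavittPathAlgebra.ghost e : LeavittPathAlgebra K E) • y = actGhost K c e y := by
  rw [smul_def, rep, LeavittPathAlgebra.ghost, LeavittPathAlgebra.lift_mk,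
    LeavittPathAlgebra.fg, FreeAlgebra.lift_ι_apply]
  rfl

end UHat

/-! ### The elements `γ α_{c,j}`

The two identities below show that `Û` extends the Prüfer module: `γ ∈ L_K(E)` times `α_{c,j}` is
the basis element `γ α_{c,j}` for `γ ∈ P_c`, and `(c - 1) α_{c,j} = α_{c,j-1}`. -/

/-- A path, regarded as an element of the Leavitt path algebra. -/
noncomputable def LeavittPathAlgebra.path {K : Type w} [Field K] {E : FinGraph.{u, v}}
    (γ : E.Path) : LeavittPathAlgebra K E :=
  (γ.edges.map edge).foldr (· * ·) (vertex γ.tgt)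

namespace UHat

variable {K : Type w} [Field K] {E : FinGraph.{u, v}} {c : E.Cycle}

open Classical in
/-- The element `γ α_{c,j}` of `Û` for `γ ∈ P_c`. -/
noncomputable def basisElt (K : Type w) [Field K] {E : FinGraph.{u, v}} {c : E.Cycle}
    (γ : c.pathSet) (j : ℕ) : UHat K c := α K c j (Pi.single γ 1)

open Classical in
theorem coeff_single (γ : c.pathSet) (δ : E.Path) :
    FormalSeries.coeff K c δ (Pi.single γ 1) = if δ = γ.1 then 1 else 0 := by
  by_cases h : δ ∈ c.pathSet
  · rw [FormalSeries.coeff_of_mem h, Pi.single_apply]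
    simp only [Subtype.ext_iff]
  · rw [FormalSeries.coeff_of_notMem h, if_neg]
    rintro rfl
    exact h γ.2

theorem edge_smul_basisElt {e : E.Edge} {γ : E.Path} (h : E.r e = γ.src)
    (hm : Path.cons e γ h ∈ c.pathSet) (j : ℕ) :
    (LeavittPathAlgebra.edge e : LeavittPathAlgebra K E) •
      basisElt K ⟨γ, Cycle.mem_of_cons_mem hm⟩ j = basisElt K ⟨Path.cons e γ h, hm⟩ j := by
  classical
  rw [basisElt, edge_smul, actEdge_α]
  have h1 : FormalSeries.close K c e (Pi.single ⟨γ, Cycle.mem_of_cons_mem hm⟩ 1) = 0 := by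
    refine FormalSeries.ext_coeff fun δ _ => ?_
    rw [FormalSeries.coeff_close, coeff_single, map_zero]
    split_ifs with h2 h3
    · obtain ⟨hr, h5⟩ := FormalSeries.cycle_eq_cons h2.1
      have h6 : c.1.tail = γ := h3
      subst h6
      rw [← h5] at hm
      exact absurd hm (FormalSeries.self_notMem h2.1)
    · rfl
    · rfl
  have h2 : FormalSeries.concat K c e (Pi.single ⟨γ, Cycle.mem_of_cons_mem hm⟩ 1) =
      Pi.single ⟨Path.cons e γ h, hm⟩ 1 := by
    refine FormalSeries.ext_coeff fun δ hδ => ?_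
    rw [coeff_single]
    rcases Path.eq_trivial_or_cons δ with h0 | ⟨f, ε, hf, rfl⟩
    · rw [h0, FormalSeries.coeff_concat_trivial, if_neg]
      intro H
      have := congrArg Path.edges H
      simp [Path.trivial] at this
    · rw [FormalSeries.coeff_concat_cons, coeff_single]
      by_cases h3 : Path.cons f ε hf = Path.cons e γ h
      · obtain ⟨rfl, rfl⟩ := Path.cons_inj h3
        rw [if_pos ⟨rfl, hδ⟩, if_pos rfl, if_pos rfl]
      · rw [if_neg h3]
        split_ifs with h4 h5
        · obtain ⟨rfl, -⟩ := h4
          have h5 : ε = γ := h5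
          subst h5
          exact absurd rfl h3
        · rfl
        · rfl
  rw [h1, h2, map_zero, map_zero, add_zero, add_zero]
  rfl

theorem path_smul_basisElt (γ : c.pathSet) (j : ℕ) :
    (LeavittPathAlgebra.path γ.1 : LeavittPathAlgebra K E) •
      basisElt K ⟨Path.trivial c.1.src, c.trivial_mem⟩ j = basisElt K γ j := by
  obtain ⟨γ, hγ⟩ := γ
  obtain ⟨n, hn⟩ : ∃ n, γ.length = n := ⟨_, rfl⟩
  induction n generalizing γ with
  | zero =>
    rcases Path.eq_trivial_or_cons γ with h0 | ⟨e, δ, h, rfl⟩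
    · have h1 : γ.tgt = γ.src := by rw [h0]; rfl
      have h2 : γ = Path.trivial c.1.src := by rw [← hγ.1, h1]; exact h0
      subst h2
      classical
      change (LeavittPathAlgebra.vertex c.1.src : LeavittPathAlgebra K E) • _ = _
      rw [vertex_smul, basisElt, actVertex_α]
      congr 1
      refine FormalSeries.ext_coeff fun δ _ => ?_
      rw [FormalSeries.coeff_proj, coeff_single]
      split_ifs with h3 h4 h5
      · rfl
      · rfl
      · rw [h5] at h3
        exact absurd rfl h3
      · rfl
    · simp [Path.length] at hn
  | succ n ih =>
    rcases Path.eq_trivial_or_cons γ with h0 | ⟨e, δ, h, rfl⟩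
    · rw [h0] at hn
      simp [Path.length, Path.trivial] at hn
    · have h1 : (LeavittPathAlgebra.path (Path.cons e δ h) : LeavittPathAlgebra K E) =
          LeavittPathAlgebra.edge e * LeavittPathAlgebra.path δ := rfl
      rw [h1, mul_smul, ih δ (Cycle.mem_of_cons_mem hγ) (by simpa [Path.length] using hn),
        edge_smul_basisElt h hγ]

/-- `(c - 1) α_{c,j} = α_{c,j-1}` for a proper cycle `c`. -/
theorem cycle_sub_one_smul (hc : c.1.edges ≠ []) (j : ℕ) :
    ((LeavittPathAlgebra.path c.1 : LeavittPathAlgebra K E) - 1) •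
      basisElt K ⟨Path.trivial c.1.src, c.trivial_mem⟩ j =
        basisElt K ⟨Path.trivial c.1.src, c.trivial_mem⟩ (j - 1) := by
  classical
  obtain ⟨e, he⟩ : ∃ e, c.1.edges.head? = some e := by
    cases h : c.1.edges with
    | nil => exact absurd h hc
    | cons e l => exact ⟨e, rfl⟩
  obtain ⟨hr, h5⟩ := FormalSeries.cycle_eq_cons he
  have h1 : (LeavittPathAlgebra.path c.1 : LeavittPathAlgebra K E) =
      LeavittPathAlgebra.edge e * LeavittPathAlgebra.path c.1.tail := by
    conv_lhs => rw [h5]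
    rfl
  have h2 : FormalSeries.concat K c e (Pi.single ⟨c.1.tail, Cycle.tail_mem hc⟩ 1) = 0 := by
    refine FormalSeries.ext_coeff fun δ hδ => ?_
    rw [map_zero]
    rcases Path.eq_trivial_or_cons δ with h0 | ⟨f, ε, hf, rfl⟩
    · rw [h0, FormalSeries.coeff_concat_trivial]
    · rw [FormalSeries.coeff_concat_cons, coeff_single]
      split_ifs with h3 h4
      · obtain ⟨rfl, -⟩ := h3
        have h4 : ε = c.1.tail := h4
        subst h4
        rw [← h5] at hδ
        exact absurd hδ (FormalSeries.self_notMem he)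
      · rfl
      · rfl
  have h3 : FormalSeries.close K c e (Pi.single ⟨c.1.tail, Cycle.tail_mem hc⟩ 1) =
      Pi.single ⟨Path.trivial c.1.src, c.trivial_mem⟩ 1 := by
    refine FormalSeries.ext_coeff fun δ _ => ?_
    rw [FormalSeries.coeff_close, coeff_single, coeff_single]
    simp [he]
  rw [sub_smul, one_smul, h1, mul_smul, path_smul_basisElt ⟨c.1.tail, Cycle.tail_mem hc⟩ j,
    edge_smul, basisElt, actEdge_α, h2, h3, map_zero, zero_add]
  simp [basisElt]

end UHat

/-! ### Generators of Leavitt path algebras and linearity over them -/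

/-! Let v_0, …, v_{r-1} be the vertices of d in their order, v_0 = s(d). As d has no entrances, the
only edge from v_i back to the cycle is d_{i+1}, and the path d_1⋯d_i identifies v_i with the
idempotent (d_1⋯d_i)(d_1⋯d_i)* below v_0. Up to Morita equivalence the vertices v_1, …, v_{r-1}
therefore add nothing, and L_K(F) is L_K(E) seen from v_0 and from the vertices outside d⁰: the
vertex v̄ corresponds to v_0, the loop d' to d, and φ(f) to d_1⋯d_i f for an exit f at v_i. No two
of these paths with the same source are initial parts of each other (`exists_split_τ`), and the
Cuntz–Krieger relation at v̄ is the one of E iterated once around d (`vertex_src_eq_sum`).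

Both functors have the form M ↦ ⨁ p_x M for a system of elements in an algebra A, in effect a
homomorphism from the Leavitt path algebra to matrices over A indexed by the vertices. The direct
sum separates the vertices, so the p_x need not be orthogonal. This matters for `expandSystem`,
where v_i goes to p_i = v̄ - ∑ φ(f)φ(f)*, summed over the exits f at v_0, …, v_{i-1}: these
idempotents form a decreasing chain. The two composites are identified with the identity by explicit
maps (`unitEquiv`, `counitEquiv`).

For the modules Û it suffices to show G_1(Û_E) ≅ Û_F. The coefficient of u at a path γ is the
coefficient of γ*u at s(c) (`coeffs_eq`), and c* acts on the coefficients at s(c) by a map `twist`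
that does not depend on the graph (`coeffs_gmon_cycle`). Hence a bijection from the path set of F
onto the paths in P_c that start at v_0 or outside d⁰ induces the isomorphism, provided that it
turns edges of F into their paths in E (`compareHom_smul`, `compareHom_bijective`). If c misses d,
the bijection unfolds each edge of F; if c is the rotation of d starting at v_k, both sets have one
element, v̄ and d_1⋯d_k. -/

noncomputable instance FinGraph.fintypeVertex (E : FinGraph.{u, v}) : Fintype E.Vertex :=
  Fintype.ofFinite _

noncomputable instance FinGraph.fintypeEdge (E : FinGraph.{u, v}) : Fintype E.Edge :=
  Fintype.ofFinite _

namespace LeavittPathAlgebra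

variable {K : Type w} [Field K] {E : FinGraph.{u, v}}

theorem mk_eq_of_rel {a b : FreeAlgebra K (LeavittGen E)} (h : Rel K E a b) :
    (mk a : LeavittPathAlgebra K E) = mk b := RingQuot.mkAlgHom_rel K h

theorem mk_surjective :
    Function.Surjective (mk : FreeAlgebra K (LeavittGen E) →ₐ[K] LeavittPathAlgebra K E) :=
  RingQuot.mkAlgHom_surjective K _

theorem vertex_mul_self (x : E.Vertex) :
    (vertex x * vertex x : LeavittPathAlgebra K E) = vertex x := by
  simpa only [vertex, edge, ghost, map_mul] using mk_eq_of_rel (Rel.vertex_mul_self (K := K) x)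

theorem vertex_mul_of_ne {x y : E.Vertex} (h : x ≠ y) :
    (vertex x * vertex y : LeavittPathAlgebra K E) = 0 := by
  simpa only [vertex, edge, ghost, map_mul, map_zero] using mk_eq_of_rel (Rel.vertex_mul_of_ne (K := K) x y h)

theorem sum_vertex : (∑ x : E.Vertex, vertex x : LeavittPathAlgebra K E) = 1 := by
  have := mk_eq_of_rel (Rel.sum_vertex (K := K) (E := E))
  rwa [finsum_eq_sum_of_fintype, map_sum, map_one] at this

theorem source_mul_edge (e : E.Edge) :
    (vertex (E.s e) * edge e : LeavittPathAlgebra K E) = edge e := by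
  simpa only [vertex, edge, ghost, map_mul] using mk_eq_of_rel (Rel.source_mul_edge (K := K) e)

theorem edge_mul_range (e : E.Edge) :
    (edge e * vertex (E.r e) : LeavittPathAlgebra K E) = edge e := by
  simpa only [vertex, edge, ghost, map_mul] using mk_eq_of_rel (Rel.edge_mul_range (K := K) e)

theorem range_mul_ghost (e : E.Edge) :
    (vertex (E.r e) * ghost e : LeavittPathAlgebra K E) = ghost e := by
  simpa only [vertex, edge, ghost, map_mul] using mk_eq_of_rel (Rel.range_mul_ghost (K := K) e)

theorem ghost_mul_source (e : E.Edge) :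
    (ghost e * vertex (E.s e) : LeavittPathAlgebra K E) = ghost e := by
  simpa only [vertex, edge, ghost, map_mul] using mk_eq_of_rel (Rel.ghost_mul_source (K := K) e)

theorem ghost_mul_edge_self (e : E.Edge) :
    (ghost e * edge e : LeavittPathAlgebra K E) = vertex (E.r e) := by
  simpa only [vertex, edge, ghost, map_mul] using mk_eq_of_rel (Rel.ghost_mul_edge_self (K := K) e)

theorem ghost_mul_edge_of_ne {e f : E.Edge} (h : e ≠ f) :
    (ghost e * edge f : LeavittPathAlgebra K E) = 0 := by
  simpa only [vertex, edge, ghost, map_mul, map_zero] using mk_eq_of_rel (Rel.ghost_mul_edge_of_ne (K := K) e f h)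

open Classical in
theorem vertex_eq_sum {x : E.Vertex} (hx : ¬ E.IsSink x) :
    (vertex x : LeavittPathAlgebra K E) =
      ∑ e : E.Edge, if E.s e = x then edge e * ghost e else 0 := by
  have := mk_eq_of_rel (Rel.sum_edge_mul_ghost (K := K) x hx)
  rw [finsum_eq_sum_of_fintype, map_sum] at this
  refine this.trans (Finset.sum_congr rfl fun e _ => ?_)
  rw [finsum_eq_if]
  split_ifs
  · rw [map_mul]; rfl
  · exact map_zero _

section Linear

variable {M N : Type*} [AddCommGroup M] [Module (LeavittPathAlgebra K E) M] [AddCommGroup N]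
  [Module (LeavittPathAlgebra K E) N]

local notation "L" => LeavittPathAlgebra K E

/-- An additive map which commutes with the scalars and all generators is linear. -/
theorem map_smul_of_generators (f : M →+ N)
    (hK : ∀ (k : K) (m : M), f (algebraMap K L k • m) = algebraMap K L k • f m)
    (hv : ∀ (x : E.Vertex) (m : M), f ((vertex x : L) • m) = (vertex x : L) • f m)
    (he : ∀ (e : E.Edge) (m : M), f ((edge e : L) • m) = (edge e : L) • f m)
    (hg : ∀ (e : E.Edge) (m : M), f ((ghost e : L) • m) = (ghost e : L) • f m)
    (a : L) (m : M) : f (a • m) = a • f m := by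
  obtain ⟨a, rfl⟩ := mk_surjective a
  induction a generalizing m with
  | grade0 k => rw [AlgHom.commutes]; exact hK k m
  | grade1 g =>
    cases g with
    | vertex x => exact hv x m
    | edge e => exact he e m
    | ghost e => exact hg e m
  | mul a b ha hb => rw [map_mul, mul_smul, mul_smul, ha, hb]
  | add a b ha hb => rw [map_add, add_smul, add_smul, map_add, ha, hb]

/-- An additive map which commutes with the scalars, the vertices and the edges is linear. -/
theorem map_smul_of_edges (f : M →+ N)
    (hK : ∀ (k : K) (m : M), f (algebraMap K L k • m) = algebraMap K L k • f m)
    (hv : ∀ (x : E.Vertex) (m : M), f ((vertex x : L) • m) = (vertex x : L) • f m)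
    (he : ∀ (e : E.Edge) (m : M), f ((edge e : L) • m) = (edge e : L) • f m)
    (a : L) (m : M) : f (a • m) = a • f m := by
  classical
  refine map_smul_of_generators f hK hv he (fun e m => ?_) a m
  -- Insert s(e) = ∑ g g* between e* and f(m): f commutes with every g, and e*g = 0 unless g = e.
  have h1 : (ghost e : L) • f m = (ghost e : L) • f ((vertex (E.s e) : L) • m) := by
    rw [hv, ← mul_smul, ghost_mul_source]
  rw [h1, vertex_eq_sum (fun h => h e rfl), Finset.sum_smul, map_sum, Finset.smul_sum,
    Finset.sum_eq_single e]
  · rw [if_pos rfl, mul_smul, he, ← mul_smul, ghost_mul_edge_self, ← hv, ← mul_smul,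
      range_mul_ghost]
  · intro g _ hg
    split_ifs
    · rw [mul_smul, he, ← mul_smul, ghost_mul_edge_of_ne hg.symm, zero_smul]
    · rw [zero_smul, map_zero, smul_zero]
  · exact fun h => absurd (Finset.mem_univ _) h

/-- An additive map which commutes with the scalars, the vertices and the ghost edges is
linear. -/
theorem map_smul_of_ghosts (f : M →+ N)
    (hK : ∀ (k : K) (m : M), f (algebraMap K L k • m) = algebraMap K L k • f m)
    (hv : ∀ (x : E.Vertex) (m : M), f ((vertex x : L) • m) = (vertex x : L) • f m)
    (hg : ∀ (e : E.Edge) (m : M), f ((ghost e : L) • m) = (ghost e : L) • f m)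
    (a : L) (m : M) : f (a • m) = a • f m := by
  classical
  refine map_smul_of_generators f hK hv (fun e m => ?_) hg a m
  -- Dually, multiply f(e m) by s(e) = ∑ g g* and move g* inside f, where g*e = 0 unless g = e.
  have h1 : f ((edge e : L) • m) = (vertex (E.s e) : L) • f ((edge e : L) • m) := by
    rw [← hv, ← mul_smul, source_mul_edge]
  rw [h1, vertex_eq_sum (fun h => h e rfl), Finset.sum_smul, Finset.sum_eq_single e]
  · rw [if_pos rfl, mul_smul, ← hg, ← mul_smul _ _ m, ghost_mul_edge_self, hv, ← mul_smul,
      edge_mul_range]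
  · intro g _ hge
    split_ifs
    · rw [mul_smul, ← hg, ← mul_smul _ _ m, ghost_mul_edge_of_ne hge, zero_smul, map_zero,
        smul_zero]
    · rw [zero_smul]
  · exact fun h => absurd (Finset.mem_univ _) h

end Linear

end LeavittPathAlgebra

/-! ### Systems of a graph in an algebra, and the induced functors -/

open Classical in
/-- Elements `p x`, `q e`, `q' e` of an algebra `A` which satisfy the relations of `L_K(E)` that
do not involve two different vertices. Each `A`-module `M` then gives rise to the module
`⨁ p x • M` over `L_K(E)`. -/
structure LeavittSystem (K : Type w) [Field K] (E : FinGraph.{u, v}) (A : Type*) [Ring A]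
    [Algebra K A] where
  /-- the idempotents for the vertices -/
  p : E.Vertex → A
  /-- the elements for the edges -/
  q : E.Edge → A
  /-- the elements for the ghost edges -/
  q' : E.Edge → A
  p_mul_p (x : E.Vertex) : p x * p x = p x
  p_mul_q (e : E.Edge) : p (E.s e) * q e = q e
  q_mul_p (e : E.Edge) : q e * p (E.r e) = q e
  p_mul_q' (e : E.Edge) : p (E.r e) * q' e = q' e
  q'_mul_p (e : E.Edge) : q' e * p (E.s e) = q' e
  q'_mul_q_self (e : E.Edge) : q' e * q e = p (E.r e)
  q'_mul_q_of_ne (e f : E.Edge) : e ≠ f → E.s e = E.s f → q' e * q f = 0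
  p_eq_sum (x : E.Vertex) : ¬ E.IsSink x → p x = ∑ e : E.Edge, if E.s e = x then q e * q' e else 0

namespace LeavittSystem

section Sections

variable {K : Type w} [Field K] {E : FinGraph.{u, v}} {A : Type*} [Ring A] [Algebra K A]
  (σ : LeavittSystem K E A) (M : Type*) [AddCommGroup M] [Module A M]

/-- The families `w` with `w x ∈ p x • M`. -/
def sections : AddSubgroup (E.Vertex → M) where
  carrier := {w | ∀ x, σ.p x • w x = w x}
  add_mem' {a b} ha hb x := by rw [Pi.add_apply, smul_add, ha, hb]
  zero_mem' x := smul_zero _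
  neg_mem' {a} ha x := by rw [Pi.neg_apply, smul_neg, ha]

/-- The direct sum of the groups `p x • M`. -/
def Sections : Type _ := σ.sections M

namespace Sections

instance : AddCommGroup (σ.Sections M) := inferInstanceAs (AddCommGroup (σ.sections M))

variable {σ M}

instance : CoeFun (σ.Sections M) (fun _ => E.Vertex → M) := ⟨fun w => w.1⟩

theorem p_smul (w : σ.Sections M) (x : E.Vertex) : σ.p x • w x = w x := w.2 x

@[ext]
theorem ext {w z : σ.Sections M} (h : ∀ x, w x = z x) : w = z := Subtype.ext (funext h)

@[simp] theorem add_apply (w z : σ.Sections M) (x : E.Vertex) : (w + z) x = w x + z x := rfl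

@[simp] theorem zero_apply (x : E.Vertex) : (0 : σ.Sections M) x = 0 := rfl

variable (σ M) in
/-- The component of a family at a vertex. -/
def eval (x : E.Vertex) : σ.Sections M →+ M where
  toFun w := w x
  map_zero' := rfl
  map_add' _ _ := rfl

theorem sum_apply {ι : Type*} (s : Finset ι) (w : ι → σ.Sections M) (x : E.Vertex) :
    (∑ i ∈ s, w i) x = ∑ i ∈ s, w i x := map_sum (eval σ M x) w s

noncomputable instance : SMul K (σ.Sections M) where
  smul k w := ⟨fun x => algebraMap K A k • w x, fun x => by
    rw [← mul_smul, ← Algebra.commutes, mul_smul, w.p_smul]⟩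

theorem field_smul_apply (k : K) (w : σ.Sections M) (x : E.Vertex) :
    (k • w) x = algebraMap K A k • w x := rfl

noncomputable instance instModuleField : Module K (σ.Sections M) where
  one_smul w := ext fun x => by simp [field_smul_apply]
  mul_smul k l w := ext fun x => by simp [field_smul_apply, mul_smul]
  smul_zero k := ext fun x => by simp [field_smul_apply]
  smul_add k w z := ext fun x => by simp [field_smul_apply]
  add_smul k l w := ext fun x => by simp [field_smul_apply, add_smul]
  zero_smul w := ext fun x => by simp [field_smul_apply]

variable (σ M) in
open Classical in
/-- The operator which moves the component at `y` to the component at `x`, multiplied by `a`. -/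
noncomputable def transfer (x y : E.Vertex) (a : A) (ha : σ.p x * a = a) :
    Module.End K (σ.Sections M) where
  toFun w := ⟨fun z => if z = x then a • w y else 0, fun z => by
    dsimp only
    split_ifs with h
    · rw [h, ← mul_smul, ha]
    · exact smul_zero _⟩
  map_add' w z := ext fun t => by
    change (if t = x then a • (w y + z y) else 0) =
      (if t = x then a • w y else 0) + (if t = x then a • z y else 0)
    split_ifs
    · exact smul_add _ _ _
    · simp
  map_smul' k w := ext fun t => by
    change (if t = x then a • (k • w) y else 0) =
      algebraMap K A k • (if t = x then a • w y else 0)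
    split_ifs
    · rw [field_smul_apply, ← mul_smul, ← mul_smul, Algebra.commutes]
    · simp

open Classical in
theorem transfer_apply (x y : E.Vertex) (a : A) (ha : σ.p x * a = a) (w : σ.Sections M)
    (z : E.Vertex) : transfer σ M x y a ha w z = if z = x then a • w y else 0 := rfl

theorem transfer_mul (x y z : E.Vertex) (a b : A) (ha : σ.p x * a = a) (hb : σ.p y * b = b) :
    transfer σ M x y a ha * transfer σ M y z b hb =
      transfer σ M x z (a * b) (by rw [← mul_assoc, ha]) := by
  ext w t
  simp only [Module.End.mul_apply, transfer_apply, if_true, mul_smul]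

theorem transfer_mul_of_ne {x y y' z : E.Vertex} (h : y ≠ y') (a b : A) (ha : σ.p x * a = a)
    (hb : σ.p y' * b = b) : transfer σ M x y a ha * transfer σ M y' z b hb = 0 := by
  ext w t
  simp only [Module.End.mul_apply, transfer_apply, if_neg h, smul_zero, ite_self,
    LinearMap.zero_apply, zero_apply]

theorem transfer_congr {x y : E.Vertex} {a b : A} (h : a = b) (ha : σ.p x * a = a) :
    transfer σ M x y a ha = transfer σ M x y b (h ▸ ha) := by subst h; rfl

variable (σ M) in
/-- The operators on `⨁ p x • M` for the generators of `L_K(E)`. -/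
noncomputable def gen : LeavittGen E → Module.End K (σ.Sections M)
  | .vertex x => transfer σ M x x (σ.p x) (σ.p_mul_p x)
  | .edge e => transfer σ M (E.s e) (E.r e) (σ.q e) (σ.p_mul_q e)
  | .ghost e => transfer σ M (E.r e) (E.s e) (σ.q' e) (σ.p_mul_q' e)

-- Composing two transfers multiplies their coefficients if the inner vertices agree and gives 0
-- otherwise. Relations between different vertices thus come from the direct sum, and all others
-- from the axioms of the system.
open LeavittPathAlgebra in
theorem gen_rel ⦃a b : FreeAlgebra K (LeavittGen E)⦄ (h : LeavittPathAlgebra.Rel K E a b) :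
    FreeAlgebra.lift K (gen σ M) a = FreeAlgebra.lift K (gen σ M) b := by
  have hv (x : E.Vertex) : FreeAlgebra.lift K (gen σ M) (fv K E x) =
      transfer σ M x x (σ.p x) (σ.p_mul_p x) := FreeAlgebra.lift_ι_apply _ _
  have he (e : E.Edge) : FreeAlgebra.lift K (gen σ M) (fe K E e) =
      transfer σ M (E.s e) (E.r e) (σ.q e) (σ.p_mul_q e) := FreeAlgebra.lift_ι_apply _ _
  have hg (e : E.Edge) : FreeAlgebra.lift K (gen σ M) (fg K E e) =
      transfer σ M (E.r e) (E.s e) (σ.q' e) (σ.p_mul_q' e) := FreeAlgebra.lift_ι_apply _ _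
  cases h with
  | vertex_mul_self x =>
    rw [map_mul, hv, transfer_mul]; exact transfer_congr (σ.p_mul_p x) _
  | vertex_mul_of_ne x y hxy => rw [map_mul, hv, hv, map_zero, transfer_mul_of_ne hxy]
  | sum_vertex =>
    classical
    rw [finsum_eq_sum_of_fintype, map_sum, map_one, Finset.sum_congr rfl fun x _ => hv x]
    ext w t
    rw [LinearMap.sum_apply, sum_apply]
    simp only [transfer_apply, Finset.sum_ite_eq, Finset.mem_univ, if_true, p_smul]
    rfl
  | source_mul_edge e =>
    rw [map_mul, hv, he, transfer_mul]; exact transfer_congr (σ.p_mul_q e) _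
  | edge_mul_range e =>
    rw [map_mul, hv, he, transfer_mul]; exact transfer_congr (σ.q_mul_p e) _
  | range_mul_ghost e =>
    rw [map_mul, hv, hg, transfer_mul]; exact transfer_congr (σ.p_mul_q' e) _
  | ghost_mul_source e =>
    rw [map_mul, hv, hg, transfer_mul]; exact transfer_congr (σ.q'_mul_p e) _
  | ghost_mul_edge_self e =>
    rw [map_mul, hv, he, hg, transfer_mul]; exact transfer_congr (σ.q'_mul_q_self e) _
  | ghost_mul_edge_of_ne e f hef =>
    rw [map_mul, he, hg, map_zero]
    -- Only for equal sources does this relation need an axiom; for different sources the two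
    -- operators meet in different components.
    by_cases h : E.s e = E.s f
    · ext w t
      simp only [Module.End.mul_apply, transfer_apply, h, if_true, ← mul_smul,
        σ.q'_mul_q_of_ne e f hef h, zero_smul, ite_self, LinearMap.zero_apply, zero_apply]
    · exact transfer_mul_of_ne h _ _ _ _
  | sum_edge_mul_ghost x hx =>
    classical
    rw [finsum_eq_sum_of_fintype, map_sum, hv]
    have h1 (e : E.Edge) : FreeAlgebra.lift K (gen σ M)
        (∑ᶠ (_ : E.s e = x), fe K E e * fg K E e) = if E.s e = x then
          transfer σ M (E.s e) (E.s e) (σ.q e * σ.q' e) (by rw [← mul_assoc, σ.p_mul_q]) else 0 := by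
      rw [finsum_eq_if]
      split_ifs
      · rw [map_mul, he, hg, transfer_mul]
      · exact map_zero _
    rw [Finset.sum_congr rfl fun e _ => h1 e]
    ext w t
    rw [LinearMap.sum_apply, sum_apply, transfer_apply]
    split_ifs with ht
    · rw [σ.p_eq_sum x hx, Finset.sum_smul]
      refine Finset.sum_congr rfl fun e _ => ?_
      split_ifs with hs
      · rw [transfer_apply, hs, if_pos ht]
      · rw [zero_smul]; rfl
    · refine (Finset.sum_eq_zero fun e _ => ?_).symm
      split_ifs with hs
      · rw [transfer_apply, hs, if_neg ht]
      · rfl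

variable (σ M) in
/-- The representation of `L_K(E)` on `⨁ p x • M`. -/
noncomputable def rep : LeavittPathAlgebra K E →ₐ[K] Module.End K (σ.Sections M) :=
  LeavittPathAlgebra.lift (gen σ M) gen_rel

noncomputable instance instModule : Module (LeavittPathAlgebra K E) (σ.Sections M) :=
  Module.compHom (σ.Sections M) (rep σ M).toRingHom

theorem smul_def (a : LeavittPathAlgebra K E) (w : σ.Sections M) : a • w = rep σ M a w := rfl

theorem algebraMap_smul_apply (k : K) (w : σ.Sections M) (x : E.Vertex) :
    (algebraMap K (LeavittPathAlgebra K E) k • w) x = algebraMap K A k • w x := by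
  rw [smul_def, AlgHom.commutes]
  rfl

theorem gen_smul (g : LeavittGen E) (w : σ.Sections M) :
    (LeavittPathAlgebra.mk (FreeAlgebra.ι K g) : LeavittPathAlgebra K E) • w = gen σ M g w := by
  rw [smul_def, rep, LeavittPathAlgebra.lift_mk, FreeAlgebra.lift_ι_apply]

open Classical in
theorem vertex_smul_apply (x : E.Vertex) (w : σ.Sections M) (z : E.Vertex) :
    ((LeavittPathAlgebra.vertex x : LeavittPathAlgebra K E) • w) z = if z = x then w x else 0 := by
  rw [← w.p_smul x]
  exact congrArg (fun w : σ.Sections M => w z) (gen_smul (.vertex x) w)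

open Classical in
theorem edge_smul_apply (e : E.Edge) (w : σ.Sections M) (z : E.Vertex) :
    ((LeavittPathAlgebra.edge e : LeavittPathAlgebra K E) • w) z =
      if z = E.s e then σ.q e • w (E.r e) else 0 :=
  congrArg (fun w : σ.Sections M => w z) (gen_smul (.edge e) w)

open Classical in
theorem ghost_smul_apply (e : E.Edge) (w : σ.Sections M) (z : E.Vertex) :
    ((LeavittPathAlgebra.ghost e : LeavittPathAlgebra K E) • w) z =
      if z = E.r e then σ.q' e • w (E.s e) else 0 :=
  congrArg (fun w : σ.Sections M => w z) (gen_smul (.ghost e) w)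

variable {N : Type*} [AddCommGroup N] [Module A N]

/-- The map on families induced by a linear map. -/
noncomputable def map (σ : LeavittSystem K E A) (f : M →ₗ[A] N) :
    σ.Sections M →ₗ[LeavittPathAlgebra K E] σ.Sections N where
  toFun w := ⟨fun x => f (w x), fun x => by rw [← map_smul, w.p_smul]⟩
  map_add' w z := ext fun x => map_add f _ _
  map_smul' := by
    classical
    let g : σ.Sections M →+ σ.Sections N :=
      { toFun := fun w => ⟨fun x => f (w x), fun x => by rw [← map_smul, w.p_smul]⟩
        map_zero' := ext fun x => map_zero f
        map_add' := fun w z => ext fun x => map_add f _ _ }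
    have hg (w : σ.Sections M) (x : E.Vertex) : g w x = f (w x) := rfl
    refine LeavittPathAlgebra.map_smul_of_edges g (fun k w => ?_) (fun x w => ?_) (fun e w => ?_)
    · ext z
      rw [hg, algebraMap_smul_apply, algebraMap_smul_apply, map_smul, hg]
    · ext z
      rw [hg, vertex_smul_apply, vertex_smul_apply, apply_ite f, map_zero, hg]
    · ext z
      rw [hg, edge_smul_apply, edge_smul_apply, apply_ite f, map_zero, map_smul, hg]

@[simp] theorem map_apply (f : M →ₗ[A] N) (w : σ.Sections M) (x : E.Vertex) :
    map σ f w x = f (w x) := rfl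

end Sections

end Sections

open CategoryTheory

variable {K : Type w} [Field K] {E : FinGraph.{u, v}} {A : Type (max u v w)} [Ring A]
  [Algebra K A]

/-- The functor `M ↦ ⨁ p x • M`. -/
noncomputable def functor (σ : LeavittSystem K E A) :
    ModuleCat.{max u v w} A ⥤ ModuleCat.{max u v w} (LeavittPathAlgebra K E) where
  obj M := ModuleCat.of _ (σ.Sections M)
  map f := ModuleCat.ofHom (Sections.map σ f.hom)
  map_id _ := rfl
  map_comp _ _ := rfl

open scoped ModuleCat.Algebra in
theorem functor_linear (σ : LeavittSystem K E A) : σ.functor.Linear K where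
  map_smul {M N} f k := by
    refine ModuleCat.hom_ext (LinearMap.ext fun w => Sections.ext fun x => ?_)
    exact (Sections.algebraMap_smul_apply k (Sections.map σ f.hom w) x).symm

end LeavittSystem

/-! ### Walks -/

namespace FinGraph

variable {E : FinGraph.{u, v}}

theorem isWalk_append {l m : List E.Edge} {x z : E.Vertex} :
    E.IsWalk x (l ++ m) z ↔ ∃ y, E.IsWalk x l y ∧ E.IsWalk y m z := by
  induction l generalizing x with
  | nil => exact ⟨fun h => ⟨x, rfl, h⟩, fun ⟨y, h, h'⟩ => by subst h; exact h'⟩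
  | cons e l ih =>
    simp only [List.cons_append, IsWalk, ih]
    exact ⟨fun ⟨h, y, h1, h2⟩ => ⟨y, ⟨h, h1⟩, h2⟩, fun ⟨y, ⟨h, h1⟩, h2⟩ => ⟨h, y, h1, h2⟩⟩

theorem IsWalk.tgt_unique {l : List E.Edge} {x y z : E.Vertex} (h : E.IsWalk x l y)
    (h' : E.IsWalk x l z) : y = z := by
  induction l generalizing x with
  | nil => exact Eq.trans (Eq.symm h) h'
  | cons e l ih => exact ih h.2 h'.2

theorem IsWalk.r_getElem {l : List E.Edge} {x y : E.Vertex} (h : E.IsWalk x l y) {i : ℕ}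
    (hi : i + 1 < l.length) : E.r l[i] = E.s l[i + 1] := by
  induction l generalizing x i with
  | nil => simp at hi
  | cons e l ih =>
    cases i with
    | zero =>
      cases l with
      | nil => simp at hi
      | cons f l => exact h.2.1.symm
    | succ i => exact ih h.2 (by simpa using hi)

theorem IsWalk.s_getElem_zero {l : List E.Edge} {x y : E.Vertex} (h : E.IsWalk x l y)
    (hl : 0 < l.length) : E.s l[0] = x := by
  cases l with
  | nil => simp at hl
  | cons e l => exact h.1

theorem IsWalk.r_getElem_last {l : List E.Edge} {x y : E.Vertex} (h : E.IsWalk x l y) {i : ℕ}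
    (hi : i + 1 = l.length) : E.r (l[i]'(by omega)) = y := by
  induction l generalizing x i with
  | nil => simp at hi
  | cons e l ih =>
    cases i with
    | zero =>
      cases l with
      | nil => exact h.2
      | cons f l => simp at hi
    | succ i => exact ih h.2 (by simpa using hi)

/-! ### The edges of a source cycle -/

namespace Path.IsSourceCycle

variable {d : E.Path} (hd : d.IsSourceCycle)

theorem length_pos {d : E.Path} (hd : d.IsSourceCycle) : 0 < d.length :=
  List.length_pos_iff.2 hd.1.1

/-- The edges of the cycle, enumerated periodically. -/
def D (i : ℕ) : E.Edge := d.edges.get ⟨i % d.length, Nat.mod_lt _ hd.length_pos⟩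

theorem D_of_lt {i : ℕ} (hi : i < d.length) : hd.D i = d.edges.get ⟨i, hi⟩ := by
  simp only [D, Nat.mod_eq_of_lt hi]

theorem D_add_length (i : ℕ) : hd.D (i + d.length) = hd.D i := by
  simp only [D, Nat.add_mod_right]

theorem D_mod (i : ℕ) : hd.D (i % d.length) = hd.D i := by
  simp only [D, Nat.mod_mod]

theorem D_mem (i : ℕ) : hd.D i ∈ d.edges := List.get_mem _ _

theorem s_D_mem (i : ℕ) : E.s (hd.D i) ∈ d.vertices := ⟨_, hd.D_mem i, rfl⟩

theorem src_eq : d.src = E.s (hd.D 0) := by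
  rw [D_of_lt hd hd.length_pos]
  exact (d.isWalk.s_getElem_zero hd.length_pos).symm

theorem r_D (i : ℕ) : E.r (hd.D i) = E.s (hd.D (i + 1)) := by
  rw [← hd.D_mod i, ← hd.D_mod (i + 1)]
  have h := Nat.mod_lt i hd.length_pos
  rcases Nat.lt_or_ge (i % d.length + 1) d.length with h1 | h1
  · rw [Nat.add_mod_eq_ite, if_neg]
    all_goals have h2 : 1 < d.length := by omega
    all_goals rw [Nat.mod_eq_of_lt h2]
    · rw [D_of_lt hd h, D_of_lt hd h1]
      exact d.isWalk.r_getElem h1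
    · omega
  -- Wrap-around: the last edge ends at s(d) because d is closed.
  · have h2 : i % d.length + 1 = d.length := by omega
    have h3 : (i + 1) % d.length = 0 := by
      rw [← Nat.mod_add_mod, h2, Nat.mod_self]
    rw [h3, ← hd.src_eq, D_of_lt hd h, ← hd.1.2.1]
    exact d.isWalk.r_getElem_last h2

theorem r_D_mem (i : ℕ) : E.r (hd.D i) ∈ d.vertices := by
  rw [hd.r_D]; exact hd.s_D_mem _

theorem s_D_inj {i j : ℕ} (hi : i < d.length) (hj : j < d.length)
    (h : E.s (hd.D i) = E.s (hd.D j)) : i = j := by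
  rw [D_of_lt hd hi, D_of_lt hd hj] at h
  have hi' : i < (d.edges.map E.s).length := by rw [List.length_map]; exact hi
  have hj' : j < (d.edges.map E.s).length := by rw [List.length_map]; exact hj
  refine (hd.1.2.2.getElem_inj_iff (hi := hi') (hj := hj')).1 ?_
  rw [List.getElem_map, List.getElem_map]
  exact h

theorem exists_eq_D {e : E.Edge} (he : e ∈ d.edges) : ∃ i < d.length, hd.D i = e := by
  obtain ⟨i, hi, rfl⟩ := List.mem_iff_getElem.1 he
  exact ⟨i, hi, hd.D_of_lt hi⟩

theorem exists_s_D {x : E.Vertex} (hx : x ∈ d.vertices) : ∃ i < d.length, E.s (hd.D i) = x := by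
  obtain ⟨e, he, rfl⟩ := hx
  obtain ⟨i, hi, rfl⟩ := hd.exists_eq_D he
  exact ⟨i, hi, rfl⟩

/-- Without entrances, an edge that ends on the cycle belongs to it, and the edges of the cycle have
distinct sources. -/
theorem eq_D {e : E.Edge} {i : ℕ} (he : E.r e ∈ d.vertices) (hi : E.s e = E.s (hd.D i)) :
    e = hd.D i := by
  obtain ⟨j, hj, rfl⟩ := hd.exists_eq_D (hd.2 e he)
  rw [← hd.D_mod i] at hi ⊢
  rw [hd.s_D_inj hj (Nat.mod_lt _ hd.length_pos) hi]

open Classical in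
/-- The position of a vertex on the cycle. -/
noncomputable def idx (x : E.Vertex) : ℕ :=
  if h : ∃ i < d.length, E.s (hd.D i) = x then h.choose else 0

theorem idx_lt (x : E.Vertex) : hd.idx x < d.length := by
  unfold idx
  split_ifs with h
  · exact h.choose_spec.1
  · exact hd.length_pos

theorem s_D_idx {x : E.Vertex} (hx : x ∈ d.vertices) : E.s (hd.D (hd.idx x)) = x := by
  have h := hd.exists_s_D hx
  rw [idx, dif_pos h]
  exact h.choose_spec.2

theorem idx_s_D {i : ℕ} (hi : i < d.length) : hd.idx (E.s (hd.D i)) = i :=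
  hd.s_D_inj (hd.idx_lt _) hi (hd.s_D_idx (hd.s_D_mem i))

/-- The path of length `n` along the cycle which starts with the edge number `i`. -/
def seg (i n : ℕ) : List E.Edge := (List.range' i n).map hd.D

@[simp] theorem seg_zero (i : ℕ) : hd.seg i 0 = [] := rfl

theorem seg_succ (i n : ℕ) : hd.seg i (n + 1) = hd.D i :: hd.seg (i + 1) n := rfl

@[simp] theorem length_seg (i n : ℕ) : (hd.seg i n).length = n := by simp [seg]

theorem seg_add (i m n : ℕ) : hd.seg i (m + n) = hd.seg i m ++ hd.seg (i + m) n := by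
  rw [seg, seg, seg, ← List.map_append, ← List.range'_append, one_mul]

theorem seg_add_length (i n : ℕ) : hd.seg (i + d.length) n = hd.seg i n := by
  induction n generalizing i with
  | zero => rfl
  | succ n ih => rw [seg_succ, seg_succ, D_add_length, ← ih (i + 1), Nat.add_right_comm]

theorem seg_length : hd.seg 0 d.length = d.edges := by
  refine List.ext_getElem (by rw [length_seg]; rfl) fun i h1 h2 => ?_
  simp only [seg, List.getElem_map, List.getElem_range', zero_add, one_mul]
  exact hd.D_of_lt h2

theorem isWalk_seg (i n : ℕ) : E.IsWalk (E.s (hd.D i)) (hd.seg i n) (E.s (hd.D (i + n))) := by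
  induction n generalizing i with
  | zero => rfl
  | succ n ih =>
    refine ⟨rfl, ?_⟩
    rw [hd.r_D, ← Nat.add_assoc, Nat.add_right_comm]
    exact ih (i + 1)

/-- A walk from the cycle to the cycle runs along the cycle. -/
theorem eq_seg_of_isWalk {l : List E.Edge} {i : ℕ} {y : E.Vertex}
    (h : E.IsWalk (E.s (hd.D i)) l y) (hy : y ∈ d.vertices) :
    l = hd.seg i l.length ∧ y = E.s (hd.D (i + l.length)) := by
  induction l generalizing i with
  | nil => exact ⟨rfl, Eq.symm h⟩
  | cons e l ih =>
    have h1 : E.r e ∈ d.vertices := by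
      by_contra h1
      exact h.2.tgt_notMem hd h1 hy
    obtain rfl := hd.eq_D h1 h.1
    have h2 := h.2
    rw [hd.r_D] at h2
    obtain ⟨h3, h4⟩ := ih h2
    constructor
    · rw [List.length_cons, seg_succ, ← h3]
    · rw [h4, List.length_cons, Nat.add_right_comm, ← Nat.add_assoc]

/-- A walk which leaves the cycle. -/
theorem exists_exit {l : List E.Edge} {i : ℕ} {y : E.Vertex}
    (h : E.IsWalk (E.s (hd.D i)) l y) (hy : y ∉ d.vertices) :
    ∃ (n : ℕ) (f : E.Edge) (m : List E.Edge), l = hd.seg i n ++ f :: m ∧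
      E.s f = E.s (hd.D (i + n)) ∧ E.r f ∉ d.vertices ∧ E.IsWalk (E.r f) m y := by
  induction l generalizing i with
  | nil => exact absurd (h ▸ hd.s_D_mem i) hy
  | cons e l ih =>
    by_cases h1 : E.r e ∈ d.vertices
    · obtain rfl := hd.eq_D h1 h.1
      have h2 := h.2
      rw [hd.r_D] at h2
      obtain ⟨n, f, m, rfl, h4, h5⟩ := ih h2
      exact ⟨n + 1, f, m, rfl, by rw [h4, Nat.add_right_comm, ← Nat.add_assoc], h5⟩
    · exact ⟨0, e, l, rfl, h.1, h1, h.2⟩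

open Classical in
/-- The path along the cycle from its source to the vertex `x`; it is empty if `x` is not a vertex
of the cycle. -/
noncomputable def pre (x : E.Vertex) : List E.Edge :=
  if x ∈ d.vertices then hd.seg 0 (hd.idx x) else []

theorem pre_of_mem {x : E.Vertex} (hx : x ∈ d.vertices) : hd.pre x = hd.seg 0 (hd.idx x) :=
  if_pos hx

theorem pre_of_notMem {x : E.Vertex} (hx : x ∉ d.vertices) : hd.pre x = [] := if_neg hx

theorem pre_s_D {i : ℕ} (hi : i < d.length) : hd.pre (E.s (hd.D i)) = hd.seg 0 i := by
  rw [hd.pre_of_mem (hd.s_D_mem i), hd.idx_s_D hi]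

/-! ### Vertices and edges of the contracted graph -/

open Classical in
/-- The vertex of `F_{E,d}` which corresponds to a vertex of `E`. -/
noncomputable def π (d : E.Path) (x : E.Vertex) : (E.contract d).Vertex :=
  if h : x ∈ d.vertices then none else some ⟨x, h⟩

/-- A vertex of `E` which represents a given vertex of `F_{E,d}`. -/
def lift (d : E.Path) : (E.contract d).Vertex → E.Vertex
  | none => d.src
  | some x => x.1

theorem src_mem {d : E.Path} (hd : d.IsSourceCycle) : d.src ∈ d.vertices := by
  rw [hd.src_eq]
  exact hd.s_D_mem 0

theorem π_of_mem {x : E.Vertex} (hx : x ∈ d.vertices) : π d x = none := dif_pos hx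

theorem π_of_notMem {x : E.Vertex} (hx : x ∉ d.vertices) : π d x = some ⟨x, hx⟩ := dif_neg hx

theorem π_lift {d : E.Path} (hd : d.IsSourceCycle) (y : (E.contract d).Vertex) : π d (lift d y) = y := by
  rcases y with _ | x
  · exact dif_pos hd.src_mem
  · exact dif_neg x.2

theorem lift_injective {d : E.Path} (hd : d.IsSourceCycle) : Function.Injective (lift d) :=
  Function.LeftInverse.injective hd.π_lift

/-- The new vertex is represented by s(d), where all the paths `pre` begin, so no initial segment is
needed. -/
theorem pre_lift (y : (E.contract d).Vertex) : hd.pre (lift d y) = [] := by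
  rcases y with _ | x
  · change hd.pre d.src = []
    rw [hd.src_eq, hd.pre_s_D hd.length_pos, seg_zero]
  · exact hd.pre_of_notMem x.2

/-- The path of `E` which corresponds to an edge of `F_{E,d}`. -/
noncomputable def τ : (E.contract d).Edge → List E.Edge
  | none => d.edges
  | some f => hd.pre (E.s f.1) ++ [f.1]

theorem s_some (f : {e : E.Edge // E.r e ∉ d.vertices}) :
    (E.contract d).s (some f) = π d (E.s f.1) := rfl

theorem isWalk_pre (x : E.Vertex) : E.IsWalk (lift d (π d x)) (hd.pre x) x := by
  by_cases hx : x ∈ d.vertices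
  · rw [π_of_mem hx, hd.pre_of_mem hx]
    change E.IsWalk d.src _ _
    have := hd.isWalk_seg 0 (hd.idx x)
    rwa [zero_add, hd.s_D_idx hx, ← hd.src_eq] at this
  · rw [π_of_notMem hx, hd.pre_of_notMem hx]
    rfl

theorem isWalk_τ (e : (E.contract d).Edge) :
    E.IsWalk (lift d ((E.contract d).s e)) (hd.τ e) (lift d ((E.contract d).r e)) := by
  rcases e with _ | f
  · change E.IsWalk d.src d.edges d.src
    have := d.isWalk
    rwa [hd.1.2.1] at this
  · rw [s_some]
    exact isWalk_append.2 ⟨_, hd.isWalk_pre _, rfl, rfl⟩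

theorem τ_ne_nil (e : (E.contract d).Edge) : hd.τ e ≠ [] := by
  rcases e with _ | f
  · exact hd.1.1
  · simp [τ]

theorem s_mem_of_s_eq_none {f : {e : E.Edge // E.r e ∉ d.vertices}}
    (h : (E.contract d).s (some f) = none) : E.s f.1 ∈ d.vertices := by
  by_contra h1
  rw [s_some, π_of_notMem h1] at h
  exact Option.some_ne_none _ h

theorem ne_D {f : E.Edge} (hf : E.r f ∉ d.vertices) (i : ℕ) : f ≠ hd.D i := by
  rintro rfl
  exact hf (hd.r_D_mem i)

/-- After i common edges the first path leaves the cycle through f, while the second continues with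
an edge of the cycle. -/
theorem exists_split_seg {f : E.Edge} (hf : E.r f ∉ d.vertices) {i n : ℕ} (h : i < n)
    (l l' : List E.Edge) : ∃ (m : List E.Edge) (a b : E.Edge) (l₁ l₂ : List E.Edge), a ≠ b ∧
      hd.seg 0 i ++ f :: l = m ++ a :: l₁ ∧ hd.seg 0 n ++ l' = m ++ b :: l₂ := by
  obtain ⟨k, rfl⟩ : ∃ k, n = i + (k + 1) := ⟨n - i - 1, by omega⟩
  refine ⟨hd.seg 0 i, f, hd.D i, l, hd.seg (i + 1) k ++ l', hd.ne_D hf i, rfl, ?_⟩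
  rw [seg_add, seg_succ, zero_add, List.append_assoc, List.cons_append]

/-- The paths for different edges with the same source are not initial parts of each other. -/
theorem exists_split_τ {e f : (E.contract d).Edge} (hef : e ≠ f)
    (hs : (E.contract d).s e = (E.contract d).s f) (l l' : List E.Edge) :
    ∃ (m : List E.Edge) (a b : E.Edge) (l₁ l₂ : List E.Edge), a ≠ b ∧
      hd.τ e ++ l = m ++ a :: l₁ ∧ hd.τ f ++ l' = m ++ b :: l₂ := by
  -- An exit against the loop: the exit occurs at some position below r, hence before the full turn
  -- d is completed.
  have key (f : {e : E.Edge // E.r e ∉ d.vertices}) (h : (E.contract d).s (some f) = none)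
      (l l' : List E.Edge) : ∃ (m : List E.Edge) (a b : E.Edge) (l₁ l₂ : List E.Edge), a ≠ b ∧
      hd.τ (some f) ++ l = m ++ a :: l₁ ∧ hd.τ none ++ l' = m ++ b :: l₂ := by
    have h1 := s_mem_of_s_eq_none h
    simp only [τ, hd.pre_of_mem h1, List.append_assoc, List.singleton_append, ← hd.seg_length]
    exact hd.exists_split_seg f.2 (hd.idx_lt _) l l'
  rcases e with _ | e <;> rcases f with _ | f
  · exact absurd rfl hef
  · obtain ⟨m, a, b, l₁, l₂, h1, h2, h3⟩ := key f hs.symm l' l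
    exact ⟨m, b, a, l₂, l₁, h1.symm, h3, h2⟩
  · exact key e hs l l'
  · have hef' : e.1 ≠ f.1 := fun h => hef (congrArg some (Subtype.ext h))
    by_cases h1 : (E.contract d).s (some e) = none
    · have h2 := s_mem_of_s_eq_none h1
      have h3 := s_mem_of_s_eq_none (hs ▸ h1)
      simp only [τ, hd.pre_of_mem h2, hd.pre_of_mem h3, List.append_assoc, List.singleton_append]
      -- Two exits: the paths part at the earlier of the two, or at the exits themselves if these
      -- start at the same vertex.
      rcases Nat.lt_trichotomy (hd.idx (E.s e.1)) (hd.idx (E.s f.1)) with h4 | h4 | h4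
      · exact hd.exists_split_seg e.2 h4 l _
      · exact ⟨hd.seg 0 (hd.idx (E.s e.1)), e.1, f.1, l, l', hef', rfl, by rw [h4]⟩
      · obtain ⟨m, a, b, l₁, l₂, h5, h6, h7⟩ := hd.exists_split_seg f.2 h4 l' (e.1 :: l)
        exact ⟨m, b, a, l₂, l₁, h5.symm, h7, h6⟩
    · have h2 : E.s e.1 ∉ d.vertices := fun h => h1 ((s_some e).trans (π_of_mem h))
      have h3 : E.s f.1 ∉ d.vertices :=
        fun h => h1 (hs.trans ((s_some f).trans (π_of_mem h)))
      simp only [τ, hd.pre_of_notMem h2, hd.pre_of_notMem h3, List.nil_append,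
        List.singleton_append]
      exact ⟨[], e.1, f.1, l, l', hef', rfl, rfl⟩

end Path.IsSourceCycle

end FinGraph

/-! ### Paths and ghost paths in the Leavitt path algebra -/

namespace LeavittPathAlgebra

variable {K : Type w} [Field K] {E : FinGraph.{u, v}}

variable (K) in
/-- The product `e₁ ⋯ eₙ`. -/
noncomputable def mon (l : List E.Edge) : LeavittPathAlgebra K E := (l.map edge).prod

variable (K) in
/-- The product `eₙ* ⋯ e₁*`. -/
noncomputable def gmon (l : List E.Edge) : LeavittPathAlgebra K E := (l.reverse.map ghost).prod

@[simp] theorem mon_nil : mon K ([] : List E.Edge) = 1 := rfl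

@[simp] theorem gmon_nil : gmon K ([] : List E.Edge) = 1 := rfl

theorem mon_append (l m : List E.Edge) : mon K (l ++ m) = mon K l * mon K m := by
  simp [mon]

theorem gmon_append (l m : List E.Edge) : gmon K (l ++ m) = gmon K m * gmon K l := by
  simp [gmon]

@[simp] theorem mon_singleton (e : E.Edge) : mon K [e] = edge e := by simp [mon]

@[simp] theorem gmon_singleton (e : E.Edge) : gmon K [e] = ghost e := by simp [gmon]

theorem mon_cons (e : E.Edge) (l : List E.Edge) : mon K (e :: l) = edge e * mon K l := by
  simp [mon]

theorem gmon_cons (e : E.Edge) (l : List E.Edge) : gmon K (e :: l) = gmon K l * ghost e := by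
  simp [gmon]

theorem vertex_mul_mon {l : List E.Edge} {x y : E.Vertex} (h : E.IsWalk x l y) :
    vertex x * mon K l = mon K l * vertex y := by
  induction l generalizing x with
  | nil => rw [mon_nil, mul_one, one_mul, show x = y from h]
  | cons e l ih =>
    rw [mon_cons, mul_assoc, ← ih h.2, ← mul_assoc, ← mul_assoc, ← h.1, source_mul_edge,
      edge_mul_range]

theorem gmon_mul_vertex {l : List E.Edge} {x y : E.Vertex} (h : E.IsWalk x l y) :
    gmon K l * vertex x = vertex y * gmon K l := by
  induction l generalizing x with
  | nil => rw [gmon_nil, mul_one, one_mul, show x = y from h]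
  | cons e l ih =>
    rw [gmon_cons, ← mul_assoc, ← ih h.2, mul_assoc, mul_assoc, ← h.1, ghost_mul_source,
      range_mul_ghost]

theorem vertex_mul_mon_of_ne_nil {l : List E.Edge} {x y : E.Vertex} (h : E.IsWalk x l y)
    (hl : l ≠ []) : vertex x * mon K l = mon K l := by
  cases l with
  | nil => exact absurd rfl hl
  | cons e l => rw [mon_cons, ← mul_assoc, ← h.1, source_mul_edge]

theorem mon_mul_vertex_of_ne_nil {l : List E.Edge} {x y : E.Vertex} (h : E.IsWalk x l y)
    (hl : l ≠ []) : mon K l * vertex y = mon K l := by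
  rw [← vertex_mul_mon h, vertex_mul_mon_of_ne_nil h hl]

theorem gmon_mul_vertex_of_ne_nil {l : List E.Edge} {x y : E.Vertex} (h : E.IsWalk x l y)
    (hl : l ≠ []) : gmon K l * vertex x = gmon K l := by
  cases l with
  | nil => exact absurd rfl hl
  | cons e l => rw [gmon_cons, mul_assoc, ← h.1, ghost_mul_source]

theorem vertex_mul_gmon_of_ne_nil {l : List E.Edge} {x y : E.Vertex} (h : E.IsWalk x l y)
    (hl : l ≠ []) : vertex y * gmon K l = gmon K l := by
  rw [← gmon_mul_vertex h, gmon_mul_vertex_of_ne_nil h hl]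

/-- The product over the empty list is 1 and not a vertex; the extra factor y makes the identity
valid for empty paths as well. -/
theorem gmon_mul_mon_mul_vertex {l : List E.Edge} {x y : E.Vertex} (h : E.IsWalk x l y) :
    gmon K l * mon K l * vertex y = vertex y := by
  induction l generalizing x with
  | nil => rw [gmon_nil, mon_nil, one_mul, one_mul]
  | cons e l ih =>
    rw [gmon_cons, mon_cons, mul_assoc (gmon K l), ← mul_assoc (ghost e), ghost_mul_edge_self,
      vertex_mul_mon h.2, ← mul_assoc, mul_assoc _ _ (vertex y), vertex_mul_self, ih h.2]

theorem gmon_mul_mon {l : List E.Edge} {x y : E.Vertex} (h : E.IsWalk x l y) (hl : l ≠ []) :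
    gmon K l * mon K l = vertex y := by
  rw [← mon_mul_vertex_of_ne_nil h hl, ← mul_assoc, gmon_mul_mon_mul_vertex h]

/-- The common initial part m cancels, which leaves a*b = 0 in the middle of the product. -/
theorem gmon_mul_mon_of_ne {m : List E.Edge} {x y : E.Vertex} {a b : E.Edge} (hab : a ≠ b)
    (l l' : List E.Edge) (h : E.IsWalk x (m ++ b :: l') y) :
    gmon K (m ++ a :: l) * mon K (m ++ b :: l') = 0 := by
  obtain ⟨z, h1, h2⟩ := FinGraph.isWalk_append.1 h
  have h3 : gmon K m * (mon K m * edge b) = edge b := by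
    rw [← source_mul_edge b, h2.1, ← mul_assoc, ← mul_assoc, gmon_mul_mon_mul_vertex h1]
  rw [gmon_append, mon_append, gmon_cons, mon_cons, mul_assoc, mul_assoc, ← mul_assoc (mon K m),
    ← mul_assoc (gmon K m), ← mul_assoc (gmon K m), mul_assoc (gmon K m) (mon K m), h3,
    ← mul_assoc (ghost a), ghost_mul_edge_of_ne hab, zero_mul, mul_zero]

end LeavittPathAlgebra

open LeavittPathAlgebra

/-! ### The system of F in L_K(E): iterating the Cuntz–Krieger relation along the cycle -/

namespace FinGraph.Path.IsSourceCycle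

section

open scoped Classical

variable {E : FinGraph.{u, v}} {d : E.Path} (hd : d.IsSourceCycle)

/-- The edges of F are the loop and the edges of E with range outside d⁰. This turns sums over F
into sums over E, where the values of h on the edges of the cycle are irrelevant. -/
theorem sum_contract_edge {M : Type*} [AddCommMonoid M] (g : (E.contract d).Edge → M)
    (h : E.Edge → M) (hgh : ∀ f : {e : E.Edge // E.r e ∉ d.vertices}, g (some f) = h f.1) :
    ∑ e, g e = g none + ∑ e, if E.r e ∈ d.vertices then 0 else h e := by
  let g' : Option {e : E.Edge // E.r e ∉ d.vertices} → M := g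
  have h1 : ∑ e, g e = ∑ e, g' e :=
    Fintype.sum_equiv (show (E.contract d).Edge ≃ Option {e : E.Edge // E.r e ∉ d.vertices} from
      Equiv.refl _) _ _ fun _ => rfl
  rw [h1, Fintype.sum_option]
  change g none + ∑ f, g (some f) = _
  congr 1
  have h2 : ∑ e, (if E.r e ∈ d.vertices then 0 else h e) =
      ∑ e, if E.r e ∉ d.vertices then h e else 0 :=
    Finset.sum_congr rfl fun e _ => (ite_not _ _ _).symm
  rw [h2, ← Finset.sum_filter, Finset.sum_congr rfl fun f _ => hgh f]
  exact (Finset.sum_subtype _ (by simp) _).symm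

variable (K : Type w) [Field K]

/-- The Cuntz–Krieger relation at v_i, split into the single edge that stays on the cycle and the
exits. -/
theorem vertex_s_D (i : ℕ) : (vertex (E.s (hd.D i)) : LeavittPathAlgebra K E) =
    edge (hd.D i) * ghost (hd.D i) + ∑ e, if E.r e ∈ d.vertices then 0 else
      if E.s e = E.s (hd.D i) then edge e * ghost e else 0 := by
  have h1 (e : E.Edge) : (if E.s e = E.s (hd.D i) then edge e * ghost e else 0 :
      LeavittPathAlgebra K E) = (if e = hd.D i then edge e * ghost e else 0) +
        if E.r e ∈ d.vertices then 0 else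
          if E.s e = E.s (hd.D i) then edge e * ghost e else 0 := by
    by_cases h2 : E.r e ∈ d.vertices
    · rw [if_pos h2, add_zero]
      by_cases h3 : E.s e = E.s (hd.D i)
      · rw [if_pos h3, if_pos (hd.eq_D h2 h3)]
      · rw [if_neg h3, if_neg (fun h => h3 (congrArg E.s h))]
    · rw [if_neg h2, if_neg (hd.ne_D h2 i), zero_add]
  rw [vertex_eq_sum (fun h => h _ rfl), Finset.sum_congr rfl fun e _ => h1 e,
    Finset.sum_add_distrib, Finset.sum_ite_eq' Finset.univ, if_pos (Finset.mem_univ _)]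

/-- Induction on n: expand the vertex in the middle of the first term by `vertex_s_D`. The edge of
the cycle lengthens the path and the exits join the sum. -/
theorem vertex_src_eq_sum {n : ℕ} : (vertex d.src : LeavittPathAlgebra K E) =
    mon K (hd.seg 0 n) * vertex (E.s (hd.D n)) * gmon K (hd.seg 0 n) +
      ∑ j ∈ Finset.range n, ∑ e, if E.r e ∈ d.vertices then 0 else
        if E.s e = E.s (hd.D j) then
          mon K (hd.seg 0 j ++ [e]) * gmon K (hd.seg 0 j ++ [e]) else 0 := by
  induction n with
  | zero => simp [hd.src_eq]
  | succ n ih =>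
    rw [ih, Finset.sum_range_succ, add_comm (Finset.sum _ _) (Finset.sum _ _), ← add_assoc]
    congr 1
    rw [hd.vertex_s_D K n, mul_add, add_mul]
    congr 1
    · rw [seg_add, zero_add, mon_append, gmon_append, ← hd.r_D n]
      change _ = mon K (hd.seg 0 n) * mon K [hd.D n] * _ * (gmon K [hd.D n] * _)
      simp only [mon_singleton, gmon_singleton, mul_assoc]
      rw [← mul_assoc (vertex _) (ghost _), range_mul_ghost]
    · rw [Finset.mul_sum, Finset.sum_mul]
      refine Finset.sum_congr rfl fun e _ => ?_
      simp only [mon_append, gmon_append, mon_singleton, gmon_singleton]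
      split_ifs <;> simp [mul_assoc]

/-- An edge starts at no more than one vertex of the cycle. After exchanging summations this
converts a double sum over positions and exits into one sum over edges. -/
theorem sum_ite_s_D {M : Type*} [AddCommMonoid M] (e : E.Edge) (g : ℕ → M) :
    ∑ j ∈ Finset.range d.length, (if E.s e = E.s (hd.D j) then g j else 0) =
      if E.s e ∈ d.vertices then g (hd.idx (E.s e)) else 0 := by
  split_ifs with h
  · rw [Finset.sum_eq_single (hd.idx (E.s e)), if_pos (hd.s_D_idx h).symm]
    · intro j hj hne
      refine if_neg fun h1 => hne ?_
      rw [h1, hd.idx_s_D (Finset.mem_range.1 hj)]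
    · exact fun h1 => absurd (Finset.mem_range.2 (hd.idx_lt _)) h1
  · exact Finset.sum_eq_zero fun j _ => if_neg fun h1 => h (by rw [h1]; exact hd.s_D_mem j)

/-- The elements of `L_K(E)` which correspond to the generators of `L_K(F_{E,d})`. -/
noncomputable def contractSystem : LeavittSystem K (E.contract d) (LeavittPathAlgebra K E) where
  p y := vertex (lift d y)
  q e := mon K (hd.τ e)
  q' e := gmon K (hd.τ e)
  p_mul_p _ := vertex_mul_self _
  p_mul_q e := vertex_mul_mon_of_ne_nil (hd.isWalk_τ e) (hd.τ_ne_nil e)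
  q_mul_p e := mon_mul_vertex_of_ne_nil (hd.isWalk_τ e) (hd.τ_ne_nil e)
  p_mul_q' e := vertex_mul_gmon_of_ne_nil (hd.isWalk_τ e) (hd.τ_ne_nil e)
  q'_mul_p e := gmon_mul_vertex_of_ne_nil (hd.isWalk_τ e) (hd.τ_ne_nil e)
  q'_mul_q_self e := gmon_mul_mon (hd.isWalk_τ e) (hd.τ_ne_nil e)
  q'_mul_q_of_ne e f hef hs := by
    obtain ⟨m, a, b, l₁, l₂, hab, h1, h2⟩ := hd.exists_split_τ hef hs [] []
    rw [List.append_nil] at h1 h2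
    have h3 := hd.isWalk_τ f
    rw [h2] at h3
    rw [h1, h2]
    exact gmon_mul_mon_of_ne hab _ _ h3
  p_eq_sum y hy := by
    rcases y with _ | x
    · rw [sum_contract_edge (d := d) _ (fun e => if E.s e ∈ d.vertices then
        mon K (hd.pre (E.s e) ++ [e]) * gmon K (hd.pre (E.s e) ++ [e]) else 0)]
      · change vertex d.src = _
        -- At v̄ go around the cycle exactly once: the remaining term is d d*, which belongs to the
        -- loop, and the exits give the edges φ(f).
        rw [hd.vertex_src_eq_sum K (n := d.length), Finset.sum_comm]
        congr 1
        · have h2 : (E.contract d).s none = none := rfl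
          have h0 : E.IsWalk d.src d.edges d.src := by
            have := d.isWalk
            rwa [hd.1.2.1] at this
          have h1 : hd.D d.length = hd.D 0 := by rw [← hd.D_mod, Nat.mod_self]
          rw [if_pos h2, h1, ← hd.src_eq, hd.seg_length, mon_mul_vertex_of_ne_nil h0 hd.1.1]
          rfl
        · refine Finset.sum_congr rfl fun e _ => ?_
          split_ifs with h1 h2
          · exact Finset.sum_const_zero
          · rw [hd.sum_ite_s_D e fun j => mon K (hd.seg 0 j ++ [e]) * gmon K (hd.seg 0 j ++ [e]),
              if_pos h2, hd.pre_of_mem h2]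
          · rw [hd.sum_ite_s_D e fun j => mon K (hd.seg 0 j ++ [e]) * gmon K (hd.seg 0 j ++ [e]),
              if_neg h2]
      · intro f
        by_cases h : E.s f.1 ∈ d.vertices
        · rw [if_pos h, if_pos ((s_some f).trans (π_of_mem h))]
          rfl
        · rw [if_neg h, if_neg (fun h1 => h (s_mem_of_s_eq_none h1))]
    · have hx : ¬ E.IsSink x.1 := by
        intro h
        refine hy fun e he => ?_
        rcases e with _ | f
        · exact Option.some_ne_none _ he.symm
        · refine h f.1 ?_
          by_cases h1 : E.s f.1 ∈ d.vertices
          · rw [s_some, π_of_mem h1] at he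
            exact absurd he.symm (Option.some_ne_none _)
          · rw [s_some, π_of_notMem h1] at he
            exact congrArg Subtype.val (Option.some.inj he)
      -- An edge that starts outside d⁰ also ends outside d⁰, so x emits the same edges in E and in
      -- F.
      rw [sum_contract_edge (d := d) _ (fun e => if E.s e = x.1 then edge e * ghost e else 0)]
      · have h1 : (E.contract d).s none ≠ some x := (Option.some_ne_none x).symm
        rw [if_neg h1, zero_add]
        refine (vertex_eq_sum hx).trans (Finset.sum_congr rfl fun e _ => ?_)
        split_ifs with h2 h3
        · exact absurd h3 (hd.range_notMem (h2 ▸ x.2))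
        · rfl
        · rfl
        · rfl
      · intro f
        by_cases h1 : E.s f.1 = x.1
        · have h2 : E.s f.1 ∉ d.vertices := h1 ▸ x.2
          have h3 : (E.contract d).s (some f) = some x := by
            rw [s_some, π_of_notMem h2]
            exact congrArg some (Subtype.ext h1)
          rw [if_pos h1, if_pos h3]
          simp only [τ, hd.pre_of_notMem h2, List.nil_append, mon_singleton, gmon_singleton]
        · rw [if_neg h1, if_neg]
          intro h2
          by_cases h3 : E.s f.1 ∈ d.vertices
          · rw [s_some, π_of_mem h3] at h2
            exact absurd h2.symm (Option.some_ne_none _)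
          · rw [s_some, π_of_notMem h3] at h2
            exact h1 (congrArg Subtype.val (Option.some.inj h2))

/-! ### The elements of `L_K(F_{E,d})` for the generators of `L_K(E)` -/

/-- The edge of `F_{E,d}` which corresponds to an edge of `E` outside the cycle. -/
noncomputable def ex (d : E.Path) (e : E.Edge) : LeavittPathAlgebra K (E.contract d) :=
  if h : E.r e ∈ d.vertices then 0 else edge (E := E.contract d) (some ⟨e, h⟩)

/-- The ghost edge of `F_{E,d}` which corresponds to an edge of `E` outside the cycle. -/
noncomputable def gh (d : E.Path) (e : E.Edge) : LeavittPathAlgebra K (E.contract d) :=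
  if h : E.r e ∈ d.vertices then 0 else ghost (E := E.contract d) (some ⟨e, h⟩)

/-- The loop of `F_{E,d}`. -/
noncomputable def loop (d : E.Path) : LeavittPathAlgebra K (E.contract d) :=
  edge (E := E.contract d) none

/-- The ghost edge for the loop of `F_{E,d}`. -/
noncomputable def loop' (d : E.Path) : LeavittPathAlgebra K (E.contract d) :=
  ghost (E := E.contract d) none

/-- The new vertex of `F_{E,d}`. -/
noncomputable def base (d : E.Path) : LeavittPathAlgebra K (E.contract d) :=
  vertex (E := E.contract d) none

variable {K}

/-! ### Multiplication rules in L_K(F) -/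

theorem ex_of_mem {e : E.Edge} (h : E.r e ∈ d.vertices) : ex K d e = 0 := dif_pos h
theorem gh_of_mem {e : E.Edge} (h : E.r e ∈ d.vertices) : gh K d e = 0 := dif_pos h
theorem ex_of_notMem {e : E.Edge} (h : E.r e ∉ d.vertices) :
    ex K d e = edge (E := E.contract d) (some ⟨e, h⟩) := dif_neg h
theorem gh_of_notMem {e : E.Edge} (h : E.r e ∉ d.vertices) :
    gh K d e = ghost (E := E.contract d) (some ⟨e, h⟩) := dif_neg h

theorem gh_mul_ex_of_ne {e f : E.Edge} (h : e ≠ f) : gh K d e * ex K d f = 0 := by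
  by_cases he : E.r e ∈ d.vertices
  · rw [gh_of_mem he, zero_mul]
  by_cases hf : E.r f ∈ d.vertices
  · rw [ex_of_mem hf, mul_zero]
  rw [gh_of_notMem he, ex_of_notMem hf]
  exact ghost_mul_edge_of_ne fun h1 => h (congrArg Subtype.val (Option.some.inj h1))

theorem gh_mul_ex_self {e : E.Edge} (h : E.r e ∉ d.vertices) :
    gh K d e * ex K d e = vertex (π d (E.r e)) := by
  rw [gh_of_notMem h, ex_of_notMem h, π_of_notMem h]
  exact ghost_mul_edge_self (E := E.contract d) (some ⟨e, h⟩)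

theorem vertex_mul_ex (e : E.Edge) :
    (vertex (π d (E.s e)) : LeavittPathAlgebra K _) * ex K d e = ex K d e := by
  by_cases h : E.r e ∈ d.vertices
  · rw [ex_of_mem h, mul_zero]
  · rw [ex_of_notMem h]
    exact source_mul_edge (E := E.contract d) (some ⟨e, h⟩)

theorem gh_mul_vertex (e : E.Edge) :
    gh K d e * (vertex (π d (E.s e)) : LeavittPathAlgebra K _) = gh K d e := by
  by_cases h : E.r e ∈ d.vertices
  · rw [gh_of_mem h, zero_mul]
  · rw [gh_of_notMem h]
    exact ghost_mul_source (E := E.contract d) (some ⟨e, h⟩)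

theorem ex_mul_vertex (e : E.Edge) :
    ex K d e * (vertex (π d (E.r e)) : LeavittPathAlgebra K _) = ex K d e := by
  by_cases h : E.r e ∈ d.vertices
  · rw [ex_of_mem h, zero_mul]
  · rw [ex_of_notMem h, π_of_notMem h]
    exact edge_mul_range (E := E.contract d) (some ⟨e, h⟩)

theorem vertex_mul_gh (e : E.Edge) :
    (vertex (π d (E.r e)) : LeavittPathAlgebra K _) * gh K d e = gh K d e := by
  by_cases h : E.r e ∈ d.vertices
  · rw [gh_of_mem h, mul_zero]
  · rw [gh_of_notMem h, π_of_notMem h]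
    exact range_mul_ghost (E := E.contract d) (some ⟨e, h⟩)

theorem loop'_mul_ex (e : E.Edge) : loop' K d * ex K d e = 0 := by
  by_cases h : E.r e ∈ d.vertices
  · rw [ex_of_mem h, mul_zero]
  · rw [ex_of_notMem h]
    exact ghost_mul_edge_of_ne (Option.some_ne_none _).symm

theorem gh_mul_loop (e : E.Edge) : gh K d e * loop K d = 0 := by
  by_cases h : E.r e ∈ d.vertices
  · rw [gh_of_mem h, zero_mul]
  · rw [gh_of_notMem h]
    exact ghost_mul_edge_of_ne (Option.some_ne_none _)

/-! ### The decreasing chain of idempotents below v̄ -/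

variable (K)

/-- The sum of the elements `φ(f) φ(f)*` over all exits `f` at the vertex number `j`. -/
noncomputable def X (j : ℕ) : LeavittPathAlgebra K (E.contract d) :=
  ∑ e, if E.s e = E.s (hd.D j) then ex K d e * gh K d e else 0

/-- The idempotent for the vertex number `i` of the cycle. -/
noncomputable def pp (i : ℕ) : LeavittPathAlgebra K (E.contract d) :=
  base K d - ∑ j ∈ Finset.range i, hd.X K j

/-- The Cuntz–Krieger relation at v̄ with the exits grouped by their vertices in E. Edges of the
cycle may remain in the sums, since `ex` and `gh` vanish on them. -/
theorem base_eq_sum : base K d =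
    loop K d * loop' K d + ∑ j ∈ Finset.range d.length, hd.X K j := by
  have h1 : ¬ (E.contract d).IsSink none := fun h => h none rfl
  rw [base, vertex_eq_sum h1, sum_contract_edge (d := d) _
    (fun e => if E.s e ∈ d.vertices then ex K d e * gh K d e else 0)]
  · have h2 : (E.contract d).s none = none := rfl
    rw [if_pos h2]
    congr 1
    simp only [X]
    rw [Finset.sum_comm]
    refine Finset.sum_congr rfl fun e _ => ?_
    rw [hd.sum_ite_s_D e fun _ => ex K d e * gh K d e]
    split_ifs with h3 h4
    · rw [ex_of_mem h3, zero_mul]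
    · rfl
    · rfl
    · rfl
  · intro f
    by_cases h : E.s f.1 ∈ d.vertices
    · rw [if_pos h, if_pos ((s_some f).trans (π_of_mem h)), ex_of_notMem f.2, gh_of_notMem f.2]
    · rw [if_neg h, if_neg (fun h1 => h (s_mem_of_s_eq_none h1))]

theorem pp_zero : hd.pp K 0 = base K d := by simp [pp]

theorem pp_succ (i : ℕ) : hd.pp K (i + 1) = hd.pp K i - hd.X K i := by
  rw [pp, pp, Finset.sum_range_succ, sub_sub]

theorem pp_length : hd.pp K d.length = loop K d * loop' K d := by
  rw [pp, hd.base_eq_sum, add_sub_cancel_right]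

variable {K}

theorem base_mul_base : base K d * base K d = base K d := vertex_mul_self _

theorem base_mul_loop : base K d * loop K d = loop K d :=
  source_mul_edge (E := E.contract d) none

theorem loop_mul_base : loop K d * base K d = loop K d :=
  edge_mul_range (E := E.contract d) none

theorem base_mul_loop' : base K d * loop' K d = loop' K d :=
  range_mul_ghost (E := E.contract d) none

theorem loop'_mul_base : loop' K d * base K d = loop' K d :=
  ghost_mul_source (E := E.contract d) none

theorem loop'_mul_loop : loop' K d * loop K d = base K d :=
  ghost_mul_edge_self (E := E.contract d) none

theorem base_mul_ex {e : E.Edge} (he : E.s e ∈ d.vertices) : base K d * ex K d e = ex K d e := by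
  have := vertex_mul_ex (K := K) (d := d) e
  rwa [π_of_mem he] at this

theorem gh_mul_base {e : E.Edge} (he : E.s e ∈ d.vertices) : gh K d e * base K d = gh K d e := by
  have := gh_mul_vertex (K := K) (d := d) e
  rwa [π_of_mem he] at this

/-- The products φ(f)φ(f)* are orthogonal idempotents with φ(f)φ(f)*φ(f) = φ(f), so their sum over
the exits at v_i fixes these exits and kills those at other vertices. -/
theorem X_mul_ex {e : E.Edge} {i j : ℕ} (hi : i < d.length) (hj : j < d.length)
    (he : E.s e = E.s (hd.D j)) : hd.X K i * ex K d e = if i = j then ex K d e else 0 := by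
  rw [X, Finset.sum_mul, Finset.sum_eq_single e]
  · by_cases h : i = j
    · rw [if_pos h, h, if_pos he, mul_assoc]
      by_cases h1 : E.r e ∈ d.vertices
      · rw [ex_of_mem h1, zero_mul]
      · rw [gh_mul_ex_self h1, ex_mul_vertex]
    · rw [if_neg h, if_neg, zero_mul]
      intro h1
      exact h (hd.s_D_inj hi hj (h1.symm.trans he))
  · intro f _ hf
    split_ifs
    · rw [mul_assoc, gh_mul_ex_of_ne hf, mul_zero]
    · rw [zero_mul]
  · exact fun h => absurd (Finset.mem_univ _) h

theorem gh_mul_X {e : E.Edge} {i j : ℕ} (hi : i < d.length) (hj : j < d.length)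
    (he : E.s e = E.s (hd.D j)) : gh K d e * hd.X K i = if i = j then gh K d e else 0 := by
  rw [X, Finset.mul_sum, Finset.sum_eq_single e]
  · by_cases h : i = j
    · rw [if_pos h, h, if_pos he, ← mul_assoc]
      by_cases h1 : E.r e ∈ d.vertices
      · rw [gh_of_mem h1, mul_zero]
      · rw [gh_mul_ex_self h1, vertex_mul_gh]
    · rw [if_neg h, if_neg, mul_zero]
      intro h1
      exact h (hd.s_D_inj hi hj (h1.symm.trans he))
  · intro f _ hf
    split_ifs
    · rw [← mul_assoc, gh_mul_ex_of_ne hf.symm, zero_mul]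
    · rw [mul_zero]
  · exact fun h => absurd (Finset.mem_univ _) h

/-- Passing from p_i to p_{i+1} removes exactly the exits at v_i, so an exit at v_j survives as long
as i ≤ j. -/
theorem pp_mul_ex {e : E.Edge} {i j : ℕ} (hi : i ≤ d.length) (hj : j < d.length)
    (he : E.s e = E.s (hd.D j)) : hd.pp K i * ex K d e = if i ≤ j then ex K d e else 0 := by
  induction i with
  | zero => rw [pp_zero, base_mul_ex (he ▸ hd.s_D_mem j), if_pos (Nat.zero_le _)]
  | succ i ih =>
    rw [pp_succ, sub_mul, ih (by omega), hd.X_mul_ex (by omega) hj he]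
    rcases Nat.lt_trichotomy i j with h | h | h
    · rw [if_pos h.le, if_neg h.ne, if_pos (by omega), sub_zero]
    · rw [if_pos h.le, if_pos h, if_neg (by omega), sub_self]
    · rw [if_neg (by omega), if_neg (by omega), if_neg (by omega), sub_zero]

theorem gh_mul_pp {e : E.Edge} {i j : ℕ} (hi : i ≤ d.length) (hj : j < d.length)
    (he : E.s e = E.s (hd.D j)) : gh K d e * hd.pp K i = if i ≤ j then gh K d e else 0 := by
  induction i with
  | zero => rw [pp_zero, gh_mul_base (he ▸ hd.s_D_mem j), if_pos (Nat.zero_le _)]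
  | succ i ih =>
    rw [pp_succ, mul_sub, ih (by omega), hd.gh_mul_X (by omega) hj he]
    rcases Nat.lt_trichotomy i j with h | h | h
    · rw [if_pos h.le, if_neg h.ne, if_pos (by omega), sub_zero]
    · rw [if_pos h.le, if_pos h, if_neg (by omega), sub_self]
    · rw [if_neg (by omega), if_neg (by omega), if_neg (by omega), sub_zero]

theorem pp_mul_X {i j : ℕ} (hi : i ≤ d.length) (hj : j < d.length) :
    hd.pp K i * hd.X K j = if i ≤ j then hd.X K j else 0 := by
  have h0 (e : E.Edge) : hd.pp K i * (if E.s e = E.s (hd.D j) then ex K d e * gh K d e else 0) =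
      if i ≤ j then (if E.s e = E.s (hd.D j) then ex K d e * gh K d e else 0) else 0 := by
    by_cases h : E.s e = E.s (hd.D j)
    · rw [if_pos h, ← mul_assoc, hd.pp_mul_ex hi hj h, ite_mul, zero_mul]
    · rw [if_neg h, mul_zero, ite_self]
  rw [X, Finset.mul_sum, Finset.sum_congr rfl fun e _ => h0 e]
  split_ifs
  · rfl
  · exact Finset.sum_const_zero

theorem X_mul_pp {i j : ℕ} (hi : i ≤ d.length) (hj : j < d.length) :
    hd.X K j * hd.pp K i = if i ≤ j then hd.X K j else 0 := by
  have h0 (e : E.Edge) : (if E.s e = E.s (hd.D j) then ex K d e * gh K d e else 0) * hd.pp K i =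
      if i ≤ j then (if E.s e = E.s (hd.D j) then ex K d e * gh K d e else 0) else 0 := by
    by_cases h : E.s e = E.s (hd.D j)
    · rw [if_pos h, mul_assoc, hd.gh_mul_pp hi hj h, mul_ite, mul_zero]
    · rw [if_neg h, zero_mul, ite_self]
  rw [X, Finset.sum_mul, Finset.sum_congr rfl fun e _ => h0 e]
  split_ifs
  · rfl
  · exact Finset.sum_const_zero

/-- For i ≤ j the summand X_j lies below p_i, so the removal of X_j keeps the idempotents nested. -/
theorem pp_mul_pp {i j : ℕ} (hij : i ≤ j) (hj : j ≤ d.length) :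
    hd.pp K i * hd.pp K j = hd.pp K j ∧ hd.pp K j * hd.pp K i = hd.pp K j := by
  induction j, hij using Nat.le_induction with
  -- Idempotency is needed first: it follows by induction on i, since p_{i+1} X_i = 0 = X_i p_{i+1}
  -- and p_i X_i = X_i.
  | base =>
    rw [and_self]
    induction i with
    | zero => rw [pp_zero, base_mul_base]
    | succ i ih =>
      rw [pp_succ, sub_mul, mul_sub, ih (by omega), hd.pp_mul_X (by omega) (by omega),
        if_pos le_rfl, ← pp_succ, hd.X_mul_pp hj (by omega), if_neg (by omega), sub_zero]
  | succ j hij ih =>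
    obtain ⟨h1, h2⟩ := ih (by omega)
    rw [pp_succ, mul_sub, sub_mul, h1, h2, hd.pp_mul_X (by omega) (by omega),
      hd.X_mul_pp (by omega) (by omega), if_pos hij]
    exact ⟨rfl, rfl⟩

theorem pp_mul_self {i : ℕ} (hi : i ≤ d.length) : hd.pp K i * hd.pp K i = hd.pp K i :=
  (hd.pp_mul_pp le_rfl hi).1

/-- Only exits are ever subtracted from v̄, and φ(f)*d' = 0 for each of them. -/
theorem pp_mul_loop {i : ℕ} : hd.pp K i * loop K d = loop K d := by
  rw [pp, sub_mul, base_mul_loop, Finset.sum_mul, Finset.sum_eq_zero, sub_zero]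
  intro j _
  rw [X, Finset.sum_mul, Finset.sum_eq_zero]
  intro e _
  split_ifs
  · rw [mul_assoc, gh_mul_loop, mul_zero]
  · rw [zero_mul]

theorem loop'_mul_pp {i : ℕ} : loop' K d * hd.pp K i = loop' K d := by
  rw [pp, mul_sub, loop'_mul_base, Finset.mul_sum, Finset.sum_eq_zero, sub_zero]
  intro j _
  rw [X, Finset.mul_sum, Finset.sum_eq_zero]
  intro e _
  split_ifs
  · rw [← mul_assoc, loop'_mul_ex, zero_mul]
  · rw [mul_zero]

/-! ### The system of E in L_K(F) -/

variable (K)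

/-- The idempotent of `L_K(F_{E,d})` for a vertex of `E`. -/
noncomputable def sysP (x : E.Vertex) : LeavittPathAlgebra K (E.contract d) :=
  if x ∈ d.vertices then hd.pp K (hd.idx x) else vertex (π d x)

/-- The element of `L_K(F_{E,d})` for an edge of `E`. -/
noncomputable def sysQ (e : E.Edge) : LeavittPathAlgebra K (E.contract d) :=
  if E.r e ∈ d.vertices then
    if hd.idx (E.s e) + 1 < d.length then hd.pp K (hd.idx (E.s e) + 1) else loop K d
  else ex K d e

/-- The element of `L_K(F_{E,d})` for a ghost edge of `E`. -/
noncomputable def sysQ' (e : E.Edge) : LeavittPathAlgebra K (E.contract d) :=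
  if E.r e ∈ d.vertices then
    if hd.idx (E.s e) + 1 < d.length then hd.pp K (hd.idx (E.s e) + 1) else loop' K d
  else gh K d e

variable {K}

/-- The three kinds of edges treated differently in the system: those ending outside d⁰, the edges
of d other than the last, and the last edge, which becomes the loop. -/
theorem edge_cases (e : E.Edge) : E.r e ∉ d.vertices ∨ (∃ i, i + 1 < d.length ∧ e = hd.D i) ∨
    ∃ i, i + 1 = d.length ∧ e = hd.D i := by
  by_cases h : E.r e ∈ d.vertices
  · obtain ⟨i, hi, rfl⟩ := hd.exists_eq_D (hd.2 e h)
    rcases Nat.lt_or_ge (i + 1) d.length with h1 | h1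
    · exact Or.inr (Or.inl ⟨i, h1, rfl⟩)
    · exact Or.inr (Or.inr ⟨i, by omega, rfl⟩)
  · exact Or.inl h

theorem sysP_s_D {i : ℕ} (hi : i < d.length) : hd.sysP K (E.s (hd.D i)) = hd.pp K i := by
  rw [sysP, if_pos (hd.s_D_mem i), hd.idx_s_D hi]

theorem sysP_of_notMem {x : E.Vertex} (hx : x ∉ d.vertices) : hd.sysP K x = vertex (π d x) :=
  if_neg hx

theorem sysP_r_D {i : ℕ} (hi : i + 1 < d.length) :
    hd.sysP K (E.r (hd.D i)) = hd.pp K (i + 1) := by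
  rw [hd.r_D, hd.sysP_s_D hi]

theorem sysP_r_D_last {i : ℕ} (hi : i + 1 = d.length) :
    hd.sysP K (E.r (hd.D i)) = base K d := by
  rw [hd.r_D, hi, ← hd.D_mod d.length, Nat.mod_self, hd.sysP_s_D hd.length_pos, pp_zero]

theorem sysQ_of_notMem {e : E.Edge} (h : E.r e ∉ d.vertices) : hd.sysQ K e = ex K d e := if_neg h

theorem sysQ'_of_notMem {e : E.Edge} (h : E.r e ∉ d.vertices) : hd.sysQ' K e = gh K d e := if_neg h

theorem sysQ_D {i : ℕ} (hi : i + 1 < d.length) : hd.sysQ K (hd.D i) = hd.pp K (i + 1) := by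
  rw [sysQ, if_pos (hd.r_D_mem i), hd.idx_s_D (by omega), if_pos hi]

theorem sysQ'_D {i : ℕ} (hi : i + 1 < d.length) : hd.sysQ' K (hd.D i) = hd.pp K (i + 1) := by
  rw [sysQ', if_pos (hd.r_D_mem i), hd.idx_s_D (by omega), if_pos hi]

theorem sysQ_D_last {i : ℕ} (hi : i + 1 = d.length) : hd.sysQ K (hd.D i) = loop K d := by
  rw [sysQ, if_pos (hd.r_D_mem i), hd.idx_s_D (by omega), if_neg (by omega)]

theorem sysQ'_D_last {i : ℕ} (hi : i + 1 = d.length) : hd.sysQ' K (hd.D i) = loop' K d := by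
  rw [sysQ', if_pos (hd.r_D_mem i), hd.idx_s_D (by omega), if_neg (by omega)]

/-- An inner edge of the cycle becomes an idempotent; the last one becomes d', and p_r = d'd'* is
the common formula for i + 1 = r. -/
theorem sysQ_mul_sysQ'_D {i : ℕ} (hi : i < d.length) :
    hd.sysQ K (hd.D i) * hd.sysQ' K (hd.D i) = hd.pp K (i + 1) := by
  rcases Nat.lt_or_ge (i + 1) d.length with h | h
  · rw [hd.sysQ_D h, hd.sysQ'_D h, hd.pp_mul_self h.le]
  · have h1 : i + 1 = d.length := by omega
    rw [hd.sysQ_D_last h1, hd.sysQ'_D_last h1, h1, pp_length]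

theorem sysP_s_mul_ex (e : E.Edge) : hd.sysP K (E.s e) * ex K d e = ex K d e := by
  by_cases h : E.s e ∈ d.vertices
  · obtain ⟨i, hi, h1⟩ := hd.exists_s_D h
    rw [← h1, hd.sysP_s_D hi, hd.pp_mul_ex hi.le hi h1.symm, if_pos le_rfl]
  · rw [hd.sysP_of_notMem h, vertex_mul_ex]

theorem gh_mul_sysP_s (e : E.Edge) : gh K d e * hd.sysP K (E.s e) = gh K d e := by
  by_cases h : E.s e ∈ d.vertices
  · obtain ⟨i, hi, h1⟩ := hd.exists_s_D h
    rw [← h1, hd.sysP_s_D hi, hd.gh_mul_pp hi.le hi h1.symm, if_pos le_rfl]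
  · rw [hd.sysP_of_notMem h, gh_mul_vertex]

variable (K)

/-- The elements of `L_K(F_{E,d})` which correspond to the generators of `L_K(E)`. -/
noncomputable def expandSystem : LeavittSystem K E (LeavittPathAlgebra K (E.contract d)) where
  p := hd.sysP K
  q := hd.sysQ K
  q' := hd.sysQ' K
  p_mul_p x := by
    rw [sysP]
    split_ifs
    · exact hd.pp_mul_self (hd.idx_lt x).le
    · exact vertex_mul_self _
  p_mul_q e := by
    rcases hd.edge_cases e with h | ⟨i, hi, rfl⟩ | ⟨i, hi, rfl⟩
    · rw [hd.sysQ_of_notMem h, hd.sysP_s_mul_ex]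
    · rw [hd.sysQ_D hi, hd.sysP_s_D (by omega), (hd.pp_mul_pp (Nat.le_succ i) hi.le).1]
    · rw [hd.sysQ_D_last hi, hd.sysP_s_D (by omega), pp_mul_loop]
  q_mul_p e := by
    rcases hd.edge_cases e with h | ⟨i, hi, rfl⟩ | ⟨i, hi, rfl⟩
    · rw [hd.sysQ_of_notMem h, hd.sysP_of_notMem h, ex_mul_vertex]
    · rw [hd.sysQ_D hi, hd.sysP_r_D hi, hd.pp_mul_self hi.le]
    · rw [hd.sysQ_D_last hi, hd.sysP_r_D_last hi, loop_mul_base]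
  p_mul_q' e := by
    rcases hd.edge_cases e with h | ⟨i, hi, rfl⟩ | ⟨i, hi, rfl⟩
    · rw [hd.sysQ'_of_notMem h, hd.sysP_of_notMem h, vertex_mul_gh]
    · rw [hd.sysQ'_D hi, hd.sysP_r_D hi, hd.pp_mul_self hi.le]
    · rw [hd.sysQ'_D_last hi, hd.sysP_r_D_last hi, base_mul_loop']
  q'_mul_p e := by
    rcases hd.edge_cases e with h | ⟨i, hi, rfl⟩ | ⟨i, hi, rfl⟩
    · rw [hd.sysQ'_of_notMem h, hd.gh_mul_sysP_s]
    · rw [hd.sysQ'_D hi, hd.sysP_s_D (by omega), (hd.pp_mul_pp (Nat.le_succ i) hi.le).2]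
    · rw [hd.sysQ'_D_last hi, hd.sysP_s_D (by omega), loop'_mul_pp]
  q'_mul_q_self e := by
    rcases hd.edge_cases e with h | ⟨i, hi, rfl⟩ | ⟨i, hi, rfl⟩
    · rw [hd.sysQ'_of_notMem h, hd.sysQ_of_notMem h, hd.sysP_of_notMem h, gh_mul_ex_self h]
    · rw [hd.sysQ'_D hi, hd.sysQ_D hi, hd.sysP_r_D hi, hd.pp_mul_self hi.le]
    · rw [hd.sysQ'_D_last hi, hd.sysQ_D_last hi, hd.sysP_r_D_last hi, loop'_mul_loop]
  q'_mul_q_of_ne e f hef hs := by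
    -- Two different edges of the cycle cannot share a source. A cycle edge at v_i other than the
    -- last is represented by p_{i+1}, from which the exits at v_i are already removed; the last one
    -- is represented by the loop, which is orthogonal to all exits.
    by_cases he : E.r e ∈ d.vertices <;> by_cases hf : E.r f ∈ d.vertices
    · obtain ⟨i, hi, rfl⟩ := hd.exists_eq_D (hd.2 f hf)
      exact absurd (hd.eq_D he hs) hef
    · rw [hd.sysQ_of_notMem hf]
      rcases hd.edge_cases e with h | ⟨i, hi, rfl⟩ | ⟨i, hi, rfl⟩
      · exact absurd he h
      · rw [hd.sysQ'_D hi, hd.pp_mul_ex hi.le (by omega) hs.symm, if_neg (by omega)]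
      · rw [hd.sysQ'_D_last hi, loop'_mul_ex]
    · rw [hd.sysQ'_of_notMem he]
      rcases hd.edge_cases f with h | ⟨i, hi, rfl⟩ | ⟨i, hi, rfl⟩
      · exact absurd hf h
      · rw [hd.sysQ_D hi, hd.gh_mul_pp hi.le (by omega) hs, if_neg (by omega)]
      · rw [hd.sysQ_D_last hi, gh_mul_loop]
    · rw [hd.sysQ'_of_notMem he, hd.sysQ_of_notMem hf, gh_mul_ex_of_ne hef]
  p_eq_sum x hx := by
    by_cases h : x ∈ d.vertices
    · obtain ⟨i, hi, rfl⟩ := hd.exists_s_D h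
      -- The edge of the cycle contributes p_{i+1} and the exits contribute X_i, which add up to
      -- p_i.
      have h1 (e : E.Edge) : (if E.s e = E.s (hd.D i) then hd.sysQ K e * hd.sysQ' K e else 0) =
          (if e = hd.D i then hd.sysQ K e * hd.sysQ' K e else 0) +
            if E.s e = E.s (hd.D i) then ex K d e * gh K d e else 0 := by
        by_cases h2 : E.r e ∈ d.vertices
        · rw [ex_of_mem h2, zero_mul, ite_self, add_zero]
          by_cases h3 : E.s e = E.s (hd.D i)
          · rw [if_pos h3, if_pos (hd.eq_D h2 h3)]
          · rw [if_neg h3, if_neg (fun h => h3 (congrArg E.s h))]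
        · rw [if_neg (hd.ne_D h2 i), zero_add, hd.sysQ_of_notMem h2, hd.sysQ'_of_notMem h2]
      rw [Finset.sum_congr rfl fun e _ => h1 e, Finset.sum_add_distrib,
        Finset.sum_ite_eq' Finset.univ, if_pos (Finset.mem_univ _), hd.sysQ_mul_sysQ'_D hi,
        hd.sysP_s_D hi, pp_succ]
      exact (sub_add_cancel _ _).symm
    · have h1 : ¬ (E.contract d).IsSink (some ⟨x, h⟩) := by
        intro h1
        refine hx fun e he => ?_
        refine h1 (some ⟨e, hd.range_notMem (he ▸ h)⟩) ?_
        rw [s_some]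
        simp only [he]
        exact π_of_notMem h
      rw [hd.sysP_of_notMem h, π_of_notMem h, vertex_eq_sum h1, sum_contract_edge (d := d) _
        (fun e => if E.s e = x then ex K d e * gh K d e else 0)]
      · have h2 : (E.contract d).s none ≠ some ⟨x, h⟩ := (Option.some_ne_none _).symm
        rw [if_neg h2, zero_add]
        refine Finset.sum_congr rfl fun e _ => ?_
        split_ifs with h3 h4 h4
        · exact absurd h3 (hd.range_notMem (h4 ▸ h))
        · rfl
        · rw [hd.sysQ_of_notMem h3, hd.sysQ'_of_notMem h3]
        · rfl
      · intro f
        by_cases h2 : E.s f.1 = x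
        · rw [if_pos h2, if_pos, ex_of_notMem f.2, gh_of_notMem f.2]
          rw [s_some, h2, π_of_notMem h]
        · rw [if_neg h2, if_neg]
          intro h3
          by_cases h4 : E.s f.1 ∈ d.vertices
          · rw [s_some, π_of_mem h4] at h3
            exact absurd h3.symm (Option.some_ne_none _)
          · rw [s_some, π_of_notMem h4] at h3
            exact h2 (congrArg Subtype.val (Option.some.inj h3))

end

end FinGraph.Path.IsSourceCycle

namespace FinGraph.Path.IsSourceCycle

section

open scoped Classical

variable {K : Type w} [Field K] {E : FinGraph.{u, v}} {d : E.Path} (hd : d.IsSourceCycle)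

/-! ### The counit -/

section Counit

variable {N : Type*} [AddCommGroup N] [Module (LeavittPathAlgebra K (E.contract d)) N]

/-- At the chosen representatives the idempotents are the vertices of F themselves; the composite of
the two constructions is therefore ⨁ y N over the vertices y of F. -/
theorem expandSystem_p_lift (y : (E.contract d).Vertex) :
    (hd.expandSystem K).p (lift d y) = vertex y := by
  change hd.sysP K _ = _
  rcases y with _ | x
  · change hd.sysP K d.src = _
    rw [hd.src_eq, hd.sysP_s_D hd.length_pos, pp_zero]
    rfl
  · exact (hd.sysP_of_notMem x.2).trans (congrArg vertex (hd.π_lift (some x)))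

/-- An inner edge of the cycle acts through the idempotent of its range, which fixes the component
there. Thus the path d_1⋯d_i moves a component to v_0 without changing it as an element of N. -/
theorem mon_seg_smul_apply (w : (hd.expandSystem K).Sections N) {i : ℕ} (hi : i < d.length) :
    (mon K (hd.seg 0 i) • w) (E.s (hd.D 0)) = w (E.s (hd.D i)) := by
  induction i generalizing w with
  | zero => rw [seg_zero, mon_nil, one_smul]
  | succ i ih =>
    rw [seg_add, zero_add, mon_append, mul_smul, ih _ (by omega)]
    change (mon K [hd.D i] • w) _ = _
    rw [mon_singleton, LeavittSystem.Sections.edge_smul_apply, if_pos rfl]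
    change hd.sysQ K _ • _ = _
    rw [hd.sysQ_D hi, ← hd.sysP_s_D hi, hd.r_D]
    exact w.p_smul _

theorem mon_pre_smul_apply (w : (hd.expandSystem K).Sections N) (x : E.Vertex) :
    (mon K (hd.pre x) • w) (lift d (π d x)) = w x := by
  by_cases h : x ∈ d.vertices
  · obtain ⟨i, hi, rfl⟩ := hd.exists_s_D h
    rw [hd.pre_s_D hi, π_of_mem h]
    change (mon K (hd.seg 0 i) • w) d.src = _
    rw [hd.src_eq, hd.mon_seg_smul_apply w hi]
  · rw [hd.pre_of_notMem h, mon_nil, one_smul, π_of_notMem h]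
    rfl

/-- Gives d the shape of the other paths, an initial segment of the cycle followed by one edge. -/
theorem τ_none_eq {i : ℕ} (hi : i + 1 = d.length) :
    hd.τ none = hd.pre (E.s (hd.D i)) ++ [hd.D i] := by
  rw [hd.pre_s_D (by omega)]
  change d.edges = _
  rw [← hd.seg_length, ← hi, seg_add, zero_add]
  rfl

/-- The initial segment of the path acts as the identity on elements of N, so only its last edge
counts, and this edge is represented by e. -/
theorem mon_τ_smul_apply (w : (hd.expandSystem K).Sections N) (e : (E.contract d).Edge) :
    (mon K (hd.τ e) • w) (lift d ((E.contract d).s e)) =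
      (edge e : LeavittPathAlgebra K _) • w (lift d ((E.contract d).r e)) := by
  rcases e with _ | f
  · obtain ⟨i, hi⟩ : ∃ i, i + 1 = d.length := ⟨d.length - 1, by have := hd.length_pos; omega⟩
    have h1 : (E.contract d).s none = π d (E.s (hd.D i)) := (π_of_mem (hd.s_D_mem i)).symm
    have h2 : E.r (hd.D i) = d.src := by
      rw [hd.r_D, hi, ← hd.D_mod d.length, Nat.mod_self, hd.src_eq]
    rw [hd.τ_none_eq hi, mon_append, mul_smul, h1, hd.mon_pre_smul_apply, mon_singleton,
      LeavittSystem.Sections.edge_smul_apply, if_pos rfl, h2]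
    change hd.sysQ K _ • _ = _
    rw [hd.sysQ_D_last hi]
    rfl
  · change (mon K (hd.pre (E.s f.1) ++ [f.1]) • w) _ = _
    rw [mon_append, mul_smul, s_some, hd.mon_pre_smul_apply, mon_singleton,
      LeavittSystem.Sections.edge_smul_apply, if_pos rfl]
    change hd.sysQ K _ • _ = _
    rw [hd.sysQ_of_notMem f.2, ex_of_notMem f.2]
    rfl

variable (N) in
/-- The underlying additive map of the counit. -/
noncomputable def counitHom :
    (hd.contractSystem K).Sections ((hd.expandSystem K).Sections N) →+ N where
  toFun z := ∑ y, z y (lift d y)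
  map_zero' := Finset.sum_eq_zero fun _ _ => rfl
  map_add' _ _ := Finset.sum_add_distrib

theorem counitHom_apply (z : (hd.contractSystem K).Sections ((hd.expandSystem K).Sections N)) :
    hd.counitHom N z = ∑ y, z y (lift d y) := rfl

theorem vertex_smul_counitHom
    (z : (hd.contractSystem K).Sections ((hd.expandSystem K).Sections N))
    (y : (E.contract d).Vertex) :
    (vertex y : LeavittPathAlgebra K _) • hd.counitHom N z = z y (lift d y) := by
  have h (t : (E.contract d).Vertex) :
      (vertex t : LeavittPathAlgebra K _) • z t (lift d t) = z t (lift d t) := by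
    rw [← hd.expandSystem_p_lift]
    exact (z t).p_smul _
  rw [counitHom_apply, Finset.smul_sum, Finset.sum_eq_single y]
  · exact h y
  · intro t _ ht
    rw [← h t, ← mul_smul, vertex_mul_of_ne ht.symm, zero_smul]
  · exact fun h => absurd (Finset.mem_univ _) h

theorem counitHom_smul (a : LeavittPathAlgebra K (E.contract d))
    (z : (hd.contractSystem K).Sections ((hd.expandSystem K).Sections N)) :
    hd.counitHom N (a • z) = a • hd.counitHom N z := by
  refine map_smul_of_edges _ (fun k z => ?_) (fun y z => ?_) (fun e z => ?_) a z
  · rw [counitHom_apply, counitHom_apply, Finset.smul_sum]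
    refine Finset.sum_congr rfl fun y _ => ?_
    rw [LeavittSystem.Sections.algebraMap_smul_apply,
      LeavittSystem.Sections.algebraMap_smul_apply]
  · rw [vertex_smul_counitHom, counitHom_apply, Finset.sum_eq_single y]
    · rw [LeavittSystem.Sections.vertex_smul_apply, if_pos rfl]
    · intro t _ ht
      rw [LeavittSystem.Sections.vertex_smul_apply, if_neg ht]
      rfl
    · exact fun h => absurd (Finset.mem_univ _) h
  -- Inserting r(e) reduces the sum on the right to a single component.
  · rw [← edge_mul_range, mul_smul, mul_smul, vertex_smul_counitHom, counitHom_apply,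
      Finset.sum_eq_single ((E.contract d).s e)]
    · rw [LeavittSystem.Sections.edge_smul_apply, if_pos rfl]
      change (mon K (hd.τ e) • _ : (hd.expandSystem K).Sections N) _ = _
      rw [hd.mon_τ_smul_apply, LeavittSystem.Sections.vertex_smul_apply, if_pos rfl]
    · intro t _ ht
      rw [LeavittSystem.Sections.edge_smul_apply, if_neg ht]
      rfl
    · exact fun h => absurd (Finset.mem_univ _) h

/-- The family z(y) is fixed by the vertex `lift d y` of E, hence supported there. -/
theorem apply_apply_eq (z : (hd.contractSystem K).Sections ((hd.expandSystem K).Sections N))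
    (y : (E.contract d).Vertex) (x : E.Vertex) :
    z y x = if x = lift d y then z y (lift d y) else 0 := by
  have h := z.p_smul y
  change (vertex (lift d y) : LeavittPathAlgebra K E) • z y = z y at h
  rw [← LeavittSystem.Sections.vertex_smul_apply, h]

/-- The element z consists of one entry in y N for each vertex y of F, and N is the direct sum of
these subgroups because the vertices are orthogonal idempotents with sum 1. -/
theorem counitHom_bijective : Function.Bijective (hd.counitHom (K := K) N) := by
  constructor
  · rw [injective_iff_map_eq_zero]
    intro z hz
    ext y x
    rw [hd.apply_apply_eq, ← hd.vertex_smul_counitHom, hz, smul_zero, ite_self]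
    rfl
  · intro n
    let z (y : (E.contract d).Vertex) : (hd.expandSystem K).Sections N :=
      ⟨fun x => if x = lift d y then (vertex y : LeavittPathAlgebra K _) • n else 0, fun x => by
        dsimp only
        split_ifs with h
        · rw [h, hd.expandSystem_p_lift, ← mul_smul, vertex_mul_self]
        · exact smul_zero _⟩
    have hz (y : (E.contract d).Vertex) (x : E.Vertex) :
      z y x = if x = lift d y then (vertex y : LeavittPathAlgebra K _) • n else 0 := rfl
    refine ⟨⟨z, fun y => ?_⟩, ?_⟩
    · change (vertex (lift d y) : LeavittPathAlgebra K E) • z y = z y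
      ext x
      rw [LeavittSystem.Sections.vertex_smul_apply, hz, hz, if_pos rfl]
    · change ∑ y, z y (lift d y) = n
      simp only [hz, if_true]
      rw [← Finset.sum_smul, sum_vertex, one_smul]

variable (K N) in
/-- The counit of the equivalence, on a single module. -/
noncomputable def counitEquiv :
    (hd.contractSystem K).Sections ((hd.expandSystem K).Sections N)
      ≃ₗ[LeavittPathAlgebra K (E.contract d)] N :=
  LinearEquiv.ofBijective
    { toFun := hd.counitHom N
      map_add' := map_add _
      map_smul' := hd.counitHom_smul } hd.counitHom_bijective

end Counit

/-! ### The unit -/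

section Unit

variable {M : Type*} [AddCommGroup M] [Module (LeavittPathAlgebra K E) M]

theorem ex_smul_apply (e : E.Edge) (he : E.r e ∉ d.vertices)
    (z : (hd.contractSystem K).Sections M) (y : (E.contract d).Vertex) :
    (ex K d e • z) y =
      if y = π d (E.s e) then mon K (hd.pre (E.s e) ++ [e]) • z (π d (E.r e)) else 0 := by
  rw [ex_of_notMem he]
  refine (LeavittSystem.Sections.edge_smul_apply (E := E.contract d) (some ⟨e, he⟩) z y).trans ?_
  rw [π_of_notMem he]
  rfl

theorem gh_smul_apply (e : E.Edge) (he : E.r e ∉ d.vertices)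
    (z : (hd.contractSystem K).Sections M) (y : (E.contract d).Vertex) :
    (gh K d e • z) y =
      if y = π d (E.r e) then gmon K (hd.pre (E.s e) ++ [e]) • z (π d (E.s e)) else 0 := by
  rw [gh_of_notMem he]
  refine (LeavittSystem.Sections.ghost_smul_apply (E := E.contract d) (some ⟨e, he⟩) z y).trans ?_
  rw [π_of_notMem he]
  rfl

/-- On families the edge φ(f) acts as the path d_1⋯d_j f, so X_j becomes the exit term of
`vertex_src_eq_sum` for the vertex v_j. -/
theorem X_smul_apply (z : (hd.contractSystem K).Sections M) {j : ℕ} (hj : j < d.length) :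
    (hd.X K j • z) none = (∑ e, if E.r e ∈ d.vertices then 0 else
        if E.s e = E.s (hd.D j) then
          mon K (hd.seg 0 j ++ [e]) * gmon K (hd.seg 0 j ++ [e]) else 0 :
            LeavittPathAlgebra K E) • z none := by
  rw [X, Finset.sum_smul, Finset.sum_smul]
  refine (LeavittSystem.Sections.sum_apply (E := E.contract d) Finset.univ _ (none : (E.contract d).Vertex)).trans ?_
  refine Finset.sum_congr rfl fun e _ => ?_
  split_ifs with h1 h2 h2
  · rw [ex_of_mem h2, zero_mul, zero_smul, zero_smul]
    rfl
  · have h3 : π d (E.s e) = none := by rw [h1, π_of_mem (hd.s_D_mem j)]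
    rw [mul_smul]
    refine (hd.ex_smul_apply e h2 _ _).trans ?_
    rw [if_pos h3.symm, hd.gh_smul_apply e h2, if_pos rfl, h1, hd.pre_s_D hj,
      π_of_mem (hd.s_D_mem j), mul_smul]
  · rw [zero_smul, zero_smul]
    rfl
  · rw [zero_smul, zero_smul]
    rfl

theorem vertex_lift_smul_apply (z : (hd.contractSystem K).Sections M)
    (y : (E.contract d).Vertex) :
    (vertex (lift d y) : LeavittPathAlgebra K E) • z y = z y := z.p_smul y

/-- Both sides arise from v_0 by subtracting the exit terms at v_0, …, v_{i-1}: on the left by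
definition, on the right by `vertex_src_eq_sum`. -/
theorem pp_smul_apply (z : (hd.contractSystem K).Sections M) {i : ℕ} (hi : i ≤ d.length) :
    (hd.pp K i • z) none =
      (mon K (hd.seg 0 i) * vertex (E.s (hd.D i)) * gmon K (hd.seg 0 i)) • z none := by
  have h1 := hd.vertex_src_eq_sum K (n := i)
  rw [eq_comm, ← eq_sub_iff_add_eq] at h1
  have h2 : (base K d • z) none = z none :=
    (LeavittSystem.Sections.vertex_smul_apply (E := E.contract d) none z none).trans (if_pos rfl)
  rw [h1, pp, sub_smul, sub_smul]
  have h3 : (base K d • z - (∑ j ∈ Finset.range i, hd.X K j) • z) none =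
    (base K d • z) none - ((∑ j ∈ Finset.range i, hd.X K j) • z) none := rfl
  rw [h3, h2]
  congr 1
  · exact (hd.vertex_lift_smul_apply z none).symm
  · rw [Finset.sum_smul, Finset.sum_smul]
    refine (LeavittSystem.Sections.sum_apply (E := E.contract d) _ _ (none : (E.contract d).Vertex)).trans ?_
    refine Finset.sum_congr rfl fun j hj => hd.X_smul_apply z ?_
    have := Finset.mem_range.1 hj
    omega

/-- The idempotent attached to x acts as the projection γ x γ* for the path γ from the
representative of x to x. This makes left multiplication by γ an isomorphism from x M onto the
component at x of the composite. -/
theorem sysP_smul_apply (z : (hd.contractSystem K).Sections M) (x : E.Vertex)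
    (y : (E.contract d).Vertex) : (hd.sysP K x • z) y = if y = π d x then
      (mon K (hd.pre x) * vertex x * gmon K (hd.pre x)) • z (π d x) else 0 := by
  by_cases h : x ∈ d.vertices
  · obtain ⟨i, hi, rfl⟩ := hd.exists_s_D h
    rw [hd.sysP_s_D hi, hd.pre_s_D hi, π_of_mem h]
    split_ifs with hy
    · rw [hy, hd.pp_smul_apply z hi.le]
    · rw [← (hd.pp_mul_pp (Nat.zero_le i) hi.le).1, pp_zero, mul_smul]
      exact (LeavittSystem.Sections.vertex_smul_apply (E := E.contract d) none _ y).trans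
        (if_neg hy)
  · rw [hd.sysP_of_notMem h, hd.pre_of_notMem h, LeavittSystem.Sections.vertex_smul_apply,
      mon_nil, gmon_nil, one_mul, mul_one]
    split_ifs
    · have := hd.vertex_lift_smul_apply z (π d x)
      rw [π_of_notMem h] at this ⊢
      exact this.symm
    · rfl

/-- The component of the unit at a vertex. -/
noncomputable def unitComponent (m : M) (x : E.Vertex) : (hd.contractSystem K).Sections M :=
  ⟨fun y => if y = π d x then (mon K (hd.pre x) * vertex x) • m else 0, fun y => by
    dsimp only
    split_ifs with h
    · change (vertex (lift d y) : LeavittPathAlgebra K E) • _ = _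
      rw [h, ← vertex_mul_mon (hd.isWalk_pre x), ← mul_smul, ← mul_assoc, vertex_mul_self]
    · exact smul_zero _⟩

theorem unitComponent_apply (m : M) (x : E.Vertex) (y : (E.contract d).Vertex) :
    hd.unitComponent (K := K) m x y =
      if y = π d x then (mon K (hd.pre x) * vertex x) • m else 0 := rfl

theorem gmon_mul_mon_pre (x : E.Vertex) :
    gmon K (hd.pre x) * (mon K (hd.pre x) * vertex x) = vertex x := by
  rw [← mul_assoc, gmon_mul_mon_mul_vertex (hd.isWalk_pre x)]

variable (K) in
/-- The underlying additive map of the unit. -/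
noncomputable def unitHom : M →+ (hd.expandSystem K).Sections ((hd.contractSystem K).Sections M) where
  toFun m := ⟨hd.unitComponent m, fun x => by
    change hd.sysP K x • _ = _
    ext y
    rw [sysP_smul_apply, unitComponent_apply, unitComponent_apply, if_pos rfl, ← mul_smul,
      mul_assoc _ (gmon K _), gmon_mul_mon_pre, mul_assoc, vertex_mul_self]⟩
  map_zero' := by
    ext x y
    change hd.unitComponent 0 x y = 0
    rw [unitComponent_apply, smul_zero, ite_self]
  map_add' m n := by
    ext x y
    change hd.unitComponent (m + n) x y = hd.unitComponent m x y + hd.unitComponent n x y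
    simp only [unitComponent_apply, smul_add]
    split_ifs
    · rfl
    · rw [add_zero]

theorem unitHom_apply (m : M) (x : E.Vertex) : hd.unitHom K m x = hd.unitComponent m x := rfl

theorem unitHom_smul (a : LeavittPathAlgebra K E) (m : M) :
    hd.unitHom K (a • m) = a • hd.unitHom K m := by
  refine map_smul_of_edges (hd.unitHom K) (fun k m => ?_) (fun x m => ?_) (fun e m => ?_) a m
  · ext x y
    rw [LeavittSystem.Sections.algebraMap_smul_apply,
      LeavittSystem.Sections.algebraMap_smul_apply, unitHom_apply, unitHom_apply,
      unitComponent_apply, unitComponent_apply, smul_ite, smul_zero, ← mul_smul, ← mul_smul,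
      Algebra.commutes]
  · ext t y
    rw [LeavittSystem.Sections.vertex_smul_apply, unitHom_apply, unitComponent_apply, ← mul_smul,
      mul_assoc]
    split_ifs with h1 h2 h2
    · rw [h2, vertex_mul_self, unitHom_apply, unitComponent_apply, if_pos (by rw [h1, h2])]
    · rw [vertex_mul_of_ne h2, mul_zero, zero_smul]
      rfl
    · rw [unitHom_apply, unitComponent_apply, if_neg (by rwa [← h2])]
    · rfl
  · refine LeavittSystem.Sections.ext fun x => ?_
    rw [LeavittSystem.Sections.edge_smul_apply]
    split_ifs with hx
    · subst hx
      change _ = hd.sysQ K e • _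
      -- In each case the path to s(e), followed by e, has to match the element representing e
      -- applied to the path to r(e).
      rcases hd.edge_cases e with h | ⟨i, hi, rfl⟩ | ⟨i, hi, rfl⟩
      · ext y
        rw [hd.sysQ_of_notMem h, hd.ex_smul_apply e h, unitHom_apply, unitHom_apply,
          unitComponent_apply, unitComponent_apply, if_pos rfl, hd.pre_of_notMem h, mon_nil,
          one_mul, ← mul_smul, ← mul_smul, mon_append, mon_singleton, mul_assoc, mul_assoc,
          source_mul_edge, edge_mul_range]
      -- For an inner edge of the cycle the representing idempotent is that of r(e) and fixes the
      -- component; the path to r(e) already is the path to s(e) followed by e.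
      · have h1 := (hd.unitHom K m).p_smul (E.r (hd.D i))
        change hd.sysP K _ • _ = _ at h1
        rw [hd.sysQ_D hi, ← hd.sysP_r_D hi, h1]
        ext y
        rw [unitHom_apply, unitHom_apply, unitComponent_apply, unitComponent_apply,
          π_of_mem (hd.s_D_mem i), π_of_mem (hd.r_D_mem i), hd.pre_s_D (by omega), hd.r_D,
          hd.pre_s_D hi, seg_add, zero_add, mon_append, ← mul_smul, mul_assoc, source_mul_edge]
        change _ = if y = none then (_ * mon K [hd.D i] * _) • m else 0
        rw [mon_singleton, mul_assoc, ← hd.r_D, edge_mul_range]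
      -- The last edge returns to v_0, whose path is empty; the loop supplies the full turn d.
      · have h2 : E.r (hd.D i) = lift d none := by
          rw [hd.r_D, hi, ← hd.D_mod d.length, Nat.mod_self, ← hd.src_eq]
          rfl
        have h3 : hd.unitComponent (K := K) m (E.r (hd.D i)) (none : (E.contract d).Vertex) =
            (vertex (E.r (hd.D i)) : LeavittPathAlgebra K E) • m := by
          refine (hd.unitComponent_apply m _ _).trans ?_
          have h4 : hd.pre (E.r (hd.D i)) = [] :=
            (congrArg hd.pre h2).trans (hd.pre_lift (none : (E.contract d).Vertex))
          rw [if_pos (π_of_mem (hd.r_D_mem i)).symm, h4, mon_nil, one_mul]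
        ext y
        rw [hd.sysQ_D_last hi]
        refine Eq.trans ?_
          (LeavittSystem.Sections.edge_smul_apply (E := E.contract d) none _ y).symm
        refine Eq.trans ?_
          (congrArg (fun n : M => if y = none then mon K (hd.τ none) • n else 0) h3).symm
        rw [hd.τ_none_eq hi, unitHom_apply, unitComponent_apply, π_of_mem (hd.s_D_mem i),
          mon_append, mon_singleton, ← mul_smul, ← mul_smul, mul_assoc, source_mul_edge,
          mul_assoc, edge_mul_range]
    · ext y
      rw [unitHom_apply, unitComponent_apply, ← mul_smul, ← source_mul_edge, mul_assoc,
        ← mul_assoc (vertex x), vertex_mul_of_ne hx, zero_mul, mul_zero, zero_smul, ite_self]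
      rfl

theorem unitHom_bijective : Function.Bijective (hd.unitHom K (M := M)) := by
  constructor
  · rw [injective_iff_map_eq_zero]
    intro m hm
    have h1 (x : E.Vertex) : (vertex x : LeavittPathAlgebra K E) • m = 0 := by
      have h2 : hd.unitComponent (K := K) m x (π d x) = 0 := by
        rw [← unitHom_apply, hm]
        rfl
      rw [unitComponent_apply, if_pos rfl] at h2
      rw [← hd.gmon_mul_mon_pre, mul_smul, h2, smul_zero]
    rw [← one_smul (LeavittPathAlgebra K E) m, ← sum_vertex, Finset.sum_smul,
      Finset.sum_eq_zero fun x _ => h1 x]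
  · intro W
    -- The inverse applies the ghost path γ* at each vertex and adds up; γ x γ* acts as the identity
    -- on the component of W.
    refine ⟨∑ x, (vertex x * gmon K (hd.pre x)) • W x (π d x), ?_⟩
    ext x y
    have h1 := W.p_smul x
    change hd.sysP K x • _ = _ at h1
    rw [← h1, sysP_smul_apply, unitHom_apply, unitComponent_apply]
    congr 1
    rw [Finset.smul_sum, Finset.sum_eq_single x]
    · rw [← mul_smul, mul_assoc, ← mul_assoc (vertex x), vertex_mul_self, mul_assoc]
    · intro t _ ht
      rw [← mul_smul, mul_assoc, ← mul_assoc (vertex x), vertex_mul_of_ne ht.symm, zero_mul,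
        mul_zero, zero_smul]
    · exact fun h => absurd (Finset.mem_univ _) h

variable (K M) in
/-- The unit of the equivalence, on a single module. -/
noncomputable def unitEquiv : M ≃ₗ[LeavittPathAlgebra K E]
    (hd.expandSystem K).Sections ((hd.contractSystem K).Sections M) :=
  LinearEquiv.ofBijective
    { toFun := hd.unitHom K
      map_add' := map_add _
      map_smul' := hd.unitHom_smul } hd.unitHom_bijective

end Unit

/-! ### The equivalence -/

open CategoryTheory

variable (K)

/-- The Morita equivalence between `L_K(E)` and `L_K(F_{E,d})`. -/
noncomputable def moritaEquivalence :
    MoritaEquivalence K (LeavittPathAlgebra K E) (LeavittPathAlgebra K (E.contract d)) where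
  eqv := CategoryTheory.Equivalence.mk (hd.contractSystem K).functor (hd.expandSystem K).functor
    (NatIso.ofComponents (fun M => (hd.unitEquiv K M).toModuleIso) fun {M N} f => by
      refine ModuleCat.hom_ext (LinearMap.ext fun m => ?_)
      refine LeavittSystem.Sections.ext fun x => LeavittSystem.Sections.ext fun y => ?_
      change hd.unitComponent (f.hom m) x y = f.hom (hd.unitComponent m x y)
      -- Naturality: the components of the unit are multiplications by elements of the algebra,
      -- which commute with f.
      rw [unitComponent_apply, unitComponent_apply, apply_ite f.hom, map_zero, map_smul])
    (NatIso.ofComponents (fun N => (hd.counitEquiv K N).toModuleIso) fun {M N} f => by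
      refine ModuleCat.hom_ext (LinearMap.ext
        fun (z : (hd.contractSystem K).Sections ((hd.expandSystem K).Sections M)) => ?_)
      exact (map_sum f.hom (fun y => z y (lift d y)) Finset.univ).symm)
  linear := (hd.contractSystem K).functor_linear

end

end FinGraph.Path.IsSourceCycle

/-! ### Coefficients of elements of `Û` -/

namespace UHat

variable {K : Type w} [Field K] {E : FinGraph.{u, v}} {c : E.Cycle}

theorem algebraMap_smul (k : K) (y : UHat K c) :
    algebraMap K (LeavittPathAlgebra K E) k • y = k • y := by
  rw [smul_def, AlgHom.commutes]
  rfl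

theorem hom_ext' {W : Type*} [AddCommGroup W] [Module K W] {f g : UHat K c →ₗ[K] W}
    (h : ∀ j ∈ c.indexSet, ∀ p, f (α K c j p) = g (α K c j p)) : f = g := by
  suffices H : f ∘ₗ (ofFinsupp K c).toLinearMap = g ∘ₗ (ofFinsupp K c).toLinearMap by
    refine LinearMap.ext fun y => ?_
    simpa using LinearMap.congr_fun H ((ofFinsupp K c).symm y)
  refine Finsupp.lhom_ext fun j p => ?_
  have := h j.1 j.2 p
  rw [α_of_mem j.2] at this
  exact this

/-- The linear map which is `g j` on the summand of index `j`. -/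
noncomputable def ofFamily {W : Type*} [AddCommGroup W] [Module K W]
    (g : ℕ → FormalSeries K c →ₗ[K] W) : UHat K c →ₗ[K] W :=
  (Finsupp.lsum K fun j : c.indexSet => g j.1) ∘ₗ (ofFinsupp K c).symm.toLinearMap

theorem ofFamily_α {W : Type*} [AddCommGroup W] [Module K W]
    (g : ℕ → FormalSeries K c →ₗ[K] W) {j : ℕ} (hj : j ∈ c.indexSet) (p : FormalSeries K c) :
    ofFamily g (α K c j p) = g j p := by
  rw [α_of_mem hj]
  simp [ofFamily]

variable (K c) in
/-- The coefficients of an element of `Û` at the elements `γ α_{c,j}`, for a fixed path `γ`. -/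
noncomputable def coeffs (γ : E.Path) : UHat K c →ₗ[K] (ℕ →₀ K) :=
  ofFamily fun j => Finsupp.lsingle j ∘ₗ FormalSeries.coeff K c γ

theorem coeffs_α (γ : E.Path) {j : ℕ} (hj : j ∈ c.indexSet) (p : FormalSeries K c) :
    coeffs K c γ (α K c j p) = Finsupp.single j (FormalSeries.coeff K c γ p) :=
  ofFamily_α _ hj p

theorem coeffs_apply (γ : E.Path) (y : UHat K c) (j : c.indexSet) :
    coeffs K c γ y j.1 = FormalSeries.coeff K c γ ((ofFinsupp K c).symm y j) := by
  suffices H : Finsupp.lapply j.1 ∘ₗ coeffs K c γ = FormalSeries.coeff K c γ ∘ₗ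
      Finsupp.lapply j ∘ₗ (ofFinsupp K c).symm.toLinearMap from LinearMap.congr_fun H y
  refine hom_ext' fun i hi p => ?_
  rw [LinearMap.comp_apply, coeffs_α _ hi, α_of_mem hi]
  simp only [Finsupp.lapply_apply, LinearMap.comp_apply, LinearEquiv.coe_coe,
    LinearEquiv.symm_apply_apply]
  by_cases h : i = j.1
  · obtain rfl : (⟨i, hi⟩ : c.indexSet) = j := Subtype.ext h
    rw [Finsupp.single_eq_same, Finsupp.single_eq_same]
  · rw [Finsupp.single_eq_of_ne (Ne.symm h),
      Finsupp.single_eq_of_ne (fun h1 => h (congrArg Subtype.val h1).symm), map_zero]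

theorem ext_coeffs {y z : UHat K c} (h : ∀ γ ∈ c.pathSet, coeffs K c γ y = coeffs K c γ z) :
    y = z := by
  refine (ofFinsupp K c).symm.injective (Finsupp.ext fun j => FormalSeries.ext_coeff fun γ hγ => ?_)
  rw [← coeffs_apply, ← coeffs_apply, h γ hγ]

variable (K) in
/-- The action of the inverse of a proper cycle on the coefficients. -/
noncomputable def twist : (ℕ →₀ K) →ₗ[K] (ℕ →₀ K) :=
  Finsupp.lsum K fun j => ∑ l ∈ Finset.range j, (-1 : K) ^ l • Finsupp.lsingle (j - l)

theorem twist_single (j : ℕ) (a : K) : twist K (Finsupp.single j a) =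
    ∑ l ∈ Finset.range j, (-1 : K) ^ l • Finsupp.single (j - l) a := by
  simp [twist]

open Classical in
theorem coeffs_vertex_smul (γ : E.Path) (x : E.Vertex) (y : UHat K c) :
    coeffs K c γ ((vertex x : LeavittPathAlgebra K E) • y) =
      if γ.src = x then coeffs K c γ y else 0 := by
  rw [vertex_smul]
  suffices H : coeffs K c γ ∘ₗ actVertex K c x = if γ.src = x then coeffs K c γ else 0 by
    have := LinearMap.congr_fun H y
    rw [LinearMap.comp_apply] at this
    rw [this]
    split_ifs <;> rfl
  refine hom_ext' fun j hj p => ?_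
  rw [LinearMap.comp_apply, actVertex_α, coeffs_α _ hj, FormalSeries.coeff_proj]
  split_ifs
  · rw [coeffs_α _ hj]
  · simp

theorem coeffs_actGhost_α {γ : E.Path} (e : E.Edge) {j : ℕ}
    (hj : j ∈ c.indexSet) (p : FormalSeries K c) :
    coeffs K c γ (actGhost K c e (α K c j p)) =
      Finsupp.single j (FormalSeries.coeff K c γ (FormalSeries.strip K c e p)) +
        twist K (Finsupp.single j (FormalSeries.coeff K c γ (FormalSeries.unroll K c e p))) := by
  rw [actGhost_α, map_add, coeffs_α _ hj, twist_single, map_sum]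
  congr 1
  refine Finset.sum_congr rfl fun l hl => ?_
  rw [map_smul]
  -- For a sink there is no unrolling; for a proper cycle every index j - l with l < j is at least 1
  -- and so lies in the index set.
  by_cases h : c.1.edges = []
  · simp [unroll_of_edges_eq_nil h]
  · have := Finset.mem_range.1 hl
    rw [coeffs_α _ ⟨by omega, fun h1 => absurd h1 h⟩]

/-- The exceptional term of the action of e* lives at e_2⋯e_n only, where eγ would be c, and c is
not in P_c. -/
theorem coeffs_ghost_smul_of_mem {γ : E.Path} {e : E.Edge} (h : E.r e = γ.src)
    (hm : Path.cons e γ h ∈ c.pathSet) (y : UHat K c) :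
    coeffs K c γ ((ghost e : LeavittPathAlgebra K E) • y) = coeffs K c (Path.cons e γ h) y := by
  rw [ghost_smul]
  suffices H : coeffs K c γ ∘ₗ actGhost K c e = coeffs K c (Path.cons e γ h) from
    LinearMap.congr_fun H y
  refine hom_ext' fun j hj p => ?_
  rw [LinearMap.comp_apply, coeffs_actGhost_α e hj, coeffs_α _ hj,
    FormalSeries.coeff_strip (Cycle.mem_of_cons_mem hm), dif_pos h, FormalSeries.coeff_unroll,
    if_neg, Finsupp.single_zero, map_zero, add_zero]
  rintro ⟨h1, rfl⟩
  obtain ⟨hr, h5⟩ := FormalSeries.cycle_eq_cons h1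
  rw [← h5] at hm
  exact FormalSeries.self_notMem h1 hm

/-- Here the ordinary term vanishes, since c is not in P_c, and only the exceptional term remains.
-/
theorem coeffs_ghost_smul_of_eq {γ : E.Path} {e : E.Edge} (h : E.r e = γ.src)
    (hm : γ ∈ c.pathSet) (hc : c.1 = Path.cons e γ h) (y : UHat K c) :
    coeffs K c γ ((ghost e : LeavittPathAlgebra K E) • y) =
      twist K (coeffs K c (Path.trivial c.1.src) y) := by
  have h1 : c.1.edges.head? = some e := by rw [hc]; rfl
  have h2 : γ = c.1.tail := by rw [hc, Path.tail_cons]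
  rw [ghost_smul]
  suffices H : coeffs K c γ ∘ₗ actGhost K c e = twist K ∘ₗ coeffs K c (Path.trivial c.1.src) from
    LinearMap.congr_fun H y
  refine hom_ext' fun j hj p => ?_
  rw [LinearMap.comp_apply, coeffs_actGhost_α e hj, LinearMap.comp_apply, coeffs_α _ hj,
    FormalSeries.coeff_strip hm, dif_pos h, ← hc,
    FormalSeries.coeff_of_notMem (FormalSeries.self_notMem h1), FormalSeries.coeff_unroll,
    if_pos ⟨h1, h2⟩, Finsupp.single_zero, zero_add]

theorem coeffs_ghost_smul_of_ne {γ : E.Path} {e : E.Edge} (h : E.r e ≠ γ.src) (y : UHat K c) :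
    coeffs K c γ ((ghost e : LeavittPathAlgebra K E) • y) = 0 := by
  rw [← range_mul_ghost, mul_smul, coeffs_vertex_smul, if_neg h.symm]

/-- The coefficients at a path are those at `s(c)` after the action of the ghost path. -/
theorem coeffs_eq {γ : E.Path} (hγ : γ ∈ c.pathSet) (y : UHat K c) :
    coeffs K c γ y = coeffs K c (Path.trivial c.1.src) (gmon K γ.edges • y) := by
  obtain ⟨n, hn⟩ : ∃ n, γ.edges.length = n := ⟨_, rfl⟩
  induction n generalizing γ y with
  | zero =>
    rcases Path.eq_trivial_or_cons γ with h0 | ⟨e, δ, h, rfl⟩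
    · have h1 : γ.tgt = γ.src := by rw [h0]; rfl
      have h2 : γ = Path.trivial c.1.src := by rw [← hγ.1, h1]; exact h0
      subst h2
      exact congrArg _ (one_smul _ y).symm
    · simp at hn
  | succ n ih =>
    rcases Path.eq_trivial_or_cons γ with h0 | ⟨e, δ, h, rfl⟩
    · rw [h0] at hn
      simp [Path.trivial] at hn
    · rw [Path.cons_edges, gmon_cons, mul_smul, ← ih (Cycle.mem_of_cons_mem hγ) _
        (by simpa using hn), coeffs_ghost_smul_of_mem h hγ]

/-- Write c* = (e_2⋯e_n)* e_1*: the exceptional rule for e_1* gives the coefficient at e_2⋯e_n,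
which is then transported to s(c). This describes `twist` without reference to the graph. -/
theorem coeffs_gmon_cycle (hc : c.1.edges ≠ []) (y : UHat K c) :
    coeffs K c (Path.trivial c.1.src) (gmon K c.1.edges • y) =
      twist K (coeffs K c (Path.trivial c.1.src) y) := by
  rcases Path.eq_trivial_or_cons c.1 with h0 | ⟨e, δ, h, h0⟩
  · exact absurd (by rw [h0]; rfl) hc
  · have hδ : δ ∈ c.pathSet := by
      have := Cycle.tail_mem hc
      rwa [h0, Path.tail_cons] at this
    have h1 : c.1.edges = e :: δ.edges := by rw [h0]; rfl
    rw [h1, gmon_cons, mul_smul, ← coeffs_eq hδ, coeffs_ghost_smul_of_eq h hδ h0]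

end UHat

namespace FinGraph.Path.IsSourceCycle

section

open scoped Classical

variable {K : Type w} [Field K] {E : FinGraph.{u, v}} {d : E.Path} (hd : d.IsSourceCycle)

/-! ### Comparison of `Û` for `E` and for the contracted graph -/

section Transfer

variable {c : E.Cycle} {c' : (E.contract d).Cycle} (T : c'.pathSet → c.pathSet)

variable (K) in
/-- The restriction of series along a map between sets of paths. -/
noncomputable def pull : UHat K c →ₗ[K] UHat K c' :=
  UHat.ofFamily fun j => UHat.α K c' j ∘ₗ LinearMap.funLeft K K T

variable (K) in
/-- The extension of series by zero along a map between sets of paths. -/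
noncomputable def push : UHat K c' →ₗ[K] UHat K c :=
  UHat.ofFamily fun j => UHat.α K c j ∘ₗ Function.ExtendByZero.linearMap K T

/-- The hypothesis `hidx` makes both cycles sinks or both proper, so the index sets agree and no
summand is lost. -/
theorem coeffs_pull (hidx : c.1.edges = [] ↔ c'.1.edges = []) (γ : c'.pathSet) (y : UHat K c) :
    UHat.coeffs K c' γ.1 (pull K T y) = UHat.coeffs K c (T γ).1 y := by
  suffices H : UHat.coeffs K c' γ.1 ∘ₗ pull K T = UHat.coeffs K c (T γ).1 from
    LinearMap.congr_fun H y
  refine UHat.hom_ext' fun j hj p => ?_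
  have hj' : j ∈ c'.indexSet := ⟨hj.1, fun h => hj.2 (hidx.2 h)⟩
  rw [LinearMap.comp_apply, pull, UHat.ofFamily_α _ hj, LinearMap.comp_apply,
    UHat.coeffs_α _ hj', UHat.coeffs_α _ hj, FormalSeries.coeff_of_mem γ.2,
    FormalSeries.coeff_of_mem (T γ).2]
  rfl

theorem coeffs_push (hidx : c.1.edges = [] ↔ c'.1.edges = []) (hT : Function.Injective T)
    (γ : c'.pathSet) (y : UHat K c') :
    UHat.coeffs K c (T γ).1 (push K T y) = UHat.coeffs K c' γ.1 y := by
  suffices H : UHat.coeffs K c (T γ).1 ∘ₗ push K T = UHat.coeffs K c' γ.1 from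
    LinearMap.congr_fun H y
  refine UHat.hom_ext' fun j hj p => ?_
  have hj' : j ∈ c.indexSet := ⟨hj.1, fun h => hj.2 (hidx.1 h)⟩
  rw [LinearMap.comp_apply, push, UHat.ofFamily_α _ hj, LinearMap.comp_apply,
    UHat.coeffs_α _ hj', UHat.coeffs_α _ hj, FormalSeries.coeff_of_mem γ.2,
    FormalSeries.coeff_of_mem (T γ).2, Function.ExtendByZero.linearMap_apply]
  exact congrArg _ (hT.extend_apply _ _ _)

variable (K) in
/-- The underlying additive map of the comparison. -/
noncomputable def compareHom : (hd.contractSystem K).Sections (UHat K c) →+ UHat K c' where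
  toFun z := ∑ y, pull K T (z y)
  map_zero' := Finset.sum_eq_zero fun _ _ => map_zero _
  map_add' z w := by
    rw [← Finset.sum_add_distrib]
    exact Finset.sum_congr rfl fun y _ => map_add _ _ _

variable {T}

/-- The series z(y) involves only paths starting at `lift d y`, and these points are distinct; hence
a single summand contributes to the coefficient at γ. -/
theorem coeffs_compareHom (hidx : c.1.edges = [] ↔ c'.1.edges = [])
    (hsrc : ∀ γ, (T γ).1.src = lift d γ.1.src) (γ : c'.pathSet)
    (z : (hd.contractSystem K).Sections (UHat K c)) :
    UHat.coeffs K c' γ.1 (hd.compareHom K T z) = UHat.coeffs K c (T γ).1 (z γ.1.src) := by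
  change UHat.coeffs K c' γ.1 (∑ y, pull K T (z y)) = _
  rw [map_sum, Finset.sum_eq_single γ.1.src]
  · rw [coeffs_pull T hidx]
  · intro y _ hy
    rw [coeffs_pull T hidx, ← hd.vertex_lift_smul_apply z y, UHat.coeffs_vertex_smul, if_neg]
    rw [hsrc]
    exact fun h => hy (hd.lift_injective h).symm
  · exact fun h => absurd (Finset.mem_univ _) h

/-- The hypotheses say that T turns an edge e of F into its path in E: `hcons` as long as the path
stays in the path set, `hcyc` when it closes the cycle, where a full turn of c appears at the end.
-/
theorem compareHom_smul (hidx : c.1.edges = [] ↔ c'.1.edges = [])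
    (hsrc : ∀ γ, (T γ).1.src = lift d γ.1.src)
    (hcons : ∀ (e : (E.contract d).Edge) (γ : c'.pathSet) (h : (E.contract d).r e = γ.1.src)
      (hm : Path.cons e γ.1 h ∈ c'.pathSet),
      (T ⟨Path.cons e γ.1 h, hm⟩).1.edges = hd.τ e ++ (T γ).1.edges)
    (hcyc : ∀ (e : (E.contract d).Edge) (γ : c'.pathSet) (h : (E.contract d).r e = γ.1.src),
      c'.1 = Path.cons e γ.1 h → hd.τ e ++ (T γ).1.edges =
        (T ⟨Path.trivial c'.1.src, c'.trivial_mem⟩).1.edges ++ c.1.edges)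
    (a : LeavittPathAlgebra K (E.contract d)) (z : (hd.contractSystem K).Sections (UHat K c)) :
    hd.compareHom K T (a • z) = a • hd.compareHom K T z := by
  -- Ghost edges are the convenient generators: the coefficients of e*u at γ with s(γ) = r(e) are
  -- read off from the coefficients of u at one path.
  refine map_smul_of_ghosts (hd.compareHom K T) (fun k z => ?_) (fun y z => ?_) (fun e z => ?_) a z
  · refine UHat.ext_coeffs fun γ hγ => ?_
    rw [UHat.algebraMap_smul, LinearMap.map_smul, hd.coeffs_compareHom hidx hsrc ⟨γ, hγ⟩,
      hd.coeffs_compareHom hidx hsrc ⟨γ, hγ⟩, LeavittSystem.Sections.algebraMap_smul_apply,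
      UHat.algebraMap_smul, LinearMap.map_smul]
  · refine UHat.ext_coeffs fun γ hγ => ?_
    rw [UHat.coeffs_vertex_smul, hd.coeffs_compareHom hidx hsrc ⟨γ, hγ⟩,
      hd.coeffs_compareHom hidx hsrc ⟨γ, hγ⟩, LeavittSystem.Sections.vertex_smul_apply]
    split_ifs with h
    · rw [h]
    · exact map_zero _
  · refine UHat.ext_coeffs fun γ hγ => ?_
    rw [hd.coeffs_compareHom hidx hsrc ⟨γ, hγ⟩, LeavittSystem.Sections.ghost_smul_apply]
    by_cases h : (E.contract d).r e = γ.src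
    · rw [if_pos h.symm]
      change UHat.coeffs K c _ (gmon K (hd.τ e) • _) = _
      rw [UHat.coeffs_eq (T ⟨γ, hγ⟩).2, ← mul_smul, ← gmon_append]
      rcases Cycle.cons_mem_or h hγ with hm | hm
      · rw [UHat.coeffs_ghost_smul_of_mem h hm,
          hd.coeffs_compareHom hidx hsrc ⟨Path.cons e γ h, hm⟩, UHat.coeffs_eq (T _).2,
          hcons e ⟨γ, hγ⟩ h hm]
        rfl
      · have h1 : c.1.edges ≠ [] := by
          intro h1
          have h2 := hidx.1 h1
          rw [hm] at h2
          exact List.cons_ne_nil _ _ h2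
        have h3 : c'.1.src = (E.contract d).s e := by rw [hm]; rfl
        -- In F, closing the cycle twists the coefficients; in E, `hcyc` produces the factor c*,
        -- which twists them in the same way.
        rw [UHat.coeffs_ghost_smul_of_eq h hγ hm,
          hd.coeffs_compareHom hidx hsrc ⟨_, c'.trivial_mem⟩, UHat.coeffs_eq (T _).2,
          ← UHat.coeffs_gmon_cycle h1, hcyc e ⟨γ, hγ⟩ h hm, gmon_append, mul_smul, ← h3]
        rfl
    · rw [if_neg (Ne.symm h), UHat.coeffs_ghost_smul_of_ne h, map_zero]

/-- T is a bijection onto the paths of P_c starting at a representative of a vertex of F, and a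
family in the sections consists of series on exactly these paths. -/
theorem compareHom_bijective (hidx : c.1.edges = [] ↔ c'.1.edges = [])
    (hsrc : ∀ γ, (T γ).1.src = lift d γ.1.src) (hT : Function.Injective T)
    (hsurj : ∀ (γ : c.pathSet) (y : (E.contract d).Vertex), γ.1.src = lift d y → ∃ δ, T δ = γ) :
    Function.Bijective (hd.compareHom K T) := by
  constructor
  · rw [injective_iff_map_eq_zero]
    intro z hz
    refine LeavittSystem.Sections.ext fun y => UHat.ext_coeffs fun γ hγ => ?_
    rw [LeavittSystem.Sections.zero_apply, map_zero]
    by_cases h : γ.src = lift d y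
    · obtain ⟨δ, hδ⟩ := hsurj ⟨γ, hγ⟩ y h
      have h1 := hd.coeffs_compareHom hidx hsrc δ z
      have h2 : δ.1.src = y := hd.lift_injective (by rw [← hsrc, hδ, h])
      rw [hz, map_zero, hδ, h2] at h1
      exact h1.symm
    · rw [← hd.vertex_lift_smul_apply z y, UHat.coeffs_vertex_smul, if_neg h]
  · intro u
    -- The preimage of u: extend by zero along T, then sort the result by the sources of the paths.
    let z : (hd.contractSystem K).Sections (UHat K c) :=
      ⟨fun y => (vertex (lift d y) : LeavittPathAlgebra K E) • push K T u, fun y => by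
        change (vertex (lift d y) : LeavittPathAlgebra K E) • _ = _
        rw [← mul_smul, vertex_mul_self]⟩
    refine ⟨z, UHat.ext_coeffs fun γ hγ => ?_⟩
    rw [hd.coeffs_compareHom hidx hsrc ⟨γ, hγ⟩ z, ← coeffs_push T hidx hT ⟨γ, hγ⟩]
    change UHat.coeffs K c _ ((vertex (lift d γ.src) : LeavittPathAlgebra K E) • push K T u) = _
    rw [UHat.coeffs_vertex_smul, if_pos (hsrc ⟨γ, hγ⟩)]

end Transfer

end

end FinGraph.Path.IsSourceCycle

namespace FinGraph.Path.IsSourceCycle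

section

open scoped Classical

variable {K : Type w} [Field K] {E : FinGraph.{u, v}} {d : E.Path} (hd : d.IsSourceCycle)

/-! ### Paths of the contracted graph and paths of `E` -/

/-- The path of `E` which corresponds to a path of `F_{E,d}`. -/
noncomputable def expand (l : List (E.contract d).Edge) : List E.Edge := l.flatMap hd.τ

theorem expand_cons (e : (E.contract d).Edge) (l : List (E.contract d).Edge) :
    hd.expand (e :: l) = hd.τ e ++ hd.expand l := rfl

theorem expand_append (l m : List (E.contract d).Edge) :
    hd.expand (l ++ m) = hd.expand l ++ hd.expand m := List.flatMap_append

theorem isWalk_expand {l : List (E.contract d).Edge} {x y : (E.contract d).Vertex}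
    (h : (E.contract d).IsWalk x l y) : E.IsWalk (lift d x) (hd.expand l) (lift d y) := by
  induction l generalizing x with
  | nil => exact congrArg (lift d) h
  | cons e l ih => exact isWalk_append.2 ⟨_, h.1 ▸ hd.isWalk_τ e, ih h.2⟩

/-- Unique decoding: the paths of two different edges with the same source part at some point, so
the first edges must agree. -/
theorem expand_injective {l m : List (E.contract d).Edge} {x y z : (E.contract d).Vertex}
    (hl : (E.contract d).IsWalk x l y) (hm : (E.contract d).IsWalk x m z)
    (h : hd.expand l = hd.expand m) : l = m := by
  induction l generalizing x m with
  | nil =>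
    cases m with
    | nil => rfl
    | cons f m =>
      rw [expand_cons] at h
      exact absurd (List.append_eq_nil_iff.1 h.symm).1 (hd.τ_ne_nil f)
  | cons e l ih =>
    cases m with
    | nil =>
      rw [expand_cons] at h
      exact absurd (List.append_eq_nil_iff.1 h).1 (hd.τ_ne_nil e)
    | cons f m =>
      rw [expand_cons, expand_cons] at h
      by_cases hef : e = f
      · subst hef
        rw [ih hl.2 hm.2 (List.append_cancel_left h)]
      · obtain ⟨k, a, b, l₁, l₂, hab, h1, h2⟩ :=
          hd.exists_split_τ hef (hl.1.trans hm.1.symm) (hd.expand l) (hd.expand m)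
        rw [h1, h2] at h
        exact absurd (List.cons_eq_cons.1 (List.append_cancel_left h)).1 hab

theorem expand_edgesToContract (l : List E.Edge) (hl : ∀ e ∈ l, E.s e ∉ d.vertices) :
    hd.expand (edgesToContract hd l hl) = l := by
  induction l with
  | nil => rfl
  | cons e l ih =>
    have h1 : hd.τ (some ⟨e, hd.range_notMem (hl e List.mem_cons_self)⟩) = [e] := by
      change hd.pre (E.s e) ++ [e] = _
      rw [hd.pre_of_notMem (hl e List.mem_cons_self), List.nil_append]
    exact congrArg₂ (· ++ ·) h1 (ih fun f hf => hl f (List.mem_cons_of_mem _ hf))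

/-- A walk in E that starts at v_0 and ends outside d⁰ makes some full turns, which are loops in F,
then a partial turn with an exit, which is one edge φ(f), and never returns to d⁰. -/
theorem exists_expand_eq {m : List E.Edge} {y : (E.contract d).Vertex} {x : E.Vertex}
    (hx : x ∉ d.vertices) (h : E.IsWalk (lift d y) m x) :
    ∃ l, (E.contract d).IsWalk y l (some ⟨x, hx⟩) ∧ hd.expand l = m := by
  rcases y with _ | y
  · obtain ⟨k, hk⟩ : ∃ k, m.length = k := ⟨_, rfl⟩
    induction k using Nat.strong_induction_on generalizing m with
    | _ k ih =>
      have h' : E.IsWalk (E.s (hd.D 0)) m x := by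
        rw [← hd.src_eq]
        exact h
      obtain ⟨n, f, l', rfl, hs, hr, hw⟩ := hd.exists_exit h' hx
      rw [zero_add] at hs
      -- Here n counts the edges of the cycle before the exit. If n ≥ r, a full turn is split off as
      -- a loop and the shorter rest is treated by induction.
      rcases Nat.lt_or_ge n d.length with hn | hn
      · have h1 := hw.source_notMem hd hr
        refine ⟨some ⟨f, hr⟩ :: edgesToContract hd l' h1,
          ⟨?_, isWalk_edgesToContract hd h1 hw hr hx⟩, ?_⟩
        · rw [s_some]
          exact π_of_mem (hs ▸ hd.s_D_mem n)
        · change hd.pre (E.s f) ++ [f] ++ hd.expand (edgesToContract hd l' h1) = _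
          rw [expand_edgesToContract, hs, hd.pre_s_D hn, List.append_assoc]
          rfl
      · obtain ⟨t, rfl⟩ : ∃ t, n = d.length + t := ⟨n - d.length, by omega⟩
        have h2 : hd.seg 0 (d.length + t) = d.edges ++ hd.seg 0 t := by
          rw [seg_add, seg_length, seg_add_length]
        rw [h2, List.append_assoc] at h hk ⊢
        obtain ⟨z, hz1, hz2⟩ := isWalk_append.1 h
        have hz3 : E.IsWalk (lift d none) d.edges (lift d none) := hd.isWalk_τ none
        obtain rfl := hz1.tgt_unique hz3
        have hlt : (hd.seg 0 t ++ f :: l').length < k := by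
          rw [← hk, List.length_append (as := d.edges)]
          have : 0 < d.edges.length := hd.length_pos
          omega
        obtain ⟨l, hl1, hl2⟩ := ih _ hlt hz2 rfl
        exact ⟨none :: l, ⟨rfl, hl1⟩, congrArg (d.edges ++ ·) hl2⟩
  · exact ⟨edgesToContract hd m (h.source_notMem hd y.2),
      isWalk_edgesToContract hd _ h y.2 hx, hd.expand_edgesToContract _ _⟩

/-- The comparison for a cycle which does not meet `d`. -/
theorem nonempty_equiv_of_notMem (c : E.Cycle) (hc : c.1.src ∉ d.vertices) :
    Nonempty ((hd.contractSystem K).Sections (UHat K c) ≃ₗ[LeavittPathAlgebra K (E.contract d)]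
      UHat K (c.toContract hd)) := by
  set c' : (E.contract d).Cycle := c.toContract hd
  have h0 : c' = ⟨Path.toContract hd c.1 hc, Path.IsCycle.toContract hd c.2 hc⟩ := dif_neg hc
  have hsrc' : c'.1.src = some ⟨c.1.src, hc⟩ := by rw [h0]; rfl
  have hexp : hd.expand c'.1.edges = c.1.edges := by
    rw [h0]
    exact hd.expand_edgesToContract _ _
  have hidx : c.1.edges = [] ↔ c'.1.edges = [] := by
    rw [← hexp]
    constructor
    · intro h
      cases h1 : c'.1.edges with
      | nil => rfl
      | cons e l =>
        rw [h1, expand_cons] at h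
        exact absurd (List.append_eq_nil_iff.1 h).1 (hd.τ_ne_nil e)
    · intro h
      rw [h]
      rfl
  have hwc : (E.contract d).IsWalk c'.1.src c'.1.edges c'.1.src := by
    have := c'.1.isWalk
    rwa [c'.2.tgt_eq] at this
  have hw (γ : c'.pathSet) : E.IsWalk (lift d γ.1.src) (hd.expand γ.1.edges) c.1.src := by
    have := hd.isWalk_expand γ.1.isWalk
    rwa [γ.2.1, hsrc'] at this
  -- If the unfolded path ended in c, the part before c would also come from a walk in F, and by
  -- unique decoding γ itself would end in the cycle of F.
  have hmem (γ : c'.pathSet) : (⟨_, _, _, hw γ⟩ : E.Path) ∈ c.pathSet := by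
    refine ⟨rfl, fun hne hsuf => ?_⟩
    obtain ⟨m, hm⟩ := hsuf
    change m ++ c.1.edges = hd.expand γ.1.edges at hm
    have h1 := hw γ
    rw [← hm] at h1
    obtain ⟨z, hz1, hz2⟩ := isWalk_append.1 h1
    have h2 : z = c.1.src := by
      rcases hcs : c.1.edges with _ | ⟨e, l⟩
      · exact absurd hcs hne
      · have h3 := c.1.isWalk
        rw [hcs] at h3 hz2
        exact hz2.1.symm.trans h3.1
    subst h2
    obtain ⟨l, hl1, hl2⟩ := hd.exists_expand_eq hc hz1
    have h4 : l ++ c'.1.edges = γ.1.edges := by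
      refine hd.expand_injective (isWalk_append.2 ⟨_, hl1, hsrc' ▸ hwc⟩) γ.1.isWalk ?_
      rw [expand_append, hl2, hexp, hm]
    exact γ.2.2 (fun h => hne (hidx.2 h)) ⟨l, h4⟩
  let T : c'.pathSet → c.pathSet := fun γ => ⟨⟨_, _, _, hw γ⟩, hmem γ⟩
  have hinj : Function.Injective T := by
    intro γ δ h
    have h1 : γ.1.src = δ.1.src :=
      hd.lift_injective (congrArg (fun p : c.pathSet => p.1.src) h)
    have h2 : hd.expand γ.1.edges = hd.expand δ.1.edges :=
      congrArg (fun p : c.pathSet => p.1.edges) h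
    exact Subtype.ext (Path.ext h1 (γ.2.1.trans δ.2.1.symm)
      (hd.expand_injective γ.1.isWalk (h1 ▸ δ.1.isWalk) h2))
  have hsurj (γ : c.pathSet) (y : (E.contract d).Vertex) (h : γ.1.src = lift d y) :
      ∃ δ, T δ = γ := by
    have h1 := γ.1.isWalk
    rw [h, γ.2.1] at h1
    obtain ⟨l, hl1, hl2⟩ := hd.exists_expand_eq hc h1
    refine ⟨⟨⟨_, _, _, hl1⟩, hsrc'.symm, fun hne hsuf => ?_⟩, ?_⟩
    · refine γ.2.2 (fun h => hne (hidx.1 h)) ?_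
      obtain ⟨m, hm⟩ := hsuf
      refine ⟨hd.expand m, ?_⟩
      rw [← hl2, ← hexp, ← expand_append, hm]
    · exact Subtype.ext (Path.ext h.symm γ.2.1.symm hl2)
  exact ⟨LinearEquiv.ofBijective
    { toFun := hd.compareHom K T
      map_add' := map_add _
      map_smul' := hd.compareHom_smul hidx (fun _ => rfl) (fun _ _ _ _ => rfl)
        (fun e γ h hm => by
          change hd.expand (Path.cons e γ.1 h).edges = [] ++ c.1.edges
          rw [← hm, hexp, List.nil_append]) }
    (hd.compareHom_bijective hidx (fun _ => rfl) hinj hsurj)⟩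

/-! ### Cycles which meet `d` -/

theorem D_congr {i j : ℕ} (h : i % d.length = j % d.length) : hd.D i = hd.D j := by
  rw [← hd.D_mod i, h, hd.D_mod]

theorem seg_congr {i j : ℕ} (h : i % d.length = j % d.length) (n : ℕ) :
    hd.seg i n = hd.seg j n := by
  induction n generalizing i j with
  | zero => rfl
  | succ n ih => rw [seg_succ, seg_succ, hd.D_congr h, ih (Nat.ModEq.add_right 1 h)]

theorem mod_eq_of_s_D_eq {i j : ℕ} (h : E.s (hd.D i) = E.s (hd.D j)) :
    i % d.length = j % d.length := by
  rw [← hd.D_mod i, ← hd.D_mod j] at h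
  exact hd.s_D_inj (Nat.mod_lt _ hd.length_pos) (Nat.mod_lt _ hd.length_pos) h

/-- A cycle which meets `d` is a rotation of `d`. -/
theorem edges_eq_seg (c : E.Cycle) {k : ℕ} (hk : c.1.src = E.s (hd.D k)) :
    c.1.edges = hd.seg k d.length := by
  have hne : c.1.IsProperCycle := by
    refine c.2.resolve_left fun h => h.2 (hd.D k) hk.symm
  have h1 := c.1.isWalk
  rw [hne.2.1, hk] at h1
  -- The closed walk c runs along d, so its length is a positive multiple of r; distinctness of the
  -- sources leaves only r.
  obtain ⟨h2, h3⟩ := hd.eq_seg_of_isWalk h1 (hd.s_D_mem k)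
  have h4 := hd.mod_eq_of_s_D_eq h3
  have h5 : d.length ∣ c.1.edges.length := by
    have : k + 0 ≡ k + c.1.edges.length [MOD d.length] := h4
    exact (Nat.modEq_zero_iff_dvd).1 (Nat.ModEq.add_left_cancel' k this).symm
  have h6 : d.length ≤ c.1.edges.length :=
    Nat.le_of_dvd (List.length_pos_iff.2 hne.1) h5
  have h7 : c.1.edges.length ≤ d.length := by
    -- A longer walk would leave the vertex number k twice.
    by_contra! h7
    obtain ⟨t, ht⟩ : ∃ t, c.1.edges.length = d.length + (t + 1) :=
      ⟨c.1.edges.length - d.length - 1, by omega⟩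
    obtain ⟨r, hr⟩ : ∃ r, d.length = r + 1 := ⟨d.length - 1, by have := hd.length_pos; omega⟩
    have h8 := hne.2.2
    rw [h2, ht, seg_add, seg_add_length, seg_succ] at h8
    nth_rewrite 1 [hr] at h8
    rw [seg_succ, List.map_append, List.nodup_append] at h8
    exact h8.2.2 (E.s (hd.D k)) (by simp) (E.s (hd.D k)) (by simp) rfl
  rw [← le_antisymm h7 h6]
  exact h2

/-- Every edge of F other than the loop ends at an old vertex. -/
theorem eq_nil_or_suffix_of_isWalk {l : List (E.contract d).Edge} {y : (E.contract d).Vertex}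
    (h : (E.contract d).IsWalk y l none) : l = [] ∨ [none] <:+ l := by
  rcases List.eq_nil_or_concat l with h1 | ⟨m, e, rfl⟩
  · exact Or.inl h1
  · right
    rw [List.concat_eq_append] at h ⊢
    obtain ⟨z, -, hz⟩ := isWalk_append.1 h
    rcases e with _ | f
    · exact ⟨m, rfl⟩
    · exact absurd hz.2 (Option.some_ne_none _)

/-- The comparison for a rotation of `d`. -/
theorem nonempty_equiv_of_mem (c : E.Cycle) (hc : c.1.src ∈ d.vertices) :
    Nonempty ((hd.contractSystem K).Sections (UHat K c) ≃ₗ[LeavittPathAlgebra K (E.contract d)]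
      UHat K (c.toContract hd)) := by
  have h0 : c.toContract hd = E.contractLoop d := dif_pos hc
  rw [h0]
  obtain ⟨k, hk, hck⟩ := hd.exists_s_D hc
  have hce := hd.edges_eq_seg c hck.symm
  -- A nonempty path to v̄ ends in the loop and is excluded, so the path set of the loop consists of
  -- v̄ alone.
  have hnil (γ : (E.contractLoop d).pathSet) : γ.1.edges = [] := by
    have h1 := γ.1.isWalk
    rw [γ.2.1] at h1
    exact (eq_nil_or_suffix_of_isWalk h1).resolve_right (γ.2.2 (List.cons_ne_nil _ _))
  have hnone (γ : (E.contractLoop d).pathSet) : γ.1.src = none := by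
    have h1 := γ.1.isWalk
    rw [γ.2.1, hnil] at h1
    exact h1
  have hidx : c.1.edges = [] ↔ (E.contractLoop d).1.edges = [] := by
    refine ⟨fun h => ?_, fun h => absurd h (List.cons_ne_nil _ _)⟩
    have := congrArg List.length (hce.symm.trans h)
    rw [length_seg] at this
    exact absurd this hd.length_pos.ne'
  have hw : E.IsWalk d.src (hd.seg 0 k) c.1.src := by
    have := hd.isWalk_seg 0 k
    rwa [zero_add, hck, ← hd.src_eq] at this
  have hmem : (⟨_, _, _, hw⟩ : E.Path) ∈ c.pathSet := by
    refine ⟨rfl, fun _ hsuf => ?_⟩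
    have := hsuf.length_le
    rw [hce, length_seg, length_seg] at this
    omega
  let T : (E.contractLoop d).pathSet → c.pathSet := fun _ => ⟨⟨_, _, _, hw⟩, hmem⟩
  have hinj : Function.Injective T := fun γ δ _ =>
    Subtype.ext (Path.ext ((hnone γ).trans (hnone δ).symm) (γ.2.1.trans δ.2.1.symm)
      ((hnil γ).trans (hnil δ).symm))
  have hsrc (γ : (E.contractLoop d).pathSet) : (T γ).1.src = lift d γ.1.src := by
    rw [hnone]
    rfl
  have hsurj (γ : c.pathSet) (y : (E.contract d).Vertex) (h : γ.1.src = lift d y) :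
      ∃ δ, T δ = γ := by
    refine ⟨⟨_, Cycle.trivial_mem _⟩, ?_⟩
    have h1 := γ.1.isWalk
    rw [h, γ.2.1] at h1
    rcases y with _ | y
    · have h2 : E.IsWalk (E.s (hd.D 0)) γ.1.edges c.1.src := by
        rw [← hd.src_eq]
        exact h1
      obtain ⟨h3, h4⟩ := hd.eq_seg_of_isWalk h2 hc
      rw [zero_add, ← hck] at h4
      have h5 := hd.mod_eq_of_s_D_eq h4
      -- The walk from v_0 to v_k along d has length congruent to k modulo r; if it had r edges or
      -- more, its last r edges would form c.
      have h6 : γ.1.edges.length < d.length := by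
        by_contra! h6
        refine γ.2.2 (fun h => ?_) ?_
        · have := hidx.1 h
          exact List.cons_ne_nil _ _ this
        · obtain ⟨t, ht⟩ : ∃ t, γ.1.edges.length = t + d.length :=
            ⟨γ.1.edges.length - d.length, by omega⟩
          rw [ht, Nat.add_mod_right] at h5
          rw [h3, ht, seg_add, zero_add, hce, hd.seg_congr h5]
          exact List.suffix_append _ _
      rw [Nat.mod_eq_of_lt hk, Nat.mod_eq_of_lt h6] at h5
      rw [← h5] at h3
      exact Subtype.ext (Path.ext h.symm γ.2.1.symm h3.symm)
    · exact absurd hc (h1.tgt_notMem hd y.2)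
  exact ⟨LinearEquiv.ofBijective
    { toFun := hd.compareHom K T
      map_add' := map_add _
      map_smul' := hd.compareHom_smul hidx hsrc
        (fun e γ h hm => absurd (hnil ⟨_, hm⟩) (List.cons_ne_nil _ _))
        (fun e γ h hm => by
          have h1 : e = none := by
            have h2 := congrArg (fun p : (E.contract d).Path => p.edges.head?) hm
            exact (Option.some.inj h2).symm
          subst h1
          -- The identity d · d_1⋯d_k = d_1⋯d_k · c: both sides are the path of length r + k along
          -- the cycle from v_0.
          change d.edges ++ hd.seg 0 k = hd.seg 0 k ++ c.1.edges
          have h3 := hd.seg_add 0 k d.length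
          rw [Nat.add_comm, seg_add, seg_length, seg_add_length, zero_add] at h3
          rw [hce, h3]) }
    (hd.compareHom_bijective hidx hsrc hinj hsurj)⟩

end

end FinGraph.Path.IsSourceCycle

/-! ### The equivalence and the modules of formal series together -/

theorem lemma5p6 (K : Type w) [Field K] (E : FinGraph.{u, v}) (d : E.Path)
    (hd : d.IsSourceCycle) (hr : 2 ≤ d.length) :
    ∃ G : MoritaEquivalence K (LeavittPathAlgebra K E) (LeavittPathAlgebra K (E.contract d)),
      ∀ c : E.Cycle,
        Nonempty (ModuleCat.of (LeavittPathAlgebra K E) (UHat K c) ≅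
          G.eqv.inverse.obj
            (ModuleCat.of (LeavittPathAlgebra K (E.contract d)) (UHat K (c.toContract hd)))) := by
  refine ⟨hd.moritaEquivalence K, fun c => ?_⟩
  have h : Nonempty ((hd.contractSystem K).Sections (UHat K c)
      ≃ₗ[LeavittPathAlgebra K (E.contract d)] UHat K (c.toContract hd)) := by
    by_cases hc : c.1.src ∈ d.vertices
    · exact hd.nonempty_equiv_of_mem c hc
    · exact hd.nonempty_equiv_of_notMem c hc
  obtain ⟨f⟩ := h
  -- The unit gives Û_E ≅ G_2(G_1(Û_E)), and G_2 is applied to the comparison G_1(Û_E) ≅ Û_F.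
  exact ⟨(hd.moritaEquivalence K).eqv.unitIso.app _ ≪≫
    (hd.moritaEquivalence K).eqv.inverse.mapIso f.toModuleIso⟩
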